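/- **Theorem 3.1 (weak (measure-valued) – strong uniqueness principle).** *Setting.* Let $\Omega=(\mathbb R/\mathbb Z)^3$ be the flat torus and $T>0$. The complete Euler system for the density $\varrho$, temperature $\vartheta$ and velocity $\mathbf u$ is $$\partial_t\varrho+\mathrm{div}_x(\varrho\mathbf u)=0,\qquad \partial_t(\varrho\mathbf u)+\mathrm{div}_x(\varrho\mathbf u\otimes\mathbf u)+\nabla_xp(\varrho,\vartheta)=0,$$ $$\partial_t\big(\tfrac12\varrho|\mathbf u|^2+\varrho e(\varrho,\vartheta)\big)+\mathrm{div}_x\big[\big(\tfrac12\varrho|\mathbf u|^2+\varrho e(\varrho,\vartheta)+p(\varrho,\vartheta)\big)\mathbf u\big]=0.$$ The pressure $p$, the specific internal energy $e>0$ and the specific entropy $s$ are twice continuously differentiable real functions of $(\varrho,\vartheta)\in(0,\infty)^2$ such that for all $\varrho,\vartheta>0$ and a constant $c>0$ $$\vartheta Ds=De+p\,D\big(\tfrac1\varrho\big),\qquad \frac{\partial p}{\partial\varrho}>0,\quad \frac{\partial e}{\partial\vartheta}>0,\qquad |p|\le c\,(1+\varrho+\varrho|s|+\varrho e).$$ *Phase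 variables.* Let $\mathcal F=\{[\varrho,E,\mathbf m]:\varrho\ge0,\ E\ge0,\ \mathbf m\in\mathbb R^3\}$. Call $(\varrho,E)$ regular if $\varrho>0$ and $E=\varrho e(\varrho,\vartheta)$ for some (necessarily unique) $\vartheta>0$; then $s(\varrho,E):=s(\varrho,\vartheta)$ and $p(\varrho,E):=p(\varrho,\vartheta)$. At the other points of $[0,\infty)^2$ let $s(\varrho,E)\in[-\infty,\infty]$ be the upper limit of $s$ at regular points tending to $(\varrho,E)$ ($-\infty$ if there are none nearby), and let $p(\varrho,E)$ be any real values for which, with a constant $c>0$, $|p(\varrho,E)|\le c\,(1+\varrho+\varrho|s(\varrho,E)|+E)$ on $[0,\infty)^2$, where $0\cdot\infty=0$. For $Z:\mathbb R\to\mathbb R$ bounded, continuous and nondecreasing, $Z(\pm\infty)$ denotes the limit. The expression $|\mathbf m|^2/\varrho$ is $0$ if $\mathbf m=0$, and $\infty$ if $\varrho=0\neq\mathbf m$. Write $\langle\nu;G\rangle=\int_{\mathcal F}G\,d\nu$, and let $C^1([0,T]\times\Omega)$ be the functions continuously differentiable up to $t=0$ and $t=T$. *Dissipative measure-valued solutions.*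 Let $\{Y_{0,x}\}_{x\in\Omega}$ be a measurable family of probability measures on $\mathcal F$ with finite total mass $\int_\Omega\langle Y_{0,x};\varrho\rangle dx$ and energy $\int_\Omega\langle Y_{0,x};\frac12\frac{|\mathbf m|^2}\varrho+E\rangle dx$. A weakly-($*$) measurable family $\{Y_{t,x}\}_{(t,x)\in(0,T)\times\Omega}$ of probability measures on $\mathcal F$ and $\mathcal D\in L^\infty(0,T)$ form a dissipative measure-valued solution with initial data $Y_{0,x}$ if the pairings of $Y_{t,x}$ in (i)–(iii) are defined for a.e. $(t,x)$ and integrable on $(0,T)\times\Omega$, and the following hold, where $[\,\cdot\,]_0^\tau$ is the difference of the values at $t=\tau$ and $t=0$. (i) For every $\varphi\in C^1([0,T]\times\Omega)$ and a.e. $\tau\in(0,T)$, $$\Big[\int_\Omega\langle Y_{t,x};\varrho\rangle\varphi\,dx\Big]_{0}^{\tau}=\int_0^\tau\!\!\int_\Omega\big[\langle Y_{t,x};\varrho\rangle\partial_t\varphi+\langle Y_{t,x};\mathbf m\rangle\cdot\nabla_x\varphi\big]dx\,dt.$$ (ii) There are a finite signed matrix-valued Borel measure $\mu_{\mathcal R}$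 on $[0,T]\times\Omega$, with values in $\mathbb R^{3\times3}$, and a constant $c>0$ such that for every $\boldsymbol\varphi\in C^1([0,T]\times\Omega;\mathbb R^3)$ and a.e. $\tau\in(0,T)$ $$\Big[\int_\Omega\langle Y_{t,x};\mathbf m\rangle\cdot\boldsymbol\varphi\,dx\Big]_0^\tau=\int_0^\tau\!\!\int_\Omega\Big[\langle Y_{t,x};\mathbf m\rangle\cdot\partial_t\boldsymbol\varphi+\Big\langle Y_{t,x};\frac{\mathbf m\otimes\mathbf m}{\varrho}\Big\rangle:\nabla_x\boldsymbol\varphi+\langle Y_{t,x};p(\varrho,E)\rangle\,\mathrm{div}_x\boldsymbol\varphi\Big]dx\,dt+\int_{[0,\tau)\times\Omega}\nabla_x\boldsymbol\varphi:d\mu_{\mathcal R},$$ and, for a.e. $\tau\in(0,T)$, the total variation satisfies $\|\mu_{\mathcal R}\|_{\mathcal M([0,\tau)\times\Omega;\mathbb R^{3\times3})}\le c\int_0^\tau\mathcal D(t)\,dt$. (iii) For every bounded, continuous, nondecreasing $Z:\mathbb R\to\mathbb R$, every $\varphi\in C^1([0,T]\times\Omega)$ with $\varphi\ge0$, and a.e.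 $\tau\in(0,T)$, $$\Big[\int_\Omega\langle Y_{t,x};\varrho Z(s(\varrho,E))\rangle\varphi\,dx\Big]_0^\tau\ge\int_0^\tau\!\!\int_\Omega\big[\langle Y_{t,x};\varrho Z(s(\varrho,E))\rangle\partial_t\varphi+\langle Y_{t,x};Z(s(\varrho,E))\mathbf m\rangle\cdot\nabla_x\varphi\big]dx\,dt.$$ (iv) For a.e. $\tau\in(0,T)$ the energy $\int_\Omega\langle Y_{\tau,x};\frac12\frac{|\mathbf m|^2}\varrho+E\rangle dx$ is finite and $$\Big[\int_\Omega\Big\langle Y_{t,x};\frac12\frac{|\mathbf m|^2}{\varrho}+E\Big\rangle dx\Big]_0^\tau+\mathcal D(\tau)=0.$$ *Theorem.* Let $[r,\Theta,\mathbf U]\in C^1([0,T]\times\Omega;\mathbb R\times\mathbb R\times\mathbb R^3)$, with $r>0$ and $\Theta>0$ on $[0,T]\times\Omega$, be a classical solution of the complete Euler system in $(0,T)\times\Omega$, and let its pressure be positive, $p(r,\Theta)>0$ on $[0,T]\times\Omega$ (this is automatic if $p\ge0$ on $(0,\infty)^2$). Put $(r_0,\Theta_0,\mathbf U_0)=(r,\Theta,\mathbf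 U)(0,\cdot)$. Let $(Y_{t,x},\mathcal D)$ be a dissipative measure-valued solution with $$Y_{0,x}=\delta_{[r_0(x),\;r_0e(r_0,\Theta_0)(x),\;r_0\mathbf U_0(x)]}\quad\text{for a.e. }x\in\Omega.$$ Then $\mathcal D=0$ a.e. in $(0,T)$, and $$Y_{t,x}=\delta_{[r(t,x),\;re(r,\Theta)(t,x),\;r\mathbf U(t,x)]}\quad\text{for a.e. }(t,x)\in(0,T)\times\Omega.$$ -/

import Mathlib

open MeasureTheory Set Filter Topology
open scoped NNReal ENNReal

noncomputable section

namespace EulerMV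

/-! ### The flat torus, derivatives and test functions -/

/-- The periodic domain `Ω`, the flat three-dimensional torus of side length `1`. -/
abbrev Torus : Type := UnitAddTorus (Fin 3)

/-- `ℝ³` with the Euclidean norm. -/
abbrev Vec : Type := EuclideanSpace ℝ (Fin 3)

/-- Time derivative of a function of `(t, x)`. -/
def dt (f : ℝ → Torus → ℝ) (t : ℝ) (x : Torus) : ℝ :=
  deriv (fun τ => f τ x) t

/-- Spatial derivative in the `i`-th coordinate direction of a function of `(t, x)`. -/
def dx (i : Fin 3) (f : ℝ → Torus → ℝ) (t : ℝ) (x : Torus) : ℝ :=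
  deriv (fun h : ℝ => f t (x + Pi.single i (h : UnitAddCircle))) 0

/-- Functions of class `C¹([0,T] × Ω)`: the lift to `[0,T] × ℝ³`, periodic in the space variable,
is continuously differentiable up to the boundary points `t = 0` and `t = T`. -/
def IsC1 {V : Type*} [NormedAddCommGroup V] [NormedSpace ℝ V] (T : ℝ) (f : ℝ → Torus → V) : Prop :=
  ContDiffOn ℝ 1
    (fun z : ℝ × (Fin 3 → ℝ) => f z.1 (fun i => (z.2 i : UnitAddCircle)))
    (Icc 0 T ×ˢ univ)

/-! ### Thermodynamics -/

/-- The thermodynamic functions: pressure `p`, specific internal energy `e` and specific entropy `s`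
as functions of `(ϱ, ϑ)`. Only their values for `ϱ > 0`, `ϑ > 0` are relevant. -/
structure ThermoFunctions where
  p : ℝ × ℝ → ℝ
  e : ℝ × ℝ → ℝ
  s : ℝ × ℝ → ℝ

/-- The set of pairs `(ϱ, ϑ)` with `ϱ > 0` and `ϑ > 0`. -/
def Quadrant : Set (ℝ × ℝ) := Ioi 0 ×ˢ Ioi 0

/-- The thermodynamic functions are twice continuously differentiable on `(0,∞)²` and the internal
energy is positive there (so that `(ϱ, ϑ) ↦ (ϱ, ϱ e(ϱ, ϑ))` maps `(0,∞)²` to itself). -/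
structure IsRegular (F : ThermoFunctions) : Prop where
  p_smooth : ContDiffOn ℝ 2 F.p Quadrant
  e_smooth : ContDiffOn ℝ 2 F.e Quadrant
  s_smooth : ContDiffOn ℝ 2 F.s Quadrant
  e_pos : ∀ z ∈ Quadrant, 0 < F.e z

/-- Gibbs' relation `ϑ Ds = De + p D(1/ϱ)`. -/
def GibbsRelation (F : ThermoFunctions) : Prop :=
  ∀ z ∈ Quadrant,
    z.2 • fderiv ℝ F.s z = fderiv ℝ F.e z + F.p z • fderiv ℝ (fun w : ℝ × ℝ => 1 / w.1) z

/-- Thermodynamic stability `∂p/∂ϱ > 0`, `∂e/∂ϑ > 0`. -/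
def ThermoStable (F : ThermoFunctions) : Prop :=
  ∀ ϱ θ : ℝ, 0 < ϱ → 0 < θ →
    0 < deriv (fun ϱ' => F.p (ϱ', θ)) ϱ ∧ 0 < deriv (fun θ' => F.e (ϱ, θ')) θ

/-- The growth condition `|p| ≤ c (1 + ϱ + ϱ |s| + ϱ e)`. -/
def PressureGrowth (F : ThermoFunctions) : Prop :=
  ∃ c : ℝ, 0 < c ∧ ∀ ϱ θ : ℝ, 0 < ϱ → 0 < θ →
    |F.p (ϱ, θ)| ≤ c * (1 + ϱ + ϱ * |F.s (ϱ, θ)| + ϱ * F.e (ϱ, θ))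

/-! ### The phase space `[ϱ, E, m]` -/

/-- The phase space `[0,∞) × [0,∞) × ℝ³` with elements `[ϱ, E, m]`: density, internal energy density,
momentum. -/
abbrev Phase : Type := ℝ≥0 × ℝ≥0 × Vec

/-- The specific entropy `s(ϱ, E)` in the phase variables. At a state `(ϱ, ϱ e(ϱ, ϑ))` with
`ϱ, ϑ > 0` this is `s(ϱ, ϑ)`, see `entropy_eq`. At the remaining points it is the upper limit of the
values at nearby states of this form, which is `-∞` if there are none. -/
def entropy (F : ThermoFunctions) (ϱ E : ℝ≥0) : EReal :=
  limsup (fun z : ℝ × ℝ => (F.s z : EReal))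
    (comap (fun z : ℝ × ℝ => (z.1, z.1 * F.e z)) (𝓝 ((ϱ : ℝ), (E : ℝ))) ⊓ 𝓟 Quadrant)

lemma quadrant_mem_nhds {ϱ θ : ℝ} (hϱ : 0 < ϱ) (hθ : 0 < θ) : Quadrant ∈ 𝓝 (ϱ, θ) :=
  (isOpen_Ioi.prod isOpen_Ioi).mem_nhds ⟨hϱ, hθ⟩

/-- At a state `(ϱ, ϱ e(ϱ, ϑ))` the entropy in the phase variables is `s(ϱ, ϑ)`. -/
theorem entropy_eq (F : ThermoFunctions) (hreg : IsRegular F) (hstab : ThermoStable F)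
    {ϱ θ : ℝ} (hϱ : 0 < ϱ) (hθ : 0 < θ) :
    entropy F ϱ.toNNReal (ϱ * F.e (ϱ, θ)).toNNReal = (F.s (ϱ, θ) : EReal) := by
  have hcont : ∀ a b : ℝ, 0 < a → 0 < b → ContinuousAt F.e (a, b) := fun a b ha hb =>
    hreg.e_smooth.continuousOn.continuousAt (quadrant_mem_nhds ha hb)
  have hscont : ContinuousAt F.s (ϱ, θ) :=
    hreg.s_smooth.continuousOn.continuousAt (quadrant_mem_nhds hϱ hθ)
  have hmono : ∀ a : ℝ, 0 < a → StrictMonoOn (fun b => F.e (a, b)) (Ioi 0) := by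
    intro a ha
    refine strictMonoOn_of_deriv_pos (convex_Ioi 0) ?_ ?_
    · intro b hb
      have h1 : ContinuousAt (fun b : ℝ => (a, b)) b := by fun_prop
      exact (ContinuousAt.comp (f := fun b : ℝ => (a, b)) (hcont a b ha hb) h1).continuousWithinAt
    · intro b hb
      rw [interior_Ioi] at hb
      exact (hstab a b ha hb).2
  have hE : 0 < F.e (ϱ, θ) := hreg.e_pos _ ⟨hϱ, hθ⟩
  unfold entropy
  rw [Real.coe_toNNReal _ hϱ.le, Real.coe_toNNReal _ (mul_pos hϱ hE).le]
  set g : ℝ × ℝ → ℝ × ℝ := fun z => (z.1, z.1 * F.e z) with hg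
  have hge : 𝓝 (ϱ, θ) ≤ comap g (𝓝 (ϱ, ϱ * F.e (ϱ, θ))) ⊓ 𝓟 Quadrant := by
    refine le_inf ?_ (le_principal_iff.2 (quadrant_mem_nhds hϱ hθ))
    rw [← tendsto_iff_comap]
    exact continuousAt_fst.prodMk (continuousAt_fst.mul (hcont ϱ θ hϱ hθ))
  have hle : comap g (𝓝 (ϱ, ϱ * F.e (ϱ, θ))) ⊓ 𝓟 Quadrant ≤ 𝓝 (ϱ, θ) := by
    have htend : Tendsto g (comap g (𝓝 (ϱ, ϱ * F.e (ϱ, θ))) ⊓ 𝓟 Quadrant)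
        (𝓝 (ϱ, ϱ * F.e (ϱ, θ))) := tendsto_comap.mono_left inf_le_left
    have hQ : ∀ᶠ z in comap g (𝓝 (ϱ, ϱ * F.e (ϱ, θ))) ⊓ 𝓟 Quadrant, z ∈ Quadrant :=
      mem_inf_of_right (mem_principal_self _)
    have h1 : Tendsto (fun z : ℝ × ℝ => z.1)
        (comap g (𝓝 (ϱ, ϱ * F.e (ϱ, θ))) ⊓ 𝓟 Quadrant) (𝓝 ϱ) :=
      (continuous_fst.tendsto _).comp htend
    have h2 : Tendsto (fun z : ℝ × ℝ => z.1 * F.e z)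
        (comap g (𝓝 (ϱ, ϱ * F.e (ϱ, θ))) ⊓ 𝓟 Quadrant) (𝓝 (ϱ * F.e (ϱ, θ))) :=
      (continuous_snd.tendsto _).comp htend
    have hb : ∀ b : ℝ, 0 < b → Tendsto (fun z : ℝ × ℝ => z.1 * F.e (z.1, b))
        (comap g (𝓝 (ϱ, ϱ * F.e (ϱ, θ))) ⊓ 𝓟 Quadrant) (𝓝 (ϱ * F.e (ϱ, b))) := by
      intro b hb
      exact h1.mul ((hcont ϱ b hϱ hb).tendsto.comp (h1.prodMk_nhds tendsto_const_nhds))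
    have h3 : Tendsto (fun z : ℝ × ℝ => z.2)
        (comap g (𝓝 (ϱ, ϱ * F.e (ϱ, θ))) ⊓ 𝓟 Quadrant) (𝓝 θ) := by
      rw [tendsto_order]
      constructor
      · intro a ha
        have hm : 0 < max a (θ / 2) := lt_max_of_lt_right (by linarith)
        have hlt : max a (θ / 2) < θ := max_lt ha (by linarith)
        have hlt' := mul_lt_mul_of_pos_left (hmono ϱ hϱ hm hθ hlt) hϱ
        filter_upwards [hQ, (hb _ hm).eventually_lt h2 hlt'] with z hz hz'
        have := lt_of_mul_lt_mul_left hz' (le_of_lt hz.1)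
        exact (le_max_left _ _).trans_lt (((hmono z.1 hz.1).lt_iff_lt hm hz.2).1 this)
      · intro a ha
        have hm : 0 < a := hθ.trans ha
        have hlt' := mul_lt_mul_of_pos_left (hmono ϱ hϱ hθ hm ha) hϱ
        filter_upwards [hQ, h2.eventually_lt (hb _ hm) hlt'] with z hz hz'
        have := lt_of_mul_lt_mul_left hz' (le_of_lt hz.1)
        exact ((hmono z.1 hz.1).lt_iff_lt hz.2 hm).1 this
    exact h1.prodMk_nhds h3
  rw [le_antisymm hle hge]
  exact Tendsto.limsup_eq ((continuous_coe_real_ereal.tendsto _).comp hscont.tendsto)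

/-- `P` is a version of the pressure `p(ϱ, E)` in the phase variables: it has the value prescribed by
the thermodynamic functions at all states `(ϱ, ϱ e(ϱ, ϑ))` with `ϱ, ϑ > 0`. At the remaining points
of the phase space (the vacuum in particular), where the thermodynamic functions prescribe nothing,
its value is arbitrary within the growth condition `|P| ≤ c (1 + ϱ + ϱ |s| + E)`, where
`0 * ∞ = 0`. -/
structure IsPhasePressure (F : ThermoFunctions) (P : ℝ≥0 → ℝ≥0 → ℝ) : Prop where
  eq_p : ∀ ϱ θ : ℝ, 0 < ϱ → 0 < θ →
    P ϱ.toNNReal (ϱ * F.e (ϱ, θ)).toNNReal = F.p (ϱ, θ)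
  growth : ∃ c : ℝ≥0, 0 < c ∧ ∀ ϱ E : ℝ≥0,
    ENNReal.ofReal |P ϱ E| ≤ c * (1 + ϱ + ϱ * (entropy F ϱ E).abs + E)

/-- A cut-off function `Z : ℝ → ℝ` evaluated at an extended real, `Z(±∞)` being the limit at `±∞`
if `Z` is bounded and nondecreasing. -/
def cutoff (Z : ℝ → ℝ) (σ : EReal) : ℝ :=
  if σ = ⊥ then ⨅ a, Z a else if σ = ⊤ then ⨆ a, Z a else Z σ.toReal

/-- The energy density `|m|² / (2 ϱ) + E`; the first term is `0` if `m = 0` and `∞` if `ϱ = 0` and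
`m ≠ 0`. -/
def energyDensity (z : Phase) : ℝ≥0∞ :=
  ‖z.2.2‖ₑ ^ 2 / (2 * (z.1 : ℝ≥0∞)) + z.2.1

/-! ### Parameterized measures -/

/-- The duality pairing `⟨ν; G⟩`. -/
def pairing (ν : Measure Phase) (G : Phase → ℝ) : ℝ := ∫ z, G z ∂ν

/-- The Lebesgue measure on `(0,T) × Ω`. -/
def spaceTime (T : ℝ) : Measure (ℝ × Torus) :=
  (volume.restrict (Ioo 0 T)).prod volume

/-- `⟨Y_{t,x}; G⟩` makes sense for a.e. `(t,x)` and is an integrable function on `(0,T) × Ω`. -/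
def PairingIntegrable (T : ℝ) (Y : ℝ → Torus → Measure Phase) (G : Phase → ℝ) : Prop :=
  (∀ᵐ q ∂spaceTime T, Integrable G (Y q.1 q.2)) ∧
    Integrable (fun q : ℝ × Torus => pairing (Y q.1 q.2) G) (spaceTime T)

/-- The total energy `∫_Ω ⟨ν_x; |m|²/(2ϱ) + E⟩ dx`. -/
def totalEnergy (ν : Torus → Measure Phase) : ℝ≥0∞ :=
  ∫⁻ x, ∫⁻ z, energyDensity z ∂ν x

/-- A family `{Y_{t,x}}` of measures on the phase space is a Young measure on `(0,T) × Ω`: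
it is (weakly-star) measurable and consists of probability measures. -/
structure IsYoungMeasure (T : ℝ) (Y : ℝ → Torus → Measure Phase) : Prop where
  measurable : AEMeasurable (fun q : ℝ × Torus => Y q.1 q.2) (spaceTime T)
  probability : ∀ᵐ q ∂spaceTime T, IsProbabilityMeasure (Y q.1 q.2)

/-- An admissible initial Young measure: it is measurable, consists of probability measures, and has
finite total mass and energy. -/
structure IsInitialMeasure (Y₀ : Torus → Measure Phase) : Prop where
  measurable : AEMeasurable Y₀ volume
  probability : ∀ᵐ x, IsProbabilityMeasure (Y₀ x)
  mass : ∫⁻ x, ∫⁻ z, (z.1 : ℝ≥0∞) ∂Y₀ x ≠ ⊤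
  energy : totalEnergy Y₀ ≠ ⊤

/-- Integral of a function against a finite signed measure over `[0,τ) × Ω`. -/
def signedIntegral (μ : SignedMeasure (ℝ × Torus)) (τ : ℝ) (f : ℝ → Torus → ℝ) : ℝ :=
  ∫ᵛ q in Ico 0 τ ×ˢ univ, f q.1 q.2 ∂<•μ

/-- The total variation over `[0,τ) × Ω` of a matrix-valued measure, `ℝ^{3×3}` being equipped with
the norm `∑ |a_{ij}|`. -/
def matrixVariation (μ : Fin 3 → Fin 3 → SignedMeasure (ℝ × Torus)) (τ : ℝ) : ℝ :=
  ∑ i, ∑ j, ((μ i j).variation (Ico 0 τ ×ˢ univ)).toReal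

/-- Dissipative measure-valued solutions `(Y, D)` of the complete Euler system on `(0,T) × Ω`
with the initial Young measure `Y₀`. -/
structure IsDissipativeMVSolution (F : ThermoFunctions) (P : ℝ≥0 → ℝ≥0 → ℝ) (T : ℝ)
    (Y₀ : Torus → Measure Phase) (Y : ℝ → Torus → Measure Phase) (D : ℝ → ℝ) : Prop where
  young : IsYoungMeasure T Y
  initial : IsInitialMeasure Y₀
  defect : MemLp D ⊤ (volume.restrict (Ioo 0 T))
  /-- All nonlinearities in the field equations are integrable. -/
  int_density : PairingIntegrable T Y (fun z => (z.1 : ℝ))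
  int_momentum : ∀ i, PairingIntegrable T Y (fun z => z.2.2 i)
  int_convection : ∀ i j, PairingIntegrable T Y (fun z => z.2.2 i * z.2.2 j / (z.1 : ℝ))
  int_pressure : PairingIntegrable T Y (fun z => P z.1 z.2.1)
  int_entropy : ∀ Z : ℝ → ℝ, Continuous Z → (∃ C, ∀ a, |Z a| ≤ C) → Monotone Z →
    PairingIntegrable T Y (fun z => (z.1 : ℝ) * cutoff Z (entropy F z.1 z.2.1))
  int_entropy_flux : ∀ Z : ℝ → ℝ, Continuous Z → (∃ C, ∀ a, |Z a| ≤ C) → Monotone Z →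
    ∀ i, PairingIntegrable T Y (fun z => cutoff Z (entropy F z.1 z.2.1) * z.2.2 i)
  /-- The equation of continuity. -/
  continuity_eq : ∀ φ : ℝ → Torus → ℝ, IsC1 T φ → ∀ᵐ τ ∂volume.restrict (Ioo 0 T),
    (∫ x, pairing (Y τ x) (fun z => (z.1 : ℝ)) * φ τ x)
        - (∫ x, pairing (Y₀ x) (fun z => (z.1 : ℝ)) * φ 0 x)
      = ∫ t in (0 : ℝ)..τ, ∫ x,
          (pairing (Y t x) (fun z => (z.1 : ℝ)) * dt φ t x
            + ∑ i, pairing (Y t x) (fun z => z.2.2 i) * dx i φ t x)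
  /-- The momentum equation with a concentration measure `μ` dominated by the dissipation defect. -/
  momentum_eq : ∃ μ : Fin 3 → Fin 3 → SignedMeasure (ℝ × Torus),
    (∀ φ : ℝ → Torus → Vec, IsC1 T φ → ∀ᵐ τ ∂volume.restrict (Ioo 0 T),
      (∫ x, ∑ i, pairing (Y τ x) (fun z => z.2.2 i) * φ τ x i)
          - (∫ x, ∑ i, pairing (Y₀ x) (fun z => z.2.2 i) * φ 0 x i)
        = (∫ t in (0 : ℝ)..τ, ∫ x,
            ((∑ i, pairing (Y t x) (fun z => z.2.2 i) * dt (fun t x => φ t x i) t x)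
              + (∑ i, ∑ j, pairing (Y t x) (fun z => z.2.2 i * z.2.2 j / (z.1 : ℝ))
                  * dx j (fun t x => φ t x i) t x)
              + pairing (Y t x) (fun z => P z.1 z.2.1)
                  * ∑ i, dx i (fun t x => φ t x i) t x))
          + ∑ i, ∑ j, signedIntegral (μ i j) τ (dx j (fun t x => φ t x i))) ∧
    ∃ c : ℝ, 0 < c ∧ ∀ᵐ τ ∂volume.restrict (Ioo 0 T),
      matrixVariation μ τ ≤ c * ∫ t in (0 : ℝ)..τ, D t
  /-- The renormalized entropy inequality. -/
  entropy_ineq : ∀ Z : ℝ → ℝ, Continuous Z → (∃ C, ∀ a, |Z a| ≤ C) → Monotone Z →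
    ∀ φ : ℝ → Torus → ℝ, IsC1 T φ → (∀ t ∈ Icc 0 T, ∀ x, 0 ≤ φ t x) →
    ∀ᵐ τ ∂volume.restrict (Ioo 0 T),
      (∫ t in (0 : ℝ)..τ, ∫ x,
          (pairing (Y t x) (fun z => (z.1 : ℝ) * cutoff Z (entropy F z.1 z.2.1)) * dt φ t x
            + ∑ i, pairing (Y t x) (fun z => cutoff Z (entropy F z.1 z.2.1) * z.2.2 i)
                * dx i φ t x))
      ≤ (∫ x, pairing (Y τ x) (fun z => (z.1 : ℝ) * cutoff Z (entropy F z.1 z.2.1)) * φ τ x)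
        - (∫ x, pairing (Y₀ x) (fun z => (z.1 : ℝ) * cutoff Z (entropy F z.1 z.2.1)) * φ 0 x)
  /-- The energy balance. -/
  energy_eq : ∀ᵐ τ ∂volume.restrict (Ioo 0 T),
    totalEnergy (Y τ) ≠ ⊤ ∧
      (totalEnergy (Y τ)).toReal - (totalEnergy Y₀).toReal + D τ = 0

/-! ### Classical solutions -/

/-- Classical solutions `[r, Θ, U]` of class `C¹([0,T] × Ω)`, with `r > 0` and `Θ > 0`, of the
complete Euler system in `(0,T) × Ω`. -/
structure IsClassicalSolution (F : ThermoFunctions) (T : ℝ)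
    (r Θ : ℝ → Torus → ℝ) (U : ℝ → Torus → Vec) : Prop where
  r_C1 : IsC1 T r
  Θ_C1 : IsC1 T Θ
  U_C1 : IsC1 T U
  r_pos : ∀ t ∈ Icc 0 T, ∀ x, 0 < r t x
  Θ_pos : ∀ t ∈ Icc 0 T, ∀ x, 0 < Θ t x
  continuity_eq : ∀ t ∈ Ioo 0 T, ∀ x,
    dt r t x + ∑ i, dx i (fun t x => r t x * U t x i) t x = 0
  momentum_eq : ∀ t ∈ Ioo 0 T, ∀ x, ∀ i,
    dt (fun t x => r t x * U t x i) t x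
      + ∑ j, dx j (fun t x => r t x * U t x i * U t x j) t x
      + dx i (fun t x => F.p (r t x, Θ t x)) t x = 0
  energy_eq : ∀ t ∈ Ioo 0 T, ∀ x,
    dt (fun t x => 1 / 2 * r t x * ‖U t x‖ ^ 2 + r t x * F.e (r t x, Θ t x)) t x
      + ∑ j, dx j (fun t x =>
          (1 / 2 * r t x * ‖U t x‖ ^ 2 + r t x * F.e (r t x, Θ t x) + F.p (r t x, Θ t x))
            * U t x j) t x = 0

/-- The point `[ϱ, ϱ e(ϱ, ϑ), ϱ u]` of the phase space. -/
def phasePoint (F : ThermoFunctions) (ϱ θ : ℝ) (u : Vec) : Phase :=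
  (ϱ.toNNReal, (ϱ * F.e (ϱ, θ)).toNNReal, ϱ • u)

end EulerMV

end

/-! The distance between the measure-valued and the strong solution is measured by a relative
energy, |m - ϱU|²/(2ϱ) + E - Θ ϱ Z(s) - ϱ μ(r,Θ) + p(r,Θ), where μ = e - ϑ s + p/ϱ and Z truncates
the entropy to an interval [a,b]. Expanded (`relEnergy_eq`), it is a combination of the energy, ϱ
Z(s), m and ϱ whose coefficients are C¹ functions of (t,x). Testing the entropy inequality with Θ,
the momentum equation with U, the continuity equation with |U|²/2 - μ, and adding the energy balance
gives `relEnergy_inequality`: the integrated relative energy at time τ plus D(τ) is at most the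
integral of a remainder minus the integral of ∇U against the concentration measure. The initial
contribution vanishes because the data coincide.

Coercivity. The interval [a,b] contains the entropies of all states in a box around the range of
(r,Θ), so on the box Z(s) = s. There Gibbs' relation and thermodynamic stability make the
thermodynamic part increase in ϱ and ϑ away from (r,Θ), at least quadratically. Off the box
monotonicity carries this bound outwards and gives growth in ϱ. For the measure-valued solution the
entropy is known only through bounded functions Z; the minimum principle
`IsDissipativeMVSolution.le_entropy` supplies s ≥ a wherever ϱ > 0, hence Z(s) ≤ s, and truncation
only raises the relative energy. On the vacuum the expression is E + p(r,Θ), so positivity of the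
pressure of the strong solution is decisive. Altogether the relative energy is nonnegative, vanishes
only at the strong state, and dominates a multiple of 1 + ϱ + E off the box
(`exists_state_dichotomy`).

Remainder. Near the strong solution its first-order terms cancel by Maxwell's relation, the
continuity equation and the transport of entropy along the flow (`exists_box_remainder_bound`); what
remains is quadratic. Off the box it is at most linear in 1 + ϱ + E, apart from quadratic terms in m
- ϱU. So it is bounded by K times the relative energy (`exists_remainder_bound`).

Conclusion. The concentration term is at most a multiple of ∫₀^τ D, and Gronwall's lemma applied to
the sum of relative energy and defect (`eq_zero_of_gronwall`) forces both to vanish. A probability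
measure with zero mean relative energy is the Dirac mass at the strong state. -/

namespace EulerMV

/-! ### Calculus on the torus -/

/-- The covering map `ℝ³ → Ω`. -/
def torusProj (y : Fin 3 → ℝ) : Torus := fun i => (y i : UnitAddCircle)

lemma isOpenQuotientMap_torusProj : IsOpenQuotientMap torusProj := by
  have h : ∀ _ : Fin 3, IsOpenQuotientMap (fun a : ℝ => (a : UnitAddCircle)) :=
    fun _ => QuotientAddGroup.isOpenQuotientMap_mk
  exact IsOpenQuotientMap.piMap h

lemma torusProj_surjective : Function.Surjective torusProj :=
  isOpenQuotientMap_torusProj.surjective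

lemma torusProj_add_single (y : Fin 3 → ℝ) (i : Fin 3) (h : ℝ) :
    torusProj (y + h • Pi.single i (1 : ℝ)) =
      torusProj y + Pi.single i (h : UnitAddCircle) := by
  funext j
  by_cases hj : j = i
  · subst hj; simp [torusProj]
  · simp [torusProj, hj]

/-- The covering map is an open quotient map and the slab is saturated for it, so neighbourhoods
within the slab push forward exactly. Regularity, defined on the lift, thereby descends to the
torus. -/
lemma continuousOn_of_lift {V : Type*} [TopologicalSpace V] {T : ℝ} {f : ℝ → Torus → V}
    (h : ContinuousOn (fun z : ℝ × (Fin 3 → ℝ) => f z.1 (torusProj z.2)) (Icc 0 T ×ˢ univ)) :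
    ContinuousOn (fun q : ℝ × Torus => f q.1 q.2) (Icc 0 T ×ˢ univ) := by
  rintro ⟨t, x⟩ ⟨ht, -⟩
  obtain ⟨y, rfl⟩ := torusProj_surjective x
  have hq : IsOpenQuotientMap (Prod.map (id : ℝ → ℝ) torusProj) :=
    IsOpenQuotientMap.id.prodMap isOpenQuotientMap_torusProj
  have h1 := h (t, y) ⟨ht, mem_univ _⟩
  have hpre : (Icc 0 T ×ˢ univ : Set (ℝ × (Fin 3 → ℝ)))
      = Prod.map (id : ℝ → ℝ) torusProj ⁻¹' (Icc 0 T ×ˢ univ) := by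
    ext z; simp
  have hmap : map (Prod.map (id : ℝ → ℝ) torusProj) (𝓝[Icc 0 T ×ˢ univ] (t, y))
      = 𝓝[Icc 0 T ×ˢ univ] (t, torusProj y) := by
    rw [hpre, nhdsWithin, ← comap_principal, Filter.push_pull, hq.map_nhds_eq, nhdsWithin]
    rfl
  unfold ContinuousWithinAt at h1 ⊢
  rw [← hmap, tendsto_map'_iff]
  exact h1

/-! ### C¹ functions on the cylinder and their derivatives. -/

section C1

variable {T : ℝ}

lemma uniqueDiffOn_slab (hT : 0 < T) :
    UniqueDiffOn ℝ (Icc 0 T ×ˢ univ : Set (ℝ × (Fin 3 → ℝ))) :=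
  (uniqueDiffOn_Icc hT).prod uniqueDiffOn_univ

lemma IsC1.continuousOn {V : Type*} [NormedAddCommGroup V] [NormedSpace ℝ V]
    {f : ℝ → Torus → V} (hf : IsC1 T f) :
    ContinuousOn (fun q : ℝ × Torus => f q.1 q.2) (Icc 0 T ×ˢ univ) :=
  continuousOn_of_lift (ContDiffOn.continuousOn hf)

variable {f g : ℝ → Torus → ℝ}

/-- The derivative of the lift of `f` to `[0,T] × ℝ³`. -/
noncomputable def liftDeriv (T : ℝ) (f : ℝ → Torus → ℝ) :
    ℝ × (Fin 3 → ℝ) → ℝ × (Fin 3 → ℝ) →L[ℝ] ℝ :=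
  fderivWithin ℝ (fun z : ℝ × (Fin 3 → ℝ) => f z.1 (torusProj z.2)) (Icc 0 T ×ˢ univ)

lemma IsC1.hasFDerivWithinAt (hf : IsC1 T f) {t : ℝ} (ht : t ∈ Icc 0 T) (y : Fin 3 → ℝ) :
    HasFDerivWithinAt (fun z : ℝ × (Fin 3 → ℝ) => f z.1 (torusProj z.2)) (liftDeriv T f (t, y))
      (Icc 0 T ×ˢ univ) (t, y) :=
  ((ContDiffOn.differentiableOn hf one_ne_zero) (t, y) ⟨ht, mem_univ _⟩).hasFDerivWithinAt

lemma IsC1.continuousOn_liftDeriv (hT : 0 < T) (hf : IsC1 T f) :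
    ContinuousOn (liftDeriv T f) (Icc 0 T ×ˢ univ) :=
  ContDiffOn.continuousOn_fderivWithin hf (uniqueDiffOn_slab hT) le_rfl

lemma IsC1.hasDerivAt_lift_dx (hf : IsC1 T f) {t : ℝ} (ht : t ∈ Icc 0 T) (y : Fin 3 → ℝ)
    (i : Fin 3) :
    HasDerivAt (fun h : ℝ => f t (torusProj y + Pi.single i (h : UnitAddCircle)))
      (liftDeriv T f (t, y) (0, Pi.single i 1)) 0 := by
  have hc : HasDerivAt (fun h : ℝ => ((t, y + h • Pi.single i (1 : ℝ)) : ℝ × (Fin 3 → ℝ)))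
      (0, Pi.single i 1) 0 := by
    refine (hasDerivAt_const (0 : ℝ) t).prodMk ?_
    simpa using ((hasDerivAt_id (0 : ℝ)).smul_const (Pi.single i (1 : ℝ))).const_add y
  have h0 : (t, y + (0 : ℝ) • Pi.single i (1 : ℝ)) = (t, y) := by simp
  have h1 := hf.hasFDerivWithinAt ht y
  rw [← h0] at h1
  have h2 := h1.comp_hasDerivWithinAt (s := univ) (0 : ℝ) hc.hasDerivWithinAt
    (t := Icc 0 T ×ˢ univ) (fun _ _ => ⟨ht, mem_univ _⟩)
  rw [hasDerivWithinAt_univ, h0] at h2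
  refine h2.congr_of_eventuallyEq (Eventually.of_forall fun h => ?_)
  simp only [Function.comp_apply, torusProj_add_single]

lemma IsC1.dx_eq (hf : IsC1 T f) {t : ℝ} (ht : t ∈ Icc 0 T) (y : Fin 3 → ℝ) (i : Fin 3) :
    dx i f t (torusProj y) = liftDeriv T f (t, y) (0, Pi.single i 1) :=
  (hf.hasDerivAt_lift_dx ht y i).deriv

lemma IsC1.hasDerivAt_dx (hf : IsC1 T f) {t : ℝ} (ht : t ∈ Icc 0 T) (x : Torus) (i : Fin 3) :
    HasDerivAt (fun h : ℝ => f t (x + Pi.single i (h : UnitAddCircle))) (dx i f t x) 0 := by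
  obtain ⟨y, rfl⟩ := torusProj_surjective x
  rw [hf.dx_eq ht]
  exact hf.hasDerivAt_lift_dx ht y i

lemma IsC1.continuousOn_dx (hT : 0 < T) (hf : IsC1 T f) (i : Fin 3) :
    ContinuousOn (fun q : ℝ × Torus => dx i f q.1 q.2) (Icc 0 T ×ˢ univ) := by
  apply continuousOn_of_lift
  refine ((hf.continuousOn_liftDeriv hT).clm_apply
    (continuousOn_const (c := ((0, Pi.single i 1) : ℝ × (Fin 3 → ℝ))))).congr ?_
  rintro ⟨t, y⟩ ⟨ht, -⟩
  exact hf.dx_eq ht y i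

/-- The time derivative, one-sided at `t = 0` and `t = T`. -/
noncomputable def dtWithin (T : ℝ) (f : ℝ → Torus → ℝ) (t : ℝ) (x : Torus) : ℝ :=
  derivWithin (fun τ => f τ x) (Icc 0 T) t

lemma IsC1.hasDerivWithinAt_lift_dt (hf : IsC1 T f) {t : ℝ} (ht : t ∈ Icc 0 T)
    (y : Fin 3 → ℝ) :
    HasDerivWithinAt (fun τ : ℝ => f τ (torusProj y)) (liftDeriv T f (t, y) (1, 0)) (Icc 0 T) t := by
  have hc : HasDerivAt (fun τ : ℝ => ((τ, y) : ℝ × (Fin 3 → ℝ))) (1, 0) t :=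
    (hasDerivAt_id t).prodMk (hasDerivAt_const t y)
  exact (hf.hasFDerivWithinAt ht y).comp_hasDerivWithinAt (s := Icc 0 T) t hc.hasDerivWithinAt
    (t := Icc 0 T ×ˢ univ) (fun _ h => ⟨h, mem_univ _⟩)

lemma IsC1.continuousOn_dtWithin (hT : 0 < T) (hf : IsC1 T f) :
    ContinuousOn (fun q : ℝ × Torus => dtWithin T f q.1 q.2) (Icc 0 T ×ˢ univ) := by
  apply continuousOn_of_lift
  refine ((hf.continuousOn_liftDeriv hT).clm_apply
    (continuousOn_const (c := ((1, 0) : ℝ × (Fin 3 → ℝ))))).congr ?_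
  rintro ⟨t, y⟩ ⟨ht, -⟩
  exact (hf.hasDerivWithinAt_lift_dt ht y).derivWithin (uniqueDiffOn_Icc hT t ht)

lemma dt_eq_dtWithin {t : ℝ} (ht : t ∈ Ioo 0 T) (x : Torus) : dt f t x = dtWithin T f t x :=
  (derivWithin_of_mem_nhds (Icc_mem_nhds ht.1 ht.2)).symm

lemma IsC1.hasDerivAt_dt (hf : IsC1 T f) {t : ℝ} (ht : t ∈ Ioo 0 T) (x : Torus) :
    HasDerivAt (fun τ => f τ x) (dt f t x) t := by
  obtain ⟨y, rfl⟩ := torusProj_surjective x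
  have := (hf.hasDerivWithinAt_lift_dt (Ioo_subset_Icc_self ht) y).hasDerivAt
    (Icc_mem_nhds ht.1 ht.2)
  exact this.differentiableAt.hasDerivAt

lemma exists_bound_of_continuousOn {V : Type*} [NormedAddCommGroup V] {f : ℝ → Torus → V}
    (hf : ContinuousOn (fun q : ℝ × Torus => f q.1 q.2) (Icc 0 T ×ˢ univ)) :
    ∃ B : ℝ, 0 ≤ B ∧ ∀ t ∈ Icc 0 T, ∀ x, ‖f t x‖ ≤ B := by
  obtain ⟨B, hB⟩ := (isCompact_Icc.prod isCompact_univ).exists_bound_of_continuousOn hf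
  exact ⟨max B 0, le_max_right _ _, fun t ht x =>
    (hB (t, x) ⟨ht, mem_univ _⟩).trans (le_max_left _ _)⟩

lemma IsC1.exists_bound_dx (hT : 0 < T) (hf : IsC1 T f) :
    ∃ B : ℝ, 0 ≤ B ∧ ∀ t ∈ Icc 0 T, ∀ x i, |dx i f t x| ≤ B := by
  choose B hB0 hB using fun i => exists_bound_of_continuousOn (hf.continuousOn_dx hT i)
  refine ⟨∑ i, B i, Finset.sum_nonneg fun i _ => hB0 i, fun t ht x i => (hB i t ht x).trans ?_⟩
  exact Finset.single_le_sum (fun i _ => hB0 i) (Finset.mem_univ i)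

lemma IsC1.exists_bound_dt (hT : 0 < T) (hf : IsC1 T f) :
    ∃ B : ℝ, 0 ≤ B ∧ ∀ t ∈ Ioo 0 T, ∀ x, |dt f t x| ≤ B := by
  obtain ⟨B, hB0, hB⟩ := exists_bound_of_continuousOn (hf.continuousOn_dtWithin hT)
  exact ⟨B, hB0, fun t ht x => dt_eq_dtWithin (f := f) ht x ▸ hB t (Ioo_subset_Icc_self ht) x⟩

lemma isC1_const {V : Type*} [NormedAddCommGroup V] [NormedSpace ℝ V] (c : V) :
    IsC1 T (fun _ _ => c) := contDiffOn_const

lemma IsC1.add (hf : IsC1 T f) (hg : IsC1 T g) : IsC1 T (fun t x => f t x + g t x) :=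
  ContDiffOn.add hf hg

lemma IsC1.sub (hf : IsC1 T f) (hg : IsC1 T g) : IsC1 T (fun t x => f t x - g t x) :=
  ContDiffOn.sub hf hg

lemma IsC1.mul (hf : IsC1 T f) (hg : IsC1 T g) : IsC1 T (fun t x => f t x * g t x) :=
  ContDiffOn.mul hf hg

lemma IsC1.sum {ι : Type*} {s : Finset ι} {f : ι → ℝ → Torus → ℝ} (hf : ∀ i ∈ s, IsC1 T (f i)) :
    IsC1 T (fun t x => ∑ i ∈ s, f i t x) :=
  ContDiffOn.sum hf

lemma IsC1.component {U : ℝ → Torus → Vec} (hU : IsC1 T U) (i : Fin 3) :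
    IsC1 T (fun t x => U t x i) :=
  (EuclideanSpace.proj (𝕜 := ℝ) i).contDiff.comp_contDiffOn hU

lemma IsC1.comp_pair {G : ℝ × ℝ → ℝ} {s : Set (ℝ × ℝ)} (hG : ContDiffOn ℝ 1 G s)
    (hf : IsC1 T f) (hg : IsC1 T g) (hs : ∀ t ∈ Icc 0 T, ∀ x, (f t x, g t x) ∈ s) :
    IsC1 T (fun t x => G (f t x, g t x)) :=
  hG.comp (ContDiffOn.prodMk hf hg) fun z hz => hs z.1 hz.1 _

/-! ### Integrals of derivatives -/

lemma IsC1.continuous_slice (hf : IsC1 T f) {t : ℝ} (ht : t ∈ Icc 0 T) :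
    Continuous (fun x => f t x) := by
  rw [← continuousOn_univ]
  exact hf.continuousOn.comp (by fun_prop : ContinuousOn (fun x : Torus => (t, x)) univ)
    fun x hx => ⟨ht, hx⟩

lemma IsC1.continuous_slice_dx (hT : 0 < T) (hf : IsC1 T f) {t : ℝ} (ht : t ∈ Icc 0 T)
    (i : Fin 3) : Continuous (fun x => dx i f t x) := by
  rw [← continuousOn_univ]
  exact (hf.continuousOn_dx hT i).comp
    (by fun_prop : ContinuousOn (fun x : Torus => (t, x)) univ) fun x hx => ⟨ht, hx⟩

lemma IsC1.hasDerivAt_dx_line (hf : IsC1 T f) {t : ℝ} (ht : t ∈ Icc 0 T) (x : Torus)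
    (i : Fin 3) (h : ℝ) :
    HasDerivAt (fun h : ℝ => f t (x + Pi.single i (h : UnitAddCircle)))
      (dx i f t (x + Pi.single i (h : UnitAddCircle))) h := by
  have h1 := hf.hasDerivAt_dx ht (x + Pi.single i (h : UnitAddCircle)) i
  rw [← sub_self h] at h1
  have h2 := h1.comp_sub_const h h
  refine h2.congr_of_eventuallyEq (Eventually.of_forall fun k => ?_)
  simp only [add_assoc, ← Pi.single_add, ← AddCircle.coe_add]
  congr 4
  ring

/-- By invariance of the measure, the integral of `f (x + γ h)` does not depend on `h`.
Differentiating under the integral at `h = 0` gives the claim; compactness provides the dominating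
constant. -/
lemma integral_translation_deriv_eq_zero {G : Type*} [AddGroup G] [TopologicalSpace G]
    [CompactSpace G] [ContinuousAdd G] [MeasurableSpace G] [OpensMeasurableSpace G]
    [MeasurableAdd G] {μ : Measure G} [IsFiniteMeasure μ] [μ.IsAddRightInvariant]
    {f f' : G → ℝ} (hf : Continuous f) (hf' : Continuous f') {γ : ℝ → G} (hγ : γ 0 = 0)
    (hd : ∀ x h, HasDerivAt (fun h => f (x + γ h)) (f' (x + γ h)) h) : ∫ x, f' x ∂μ = 0 := by
  obtain ⟨B, hB⟩ := isCompact_univ.exists_bound_of_continuousOn hf'.continuousOn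
  have hint : ∀ h, Integrable (fun x => f (x + γ h)) μ := fun h =>
    (hf.comp (continuous_add_const _)).integrable_of_hasCompactSupport
      (HasCompactSupport.of_compactSpace _)
  have key := (hasDerivAt_integral_of_dominated_loc_of_deriv_le (μ := μ) (𝕜 := ℝ)
    (F := fun h x => f (x + γ h)) (F' := fun h x => f' (x + γ h)) (x₀ := 0)
    (s := univ) (bound := fun _ => B) univ_mem
    (Eventually.of_forall fun h => (hint h).aestronglyMeasurable) (hint 0)
    (hf'.comp (continuous_add_const _)).aestronglyMeasurable
    (Eventually.of_forall fun x h _ => hB _ (mem_univ _)) (integrable_const _)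
    (Eventually.of_forall fun x h _ => hd x h)).2
  simp only [integral_add_right_eq_self, hγ, add_zero] at key
  exact key.unique (hasDerivAt_const (0 : ℝ) (∫ x, f x ∂μ))

lemma IsC1.integral_dx (hT : 0 < T) (hf : IsC1 T f) {t : ℝ} (ht : t ∈ Icc 0 T) (i : Fin 3) :
    ∫ x, dx i f t x = 0 :=
  integral_translation_deriv_eq_zero (hf.continuous_slice ht) (hf.continuous_slice_dx hT ht i)
    (γ := fun h : ℝ => Pi.single i (h : UnitAddCircle))
    (by simp only [AddCircle.coe_zero, Pi.single_zero]) (hf.hasDerivAt_dx_line ht · i ·)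

lemma spaceTime_eq : spaceTime T = (volume : Measure (ℝ × Torus)).restrict (Ioo 0 T ×ˢ univ) := by
  rw [spaceTime, Measure.volume_eq_prod, ← Measure.prod_restrict, Measure.restrict_univ]

instance : IsFiniteMeasure (spaceTime T) := by
  unfold spaceTime; infer_instance

lemma aestronglyMeasurable_of_continuousOn {f : ℝ → Torus → ℝ}
    (hf : ContinuousOn (fun q : ℝ × Torus => f q.1 q.2) (Icc 0 T ×ˢ univ)) :
    AEStronglyMeasurable (fun q : ℝ × Torus => f q.1 q.2) (spaceTime T) := by
  rw [spaceTime_eq]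
  exact (hf.mono (prod_mono Ioo_subset_Icc_self subset_rfl)).aestronglyMeasurable
    (measurableSet_Ioo.prod MeasurableSet.univ)

lemma ae_mem_Ioo_spaceTime : ∀ᵐ q ∂spaceTime T, q.1 ∈ Ioo 0 T := by
  rw [spaceTime_eq]
  filter_upwards [ae_restrict_mem (measurableSet_Ioo.prod MeasurableSet.univ)] with q hq using hq.1

lemma IsC1.aestronglyMeasurable_dt (hT : 0 < T) (hf : IsC1 T f) :
    AEStronglyMeasurable (fun q : ℝ × Torus => dt f q.1 q.2) (spaceTime T) := by
  refine (aestronglyMeasurable_of_continuousOn (hf.continuousOn_dtWithin hT)).congr ?_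
  filter_upwards [ae_mem_Ioo_spaceTime] with q hq using (dt_eq_dtWithin hq _).symm

lemma spaceTime_mono {τ : ℝ} (hτ : τ ≤ T) : spaceTime τ ≤ spaceTime T := by
  rw [spaceTime_eq, spaceTime_eq]
  exact Measure.restrict_mono (prod_mono (Ioo_subset_Ioo_right hτ) subset_rfl) le_rfl

lemma intervalIntegral_integral_eq {τ : ℝ} (hτ0 : 0 ≤ τ) {F : ℝ → Torus → ℝ}
    (hF : Integrable (fun q : ℝ × Torus => F q.1 q.2) (spaceTime τ)) :
    ∫ t in (0 : ℝ)..τ, ∫ x, F t x = ∫ q, F q.1 q.2 ∂spaceTime τ := by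
  rw [intervalIntegral.integral_of_le hτ0, integral_Ioc_eq_integral_Ioo]
  exact (integral_prod (fun q : ℝ × Torus => F q.1 q.2) hF).symm

lemma IsC1.integrable_dt (hT : 0 < T) (hf : IsC1 T f) :
    Integrable (fun q : ℝ × Torus => dt f q.1 q.2) (spaceTime T) := by
  obtain ⟨B, hB0, hB⟩ := hf.exists_bound_dt hT
  refine Integrable.of_bound (hf.aestronglyMeasurable_dt hT) B ?_
  filter_upwards [ae_mem_Ioo_spaceTime] with q hq using hB _ hq _

/-- Fubini and the fundamental theorem of calculus in time. The two-sided derivative `dt` is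
available only for interior times; continuity up to `t = 0` covers the endpoint. -/
lemma IsC1.integral_dt (hT : 0 < T) (hf : IsC1 T f) {τ : ℝ} (hτ : τ ∈ Ioo 0 T) :
    ∫ q, dt f q.1 q.2 ∂spaceTime τ = (∫ x, f τ x) - ∫ x, f 0 x := by
  have hint := (hf.integrable_dt hT).mono_measure (spaceTime_mono hτ.2.le)
  have hslice : ∀ t ∈ Icc 0 T, Integrable (fun x => f t x) := fun t ht =>
    (hf.continuous_slice ht).integrable_of_hasCompactSupport (HasCompactSupport.of_compactSpace _)
  rw [spaceTime, integral_prod_symm _ hint,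
    ← integral_sub (hslice τ (Ioo_subset_Icc_self hτ)) (hslice 0 ⟨le_rfl, hT.le⟩)]
  refine integral_congr_ae ?_
  filter_upwards [hint.prod_left_ae] with x hx
  have h0 : ∫ t in Ioo 0 τ, dt f t x = ∫ t in (0 : ℝ)..τ, dt f t x := by
    rw [intervalIntegral.integral_of_le hτ.1.le, integral_Ioc_eq_integral_Ioo]
  refine h0.trans ?_
  refine intervalIntegral.integral_eq_sub_of_hasDerivAt_of_le (E := ℝ) (f := fun t => f t x)
    hτ.1.le ?_ ?_ ?_
  · refine (hf.continuousOn.comp (by fun_prop : ContinuousOn (fun t : ℝ => (t, x)) (Icc 0 τ))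
      fun t ht => ⟨⟨ht.1, ht.2.trans hτ.2.le⟩, mem_univ _⟩)
  · exact fun t ht => hf.hasDerivAt_dt ⟨ht.1, ht.2.trans hτ.2⟩ x
  · rw [intervalIntegrable_iff_integrableOn_Ioo_of_le hτ.1.le]
    exact hx

end C1

/-! ### One-dimensional estimates -/

/-- After subtraction of `c / 2 * (x - x₀) ^ 2` the derivative still has the sign of `x - x₀`, so
the mean value theorem shows that the difference is smallest at `x₀`. -/
lemma quadratic_lower_bound {S : Set ℝ} (hS : S.OrdConnected) {φ φ' : ℝ → ℝ} {x₀ c : ℝ}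
    (hx₀ : x₀ ∈ S) (hφ : ∀ x ∈ S, HasDerivAt φ (φ' x) x)
    (hc : ∀ x ∈ S, c * (x - x₀) ^ 2 ≤ φ' x * (x - x₀)) {x : ℝ} (hx : x ∈ S) :
    φ x₀ + c / 2 * (x - x₀) ^ 2 ≤ φ x := by
  have hψ : ∀ y ∈ S, HasDerivAt (fun y => φ y - c / 2 * (y - x₀) ^ 2)
      (φ' y - c * (y - x₀)) y := fun y hy => by
    have h1 := (((hasDerivAt_id y).sub_const x₀).pow 2).const_mul (c / 2)
    refine ((hφ y hy).sub h1).congr_deriv ?_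
    simp only [id_eq]
    ring
  rcases lt_trichotomy x x₀ with h | h | h
  · have hsub : Icc x x₀ ⊆ S := hS.out hx hx₀
    obtain ⟨ξ, hξ, h1⟩ := exists_hasDerivAt_eq_slope _ _ h
      (fun y hy => (hψ y (hsub hy)).continuousAt.continuousWithinAt)
      (fun y hy => hψ y (hsub (Ioo_subset_Icc_self hy)))
    have h2 := hc ξ (hsub (Ioo_subset_Icc_self hξ))
    rw [eq_div_iff (by linarith)] at h1
    have h3 : φ' ξ - c * (ξ - x₀) ≤ 0 := by
      by_contra! h4
      nlinarith [mul_neg_of_pos_of_neg h4 (by linarith [hξ.2] : ξ - x₀ < 0)]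
    have h4 := mul_nonpos_of_nonpos_of_nonneg h3 (by linarith : 0 ≤ x₀ - x)
    have h5 : c / 2 * (x₀ - x₀) ^ 2 = 0 := by ring
    linarith
  · subst h; simp
  · have hsub : Icc x₀ x ⊆ S := hS.out hx₀ hx
    obtain ⟨ξ, hξ, h1⟩ := exists_hasDerivAt_eq_slope _ _ h
      (fun y hy => (hψ y (hsub hy)).continuousAt.continuousWithinAt)
      (fun y hy => hψ y (hsub (Ioo_subset_Icc_self hy)))
    have h2 := hc ξ (hsub (Ioo_subset_Icc_self hξ))
    rw [eq_div_iff (by linarith)] at h1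
    have h3 : 0 ≤ φ' ξ - c * (ξ - x₀) := by
      by_contra! h4
      nlinarith [mul_neg_of_neg_of_pos h4 (by linarith [hξ.1] : 0 < ξ - x₀)]
    have h4 := mul_nonneg h3 (by linarith : 0 ≤ x - x₀)
    have h5 : c / 2 * (x₀ - x₀) ^ 2 = 0 := by ring
    linarith

lemma exists_hasDerivAt_sub_eq {φ φ' : ℝ → ℝ} {a b : ℝ} (hab : a ≤ b)
    (hφ : ∀ x ∈ Icc a b, HasDerivAt φ (φ' x) x) :
    ∃ ξ ∈ Icc a b, φ b - φ a = φ' ξ * (b - a) := by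
  rcases hab.eq_or_lt with rfl | h
  · exact ⟨a, ⟨le_rfl, le_rfl⟩, by simp⟩
  · obtain ⟨ξ, hξ, h1⟩ := exists_hasDerivAt_eq_slope _ _ h
      (fun y hy => (hφ y hy).continuousAt.continuousWithinAt)
      (fun y hy => hφ y (Ioo_subset_Icc_self hy))
    exact ⟨ξ, Ioo_subset_Icc_self hξ, by rw [h1, div_mul_cancel₀]; linarith⟩

/-! ### Functions of class `C²` on the quadrant -/

lemma isOpen_quadrant : IsOpen Quadrant := isOpen_Ioi.prod isOpen_Ioi

/-- Partial derivative with respect to the density. -/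
noncomputable def pd₁ (f : ℝ × ℝ → ℝ) (z : ℝ × ℝ) : ℝ := fderiv ℝ f z (1, 0)

/-- Partial derivative with respect to the temperature. -/
noncomputable def pd₂ (f : ℝ × ℝ → ℝ) (z : ℝ × ℝ) : ℝ := fderiv ℝ f z (0, 1)

lemma fderiv_apply_eq (f : ℝ × ℝ → ℝ) (z v : ℝ × ℝ) :
    fderiv ℝ f z v = pd₁ f z * v.1 + pd₂ f z * v.2 := by
  have h : v = v.1 • ((1, 0) : ℝ × ℝ) + v.2 • ((0, 1) : ℝ × ℝ) := by ext <;> simp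
  conv_lhs => rw [h]
  rw [map_add, map_smul, map_smul, pd₁, pd₂, smul_eq_mul, smul_eq_mul]
  ring

section C2

variable {f : ℝ × ℝ → ℝ}

lemma hasFDerivAt_of_contDiffOn (hf : ContDiffOn ℝ 2 f Quadrant) {z : ℝ × ℝ}
    (hz : z ∈ Quadrant) : HasFDerivAt f (fderiv ℝ f z) z :=
  ((hf.contDiffAt (isOpen_quadrant.mem_nhds hz)).differentiableAt two_ne_zero).hasFDerivAt

lemma contDiffOn_fderiv (hf : ContDiffOn ℝ 2 f Quadrant) :
    ContDiffOn ℝ 1 (fderiv ℝ f) Quadrant :=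
  hf.fderiv_of_isOpen isOpen_quadrant (by norm_num)

lemma continuousOn_pd₁ (hf : ContDiffOn ℝ 2 f Quadrant) : ContinuousOn (pd₁ f) Quadrant :=
  (contDiffOn_fderiv hf).continuousOn.clm_apply continuousOn_const

lemma continuousOn_pd₂ (hf : ContDiffOn ℝ 2 f Quadrant) : ContinuousOn (pd₂ f) Quadrant :=
  (contDiffOn_fderiv hf).continuousOn.clm_apply continuousOn_const

lemma hasDerivAt_pd₁ (hf : ContDiffOn ℝ 2 f Quadrant) {ϱ θ : ℝ} (hϱ : 0 < ϱ) (hθ : 0 < θ) :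
    HasDerivAt (fun x => f (x, θ)) (pd₁ f (ϱ, θ)) ϱ :=
  (hasFDerivAt_of_contDiffOn hf (z := (ϱ, θ)) ⟨hϱ, hθ⟩).comp_hasDerivAt ϱ
    ((hasDerivAt_id ϱ).prodMk (hasDerivAt_const ϱ θ))

lemma hasDerivAt_pd₂ (hf : ContDiffOn ℝ 2 f Quadrant) {ϱ θ : ℝ} (hϱ : 0 < ϱ) (hθ : 0 < θ) :
    HasDerivAt (fun y => f (ϱ, y)) (pd₂ f (ϱ, θ)) θ :=
  (hasFDerivAt_of_contDiffOn hf (z := (ϱ, θ)) ⟨hϱ, hθ⟩).comp_hasDerivAt θ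
    ((hasDerivAt_const θ ϱ).prodMk (hasDerivAt_id θ))

lemma exists_lipschitz_bound {V : Type*} [NormedAddCommGroup V] [NormedSpace ℝ V]
    {g : ℝ × ℝ → V} (hg : ContDiffOn ℝ 1 g Quadrant) {N : Set (ℝ × ℝ)} (hN : IsCompact N)
    (hconv : Convex ℝ N) (hsub : N ⊆ Quadrant) :
    ∃ C : ℝ, 0 ≤ C ∧ ∀ z ∈ N, ∀ w ∈ N, ‖g z - g w‖ ≤ C * ‖z - w‖ := by
  have hd : ∀ z ∈ N, HasFDerivWithinAt g (fderiv ℝ g z) N z := fun z hz =>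
    ((hg.contDiffAt (isOpen_quadrant.mem_nhds (hsub hz))).differentiableAt
      one_ne_zero).hasFDerivAt.hasFDerivWithinAt
  obtain ⟨C, hC⟩ := hN.exists_bound_of_continuousOn
    ((hg.continuousOn_fderiv_of_isOpen isOpen_quadrant le_rfl).mono hsub)
  refine ⟨max C 0, le_max_right _ _, fun z hz w hw => ?_⟩
  exact hconv.norm_image_sub_le_of_norm_hasFDerivWithin_le hd
    (fun x hx => (hC x hx).trans (le_max_left _ _)) hw hz

/-- The derivative is Lipschitz on a compact convex set, hence differs from its value at `w` by at
most `C * ‖z - w‖` along the segment; the mean value inequality contributes the second factor `‖z -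
w‖`. The constant is uniform in the base point. -/
lemma exists_taylor_bound (hf : ContDiffOn ℝ 2 f Quadrant) {N : Set (ℝ × ℝ)} (hN : IsCompact N)
    (hconv : Convex ℝ N) (hsub : N ⊆ Quadrant) :
    ∃ C : ℝ, 0 ≤ C ∧ ∀ z ∈ N, ∀ w ∈ N,
      |f z - f w - (pd₁ f w * (z.1 - w.1) + pd₂ f w * (z.2 - w.2))| ≤ C * ‖z - w‖ ^ 2 := by
  obtain ⟨C, hC0, hC⟩ := exists_lipschitz_bound (contDiffOn_fderiv hf) hN hconv hsub
  refine ⟨C, hC0, fun z hz w hw => ?_⟩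
  have hseg : segment ℝ w z ⊆ N := hconv.segment_subset hw hz
  have h := (convex_segment w z).norm_image_sub_le_of_norm_hasFDerivWithin_le'
    (f := f) (f' := fderiv ℝ f) (φ := fderiv ℝ f w) (C := C * ‖z - w‖)
    (fun x hx => (hasFDerivAt_of_contDiffOn hf (hsub (hseg hx))).hasFDerivWithinAt)
    (fun x hx => (hC x (hseg hx) w hw).trans
      (mul_le_mul_of_nonneg_left (norm_sub_le_of_mem_segment hx) hC0))
    (left_mem_segment ℝ w z) (right_mem_segment ℝ w z)
  rw [fderiv_apply_eq, Real.norm_eq_abs] at h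
  calc _ ≤ C * ‖z - w‖ * ‖z - w‖ := h
    _ = _ := by ring

end C2

/-! ### Consequences of Gibbs' relation -/

section Thermo

variable {F : ThermoFunctions}

lemma gibbs₁ (hgibbs : GibbsRelation F) {ϱ θ : ℝ} (hϱ : 0 < ϱ) (hθ : 0 < θ) :
    θ * pd₁ F.s (ϱ, θ) = pd₁ F.e (ϱ, θ) - F.p (ϱ, θ) / ϱ ^ 2 := by
  have h := congrArg (fun L => L (1, 0)) (hgibbs (ϱ, θ) ⟨hϱ, hθ⟩)
  have h1 : HasFDerivAt (fun w : ℝ × ℝ => 1 / w.1)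
      ((-(ϱ ^ 2)⁻¹) • ContinuousLinearMap.fst ℝ ℝ ℝ) (ϱ, θ) := by
    have := (hasDerivAt_inv hϱ.ne').comp_hasFDerivAt ((ϱ, θ) : ℝ × ℝ)
      (hasFDerivAt_fst (𝕜 := ℝ) (E := ℝ) (F := ℝ) (p := (ϱ, θ)))
    simpa only [one_div, Function.comp_def] using this
  rw [h1.fderiv] at h
  simp only [smul_apply, add_apply, smul_eq_mul,
    ContinuousLinearMap.coe_fst'] at h
  rw [pd₁, pd₁, h]
  ring

lemma gibbs₂ (hgibbs : GibbsRelation F) {ϱ θ : ℝ} (hϱ : 0 < ϱ) (hθ : 0 < θ) :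
    θ * pd₂ F.s (ϱ, θ) = pd₂ F.e (ϱ, θ) := by
  have h := congrArg (fun L => L (0, 1)) (hgibbs (ϱ, θ) ⟨hϱ, hθ⟩)
  have h1 : HasFDerivAt (fun w : ℝ × ℝ => 1 / w.1)
      ((-(ϱ ^ 2)⁻¹) • ContinuousLinearMap.fst ℝ ℝ ℝ) (ϱ, θ) := by
    have := (hasDerivAt_inv hϱ.ne').comp_hasFDerivAt ((ϱ, θ) : ℝ × ℝ)
      (hasFDerivAt_fst (𝕜 := ℝ) (E := ℝ) (F := ℝ) (p := (ϱ, θ)))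
    simpa only [one_div, Function.comp_def] using this
  rw [h1.fderiv] at h
  simp only [smul_apply, add_apply, smul_eq_mul,
    ContinuousLinearMap.coe_fst'] at h
  rw [pd₂, pd₂, h]
  ring

/-- Maxwell's relation. -/
lemma maxwell (hreg : IsRegular F) (hgibbs : GibbsRelation F) {ϱ θ : ℝ} (hϱ : 0 < ϱ)
    (hθ : 0 < θ) : pd₁ F.s (ϱ, θ) = -(pd₂ F.p (ϱ, θ) / ϱ ^ 2) := by
  have hz : ((ϱ, θ) : ℝ × ℝ) ∈ Quadrant := ⟨hϱ, hθ⟩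
  have hnhds := isOpen_quadrant.mem_nhds hz
  have hD : ∀ {f : ℝ × ℝ → ℝ}, ContDiffOn ℝ 2 f Quadrant →
      HasFDerivAt (fderiv ℝ f) (fderiv ℝ (fderiv ℝ f) (ϱ, θ)) (ϱ, θ) := fun hf =>
    (((contDiffOn_fderiv hf).contDiffAt hnhds).differentiableAt one_ne_zero).hasFDerivAt
  have hsymm : ∀ {f : ℝ × ℝ → ℝ}, ContDiffOn ℝ 2 f Quadrant →
      fderiv ℝ (fderiv ℝ f) (ϱ, θ) (1, 0) (0, 1) = fderiv ℝ (fderiv ℝ f) (ϱ, θ) (0, 1) (1, 0) :=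
    fun hf => ((hf.contDiffAt hnhds).isSymmSndFDerivAt (by simp)) (1, 0) (0, 1)
  have hx : HasDerivAt (fun x : ℝ => ((x, θ) : ℝ × ℝ)) (1, 0) ϱ :=
    (hasDerivAt_id ϱ).prodMk (hasDerivAt_const ϱ θ)
  have hy : HasDerivAt (fun y : ℝ => ((ϱ, y) : ℝ × ℝ)) (0, 1) θ :=
    (hasDerivAt_const θ ϱ).prodMk (hasDerivAt_id θ)
  have d₁₂ : ∀ {f : ℝ × ℝ → ℝ}, ContDiffOn ℝ 2 f Quadrant →
      HasDerivAt (fun x => pd₂ f (x, θ)) (fderiv ℝ (fderiv ℝ f) (ϱ, θ) (1, 0) (0, 1)) ϱ :=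
    fun {f} hf => by
      have h1 := (hD hf).comp_hasDerivAt ϱ hx
      simpa [pd₂] using h1.clm_apply (hasDerivAt_const ϱ ((0, 1) : ℝ × ℝ))
  have d₂₁ : ∀ {f : ℝ × ℝ → ℝ}, ContDiffOn ℝ 2 f Quadrant →
      HasDerivAt (fun y => pd₁ f (ϱ, y)) (fderiv ℝ (fderiv ℝ f) (ϱ, θ) (0, 1) (1, 0)) θ :=
    fun {f} hf => by
      have h1 := (hD hf).comp_hasDerivAt θ hy
      simpa [pd₁] using h1.clm_apply (hasDerivAt_const θ ((1, 0) : ℝ × ℝ))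
  -- Differentiate the ϑ-component of Gibbs' relation in ϱ, and below its ϱ-component in ϑ. By
  -- symmetry of the mixed derivatives of `s` and `e`, subtraction leaves s_ϱ = -p_ϑ/ϱ².
  have h1 := (((d₁₂ hreg.s_smooth).const_mul θ).congr_of_eventuallyEq
    (f₁ := fun x => pd₂ F.e (x, θ)) (by
      filter_upwards [Ioi_mem_nhds hϱ] with x hx using (gibbs₂ hgibbs hx hθ).symm)).unique
    (d₁₂ hreg.e_smooth)
  have h2 := (((hasDerivAt_id θ).mul (d₂₁ hreg.s_smooth)).congr_of_eventuallyEq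
    (f₁ := fun y => pd₁ F.e (ϱ, y) - F.p (ϱ, y) / ϱ ^ 2) (by
      filter_upwards [Ioi_mem_nhds hθ] with y hy using (gibbs₁ hgibbs hϱ hy).symm)).unique
    ((d₂₁ hreg.e_smooth).sub ((hasDerivAt_pd₂ hreg.p_smooth hϱ hθ).div_const (ϱ ^ 2)))
  rw [hsymm hreg.s_smooth, hsymm hreg.e_smooth] at h1
  simp only [id_eq] at h2
  linarith

lemma pd₁_p_pos (hreg : IsRegular F) (hstab : ThermoStable F) {ϱ θ : ℝ} (hϱ : 0 < ϱ)
    (hθ : 0 < θ) : 0 < pd₁ F.p (ϱ, θ) := by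
  rw [← (hasDerivAt_pd₁ hreg.p_smooth hϱ hθ).deriv]
  exact (hstab ϱ θ hϱ hθ).1

lemma pd₂_e_pos (hreg : IsRegular F) (hstab : ThermoStable F) {ϱ θ : ℝ} (hϱ : 0 < ϱ)
    (hθ : 0 < θ) : 0 < pd₂ F.e (ϱ, θ) := by
  rw [← (hasDerivAt_pd₂ hreg.e_smooth hϱ hθ).deriv]
  exact (hstab ϱ θ hϱ hθ).2

/-! ### Monotonicity of the thermodynamic relative energy. -/

/-- The Gibbs free energy `e - ϑ s + p / ϱ`. -/
noncomputable def gibbsEnergy (F : ThermoFunctions) (z : ℝ × ℝ) : ℝ :=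
  F.e z - z.2 * F.s z + F.p z / z.1

/-- The thermodynamic part of the relative energy. -/
noncomputable def relThermo (F : ThermoFunctions) (ϱ θ r Θ : ℝ) : ℝ :=
  ϱ * (F.e (ϱ, θ) - Θ * F.s (ϱ, θ)) - ϱ * gibbsEnergy F (r, Θ) + F.p (r, Θ)

/-- By Gibbs' relation e_ϱ - ϑ s_ϱ - p/ϱ² = 0, so only the derivative of the pressure survives.
Under stability the free energy is thus increasing in the density. -/
lemma hasDerivAt_gibbsEnergy (hreg : IsRegular F) (hgibbs : GibbsRelation F) {ϱ θ : ℝ}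
    (hϱ : 0 < ϱ) (hθ : 0 < θ) :
    HasDerivAt (fun x => gibbsEnergy F (x, θ)) (pd₁ F.p (ϱ, θ) / ϱ) ϱ := by
  have h := ((hasDerivAt_pd₁ hreg.e_smooth hϱ hθ).sub
    ((hasDerivAt_pd₁ hreg.s_smooth hϱ hθ).const_mul θ)).add
    ((hasDerivAt_pd₁ hreg.p_smooth hϱ hθ).div (hasDerivAt_id ϱ) hϱ.ne')
  refine h.congr_deriv ?_
  have hg := gibbs₁ hgibbs hϱ hθ
  rw [hg]
  simp only [id_eq]
  field_simp
  ring

/-- At frozen temperature Θ, the derivative of ϱ (e - Θ s) in ϱ is the Gibbs free energy. As this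
increases in ϱ, the relative energy is convex in the density with its minimum at `r`. -/
lemma hasDerivAt_relThermo_density (hreg : IsRegular F) (hgibbs : GibbsRelation F)
    {ϱ Θ : ℝ} (hϱ : 0 < ϱ) (hΘ : 0 < Θ) (r : ℝ) :
    HasDerivAt (fun x => relThermo F x Θ r Θ)
      (gibbsEnergy F (ϱ, Θ) - gibbsEnergy F (r, Θ)) ϱ := by
  have h := (((hasDerivAt_id ϱ).mul ((hasDerivAt_pd₁ hreg.e_smooth hϱ hΘ).sub
    ((hasDerivAt_pd₁ hreg.s_smooth hϱ hΘ).const_mul Θ))).sub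
    ((hasDerivAt_id ϱ).mul_const (gibbsEnergy F (r, Θ)))).add_const (F.p (r, Θ))
  refine h.congr_deriv ?_
  have hg := gibbs₁ hgibbs hϱ hΘ
  have hμ : gibbsEnergy F (ϱ, Θ) = F.e (ϱ, Θ) - Θ * F.s (ϱ, Θ) + F.p (ϱ, Θ) / ϱ := rfl
  rw [hg, hμ]
  simp only [id_eq, Pi.sub_apply]
  field_simp
  ring

/-- Since s_ϑ = e_ϑ/ϑ, the derivative of e - Θ s is e_ϑ (1 - Θ/ϑ); under stability it has the sign
of ϑ - Θ. -/
lemma hasDerivAt_relThermo_temperature (hreg : IsRegular F) (hgibbs : GibbsRelation F)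
    {ϱ θ : ℝ} (hϱ : 0 < ϱ) (hθ : 0 < θ) (r Θ : ℝ) :
    HasDerivAt (fun y => relThermo F ϱ y r Θ) (ϱ * pd₂ F.e (ϱ, θ) / θ * (θ - Θ)) θ := by
  have h := ((((hasDerivAt_pd₂ hreg.e_smooth hϱ hθ).sub
    ((hasDerivAt_pd₂ hreg.s_smooth hϱ hθ).const_mul Θ)).const_mul ϱ).sub_const
    (ϱ * gibbsEnergy F (r, Θ))).add_const (F.p (r, Θ))
  refine h.congr_deriv ?_
  rw [← gibbs₂ hgibbs hϱ hθ]
  field_simp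

lemma relThermo_self {r Θ : ℝ} (hr : 0 < r) : relThermo F r Θ r Θ = 0 := by
  simp only [relThermo, gibbsEnergy]
  field_simp
  ring

lemma gibbsEnergy_monotoneOn (hreg : IsRegular F) (hgibbs : GibbsRelation F)
    (hstab : ThermoStable F) {Θ : ℝ} (hΘ : 0 < Θ) {x y : ℝ} (hx : 0 < x) (hxy : x ≤ y) :
    gibbsEnergy F (x, Θ) ≤ gibbsEnergy F (y, Θ) := by
  obtain ⟨ξ, hξ, h⟩ := exists_hasDerivAt_sub_eq hxy (fun z hz =>
    hasDerivAt_gibbsEnergy hreg hgibbs (hx.trans_le hz.1) hΘ)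
  have := pd₁_p_pos hreg hstab (hx.trans_le hξ.1) hΘ
  have h2 : 0 ≤ pd₁ F.p (ξ, Θ) / ξ * (y - x) :=
    mul_nonneg (div_nonneg this.le (hx.trans_le hξ.1).le) (by linarith)
  linarith

lemma relThermo_temperature_le (hreg : IsRegular F) (hgibbs : GibbsRelation F)
    (hstab : ThermoStable F) {ϱ Θ y z : ℝ} (r : ℝ) (hϱ : 0 < ϱ) (hy : 0 < y) (hz : 0 < z)
    (h : (Θ ≤ y ∧ y ≤ z) ∨ (z ≤ y ∧ y ≤ Θ)) : relThermo F ϱ y r Θ ≤ relThermo F ϱ z r Θ := by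
  have hd : ∀ ξ, 0 < ξ → 0 < ϱ * pd₂ F.e (ϱ, ξ) / ξ := fun ξ hξ =>
    div_pos (mul_pos hϱ (pd₂_e_pos hreg hstab hϱ hξ)) hξ
  rcases h with ⟨h1, h2⟩ | ⟨h1, h2⟩
  · obtain ⟨ξ, hξ, h⟩ := exists_hasDerivAt_sub_eq h2 (fun w hw =>
      hasDerivAt_relThermo_temperature hreg hgibbs hϱ (hy.trans_le hw.1) r Θ)
    have := mul_nonneg (mul_nonneg (hd ξ (hy.trans_le hξ.1)).le (by linarith [hξ.1] : 0 ≤ ξ - Θ))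
      (by linarith : 0 ≤ z - y)
    linarith
  · obtain ⟨ξ, hξ, h⟩ := exists_hasDerivAt_sub_eq h1 (fun w hw =>
      hasDerivAt_relThermo_temperature hreg hgibbs hϱ (hz.trans_le hw.1) r Θ)
    have := mul_nonneg (mul_nonneg (hd ξ (hz.trans_le hξ.1)).le (by linarith [hξ.2] : 0 ≤ Θ - ξ))
      (by linarith : 0 ≤ y - z)
    linarith

/-! ### Coercivity on and off a compact box. -/

/-- The box `[a₁,a₂] × [b₁,b₂]` in the plane of densities and temperatures. -/
def box (a₁ a₂ b₁ b₂ : ℝ) : Set (ℝ × ℝ) := Icc a₁ a₂ ×ˢ Icc b₁ b₂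

variable {a₁ a₂ b₁ b₂ : ℝ}

lemma isCompact_box : IsCompact (box a₁ a₂ b₁ b₂) := isCompact_Icc.prod isCompact_Icc

lemma convex_box : Convex ℝ (box a₁ a₂ b₁ b₂) := (convex_Icc _ _).prod (convex_Icc _ _)

lemma box_subset_quadrant (ha : 0 < a₁) (hb : 0 < b₁) : box a₁ a₂ b₁ b₂ ⊆ Quadrant :=
  fun _ hz => ⟨ha.trans_le hz.1.1, hb.trans_le hz.2.1⟩

lemma exists_pos_lower_bound {N : Set (ℝ × ℝ)} (hN : IsCompact N) {f : ℝ × ℝ → ℝ}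
    (hf : ContinuousOn f N) (hpos : ∀ z ∈ N, 0 < f z) : ∃ c : ℝ, 0 < c ∧ ∀ z ∈ N, c ≤ f z := by
  rcases N.eq_empty_or_nonempty with rfl | hne
  · exact ⟨1, one_pos, fun z hz => hz.elim⟩
  · obtain ⟨z₀, hz₀, h⟩ := hN.exists_isMinOn hne hf
    exact ⟨f z₀, hpos z₀ hz₀, fun z hz => h hz⟩

/-- On a compact box the relative energy controls the square of the distance. -/
lemma exists_relThermo_ge_sq (hreg : IsRegular F) (hgibbs : GibbsRelation F)
    (hstab : ThermoStable F) (ha : 0 < a₁) (hb : 0 < b₁) :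
    ∃ c : ℝ, 0 < c ∧ (∀ r ϱ Θ, (r, Θ) ∈ box a₁ a₂ b₁ b₂ → (ϱ, Θ) ∈ box a₁ a₂ b₁ b₂ →
        c * (ϱ - r) ^ 2 ≤ (gibbsEnergy F (ϱ, Θ) - gibbsEnergy F (r, Θ)) * (ϱ - r)) ∧
      ∀ r Θ ϱ θ, (r, Θ) ∈ box a₁ a₂ b₁ b₂ → (ϱ, θ) ∈ box a₁ a₂ b₁ b₂ →
        c * ((ϱ - r) ^ 2 + (θ - Θ) ^ 2) ≤ relThermo F ϱ θ r Θ := by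
  have hsub := box_subset_quadrant (a₂ := a₂) (b₂ := b₂) ha hb
  obtain ⟨c₁, hc₁, h₁⟩ := exists_pos_lower_bound (isCompact_box (a₁ := a₁) (a₂ := a₂) (b₁ := b₁)
    (b₂ := b₂)) (f := fun z => pd₁ F.p z / z.1)
    (((continuousOn_pd₁ hreg.p_smooth).mono hsub).div continuousOn_fst
      fun z hz => (hsub hz).1.ne')
    (fun z hz => div_pos (pd₁_p_pos hreg hstab (hsub hz).1 (hsub hz).2) (hsub hz).1)
  obtain ⟨c₂, hc₂, h₂⟩ := exists_pos_lower_bound (isCompact_box (a₁ := a₁) (a₂ := a₂) (b₁ := b₁)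
    (b₂ := b₂)) (f := fun z => z.1 * pd₂ F.e z / z.2)
    ((continuousOn_fst.mul ((continuousOn_pd₂ hreg.e_smooth).mono hsub)).div continuousOn_snd
      fun z hz => (hsub hz).2.ne')
    (fun z hz => div_pos (mul_pos (hsub hz).1 (pd₂_e_pos hreg hstab (hsub hz).1 (hsub hz).2))
      (hsub hz).2)
  have hmono : ∀ r ϱ Θ, (r, Θ) ∈ box a₁ a₂ b₁ b₂ → (ϱ, Θ) ∈ box a₁ a₂ b₁ b₂ →
      c₁ * (ϱ - r) ^ 2 ≤ (gibbsEnergy F (ϱ, Θ) - gibbsEnergy F (r, Θ)) * (ϱ - r) := by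
    intro r ϱ Θ hr hϱ
    have hΘ : 0 < Θ := (hsub hr).2
    rcases le_total r ϱ with h | h
    · obtain ⟨ξ, hξ, h3⟩ := exists_hasDerivAt_sub_eq h (fun z hz =>
        hasDerivAt_gibbsEnergy hreg hgibbs ((hsub hr).1.trans_le hz.1) hΘ)
      have h4 := h₁ (ξ, Θ) ⟨⟨hr.1.1.trans hξ.1, hξ.2.trans hϱ.1.2⟩, hr.2⟩
      rw [h3]
      nlinarith [mul_le_mul_of_nonneg_right h4 (sq_nonneg (ϱ - r))]
    · obtain ⟨ξ, hξ, h3⟩ := exists_hasDerivAt_sub_eq h (fun z hz =>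
        hasDerivAt_gibbsEnergy hreg hgibbs ((hsub hϱ).1.trans_le hz.1) hΘ)
      have h4 := h₁ (ξ, Θ) ⟨⟨hϱ.1.1.trans hξ.1, hξ.2.trans hr.1.2⟩, hr.2⟩
      nlinarith [mul_le_mul_of_nonneg_right h4 (sq_nonneg (ϱ - r))]
  refine ⟨min c₁ c₂ / 2, by positivity, fun r ϱ Θ hr hϱ => ?_, fun r Θ ϱ θ hr hϱ => ?_⟩
  · refine le_trans (mul_le_mul_of_nonneg_right ?_ (sq_nonneg _)) (hmono r ϱ Θ hr hϱ)
    linarith [min_le_left c₁ c₂]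
  -- Travel from (r,Θ) to (ϱ,Θ) and then to (ϱ,ϑ): both legs stay in the box and each gains a
  -- quadratic term. The factor 1/2 of `quadratic_lower_bound` is the one in the chosen constant.
  · have h3 := quadratic_lower_bound (c := c₁) (ordConnected_Icc (a := a₁) (b := a₂)) (x₀ := r)
      hr.1 (fun x hx => hasDerivAt_relThermo_density hreg hgibbs (ha.trans_le hx.1) (hsub hr).2 r)
      (fun x hx => hmono r x Θ hr ⟨hx, hr.2⟩) hϱ.1
    have h4 := quadratic_lower_bound (c := c₂) (ordConnected_Icc (a := b₁) (b := b₂)) (x₀ := Θ)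
      hr.2 (fun y hy => hasDerivAt_relThermo_temperature hreg hgibbs (hsub hϱ).1
        (hb.trans_le hy.1) r Θ)
      (fun y hy => by
        have := mul_le_mul_of_nonneg_right (h₂ (ϱ, y) ⟨hϱ.1, hy⟩) (sq_nonneg (y - Θ))
        simp only at this
        nlinarith) hϱ.2
    rw [relThermo_self (hsub hr).1] at h3
    simp only at h3 h4
    have h5 := mul_le_mul_of_nonneg_right (min_le_left c₁ c₂) (sq_nonneg (ϱ - r))
    have h6 := mul_le_mul_of_nonneg_right (min_le_right c₁ c₂) (sq_nonneg (θ - Θ))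
    nlinarith

/-- Away from a compact box the relative energy controls the density. -/
lemma exists_relThermo_ge_density (hreg : IsRegular F) (hgibbs : GibbsRelation F)
    (hstab : ThermoStable F) (ha : 0 < a₁) (hb : 0 < b₁) {δ : ℝ} (hδ : 0 < δ) :
    ∃ c : ℝ, 0 < c ∧ ∀ r Θ ϱ θ, (r, Θ) ∈ box (a₁ + δ) (a₂ - δ) (b₁ + δ) (b₂ - δ) →
      0 < ϱ → 0 < θ → (ϱ, θ) ∉ box a₁ a₂ b₁ b₂ → c * (1 + ϱ) ≤ relThermo F ϱ θ r Θ := by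
  obtain ⟨c, hc, hmono, hsq⟩ := exists_relThermo_ge_sq (a₂ := a₂) (b₂ := b₂) hreg hgibbs hstab ha hb
  -- `c * δ ^ 2` is the energy gained in crossing the margin between the boxes, enough against `1 +
  -- ϱ` while `ϱ ≤ a₂`; `c * δ` is the slope in the density beyond `a₂`. The absolute value is
  -- needed because `a₂ > 0` is known only once the inner box has a point.
  refine ⟨min (c * δ ^ 2 / (1 + |a₂|)) (c * δ), by positivity, ?_⟩
  intro r Θ ϱ θ hr hϱ hθ hnot
  obtain ⟨⟨hr1, hr2⟩, hΘ1, hΘ2⟩ := hr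
  simp only at hr1 hr2 hΘ1 hΘ2
  have hr0 : 0 < r := by linarith
  have hΘ0 : 0 < Θ := by linarith
  have ha₂ : 0 < a₂ := by linarith
  rw [abs_of_pos ha₂]
  have hrbox : (r, Θ) ∈ box a₁ a₂ b₁ b₂ :=
    ⟨⟨by simp only; linarith, by simp only; linarith⟩, by simp only; linarith,
      by simp only; linarith⟩
  have hb₂ : b₁ ≤ b₂ := by linarith
  have hsmall : ∀ x, x ≤ a₂ → ∀ y, c * δ ^ 2 ≤ y →
      min (c * δ ^ 2 / (1 + a₂)) (c * δ) * (1 + x) ≤ y := by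
    intro x hx y hy
    have hm : 0 ≤ min (c * δ ^ 2 / (1 + a₂)) (c * δ) := by positivity
    calc _ ≤ min (c * δ ^ 2 / (1 + a₂)) (c * δ) * (1 + a₂) :=
          mul_le_mul_of_nonneg_left (by linarith) hm
      _ ≤ c * δ ^ 2 / (1 + a₂) * (1 + a₂) :=
          mul_le_mul_of_nonneg_right (min_le_left _ _) (by linarith)
      _ = c * δ ^ 2 := by field_simp
      _ ≤ y := hy
  -- Replacing ϑ by Θ lowers the relative energy, so densities outside `[a₁,a₂]` may be treated at
  -- temperature Θ.
  have htemp : relThermo F ϱ Θ r Θ ≤ relThermo F ϱ θ r Θ := by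
    refine relThermo_temperature_le hreg hgibbs hstab r hϱ hΘ0 hθ ?_
    rcases le_total Θ θ with h | h
    · exact Or.inl ⟨le_rfl, h⟩
    · exact Or.inr ⟨h, le_rfl⟩
  rcases lt_or_ge ϱ a₁ with h1 | h1
  · refine hsmall ϱ (by linarith) _ ?_
    have h2 := hsq r Θ a₁ Θ hrbox ⟨⟨le_rfl, by simp only; linarith⟩, hrbox.2⟩
    obtain ⟨ξ, hξ, h3⟩ := exists_hasDerivAt_sub_eq h1.le (fun x hx =>
      hasDerivAt_relThermo_density hreg hgibbs (hϱ.trans_le hx.1) hΘ0 r)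
    have h4 := gibbsEnergy_monotoneOn hreg hgibbs hstab hΘ0 (hϱ.trans_le hξ.1)
      (by linarith [hξ.2] : ξ ≤ r)
    have h5 := mul_nonpos_of_nonpos_of_nonneg (sub_nonpos.2 h4) (sub_nonneg.2 h1.le)
    have h6 : δ ^ 2 ≤ (a₁ - r) ^ 2 := by nlinarith
    have h7 := mul_le_mul_of_nonneg_left h6 hc.le
    simp only [sub_self] at h2
    nlinarith
  rcases lt_or_ge a₂ ϱ with h2 | h2
  · have h3 := hsq r Θ a₂ Θ hrbox ⟨⟨by simp only; linarith, le_rfl⟩, hrbox.2⟩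
    obtain ⟨ξ, hξ, h4⟩ := exists_hasDerivAt_sub_eq h2.le (fun x hx =>
      hasDerivAt_relThermo_density hreg hgibbs (ha₂.trans_le hx.1) hΘ0 r)
    have h5 := gibbsEnergy_monotoneOn hreg hgibbs hstab hΘ0 ha₂ hξ.1
    have h6 := hmono r a₂ Θ hrbox ⟨⟨by simp only; linarith, le_rfl⟩, hrbox.2⟩
    -- This bounds the slope at `a₂` and, by monotonicity of the free energy, at every larger
    -- density: hence linear growth.
    have h7 : c * δ ≤ gibbsEnergy F (a₂, Θ) - gibbsEnergy F (r, Θ) := by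
      have h8 : c * (a₂ - r) ≤ gibbsEnergy F (a₂, Θ) - gibbsEnergy F (r, Θ) :=
        le_of_mul_le_mul_right (by nlinarith) (by linarith : 0 < a₂ - r)
      nlinarith
    have h8 : δ ^ 2 ≤ (a₂ - r) ^ 2 := by nlinarith
    have h9 := mul_le_mul_of_nonneg_left h8 hc.le
    have h10 := hsmall a₂ le_rfl _ le_rfl
    have h11 : c * δ * (ϱ - a₂) ≤ (gibbsEnergy F (ξ, Θ) - gibbsEnergy F (r, Θ)) * (ϱ - a₂) :=
      mul_le_mul_of_nonneg_right (by linarith) (by linarith)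
    have h12 := mul_le_mul_of_nonneg_right (min_le_right (c * δ ^ 2 / (1 + a₂)) (c * δ))
      (by linarith : 0 ≤ ϱ - a₂)
    simp only [sub_self] at h3
    nlinarith
  · refine hsmall ϱ h2 _ ?_
    have hout : θ < b₁ ∨ b₂ < θ := by
      by_contra! h
      exact hnot ⟨⟨h1, h2⟩, h⟩
    rcases hout with h3 | h3
    · have h4 := hsq r Θ ϱ b₁ hrbox ⟨⟨h1, h2⟩, le_rfl, hb₂⟩
      have h5 := relThermo_temperature_le hreg hgibbs hstab (Θ := Θ) r hϱ hb hθ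
        (Or.inr ⟨h3.le, by linarith⟩)
      have h6 : δ ^ 2 ≤ (b₁ - Θ) ^ 2 := by nlinarith
      have h7 := mul_le_mul_of_nonneg_left h6 hc.le
      nlinarith [mul_nonneg hc.le (sq_nonneg (ϱ - r))]
    · have h4 := hsq r Θ ϱ b₂ hrbox ⟨⟨h1, h2⟩, hb₂, le_rfl⟩
      have h5 := relThermo_temperature_le hreg hgibbs hstab (Θ := Θ) r hϱ (by linarith) hθ
        (Or.inl ⟨by linarith, h3.le⟩)
      have h6 : δ ^ 2 ≤ (b₂ - Θ) ^ 2 := by nlinarith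
      have h7 := mul_le_mul_of_nonneg_left h6 hc.le
      nlinarith [mul_nonneg hc.le (sq_nonneg (ϱ - r))]

end Thermo

/-! ### The truncation used as renormalization -/

/-- The truncation of a real number to `[a,b]`. -/
noncomputable def clamp (a b : ℝ) (x : ℝ) : ℝ := max a (min x b)

section Clamp

variable {a b : ℝ}

lemma continuous_clamp : Continuous (clamp a b) := by
  unfold clamp; fun_prop

lemma monotone_clamp : Monotone (clamp a b) := fun _ _ h =>
  max_le_max le_rfl (min_le_min h le_rfl)

lemma le_clamp (x : ℝ) : a ≤ clamp a b x := le_max_left _ _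

lemma clamp_le (hab : a ≤ b) (x : ℝ) : clamp a b x ≤ b := max_le hab (min_le_right _ _)

lemma clamp_of_mem {x : ℝ} (hx : x ∈ Icc a b) : clamp a b x = x := by
  rw [clamp, min_eq_left hx.2, max_eq_right hx.1]

lemma abs_clamp_le (hab : a ≤ b) (x : ℝ) : |clamp a b x| ≤ max |a| |b| :=
  abs_le_max_abs_abs (le_clamp x) (clamp_le hab x)

lemma iInf_clamp (hab : a ≤ b) : ⨅ x, clamp a b x = a := by
  refine le_antisymm ?_ (le_ciInf fun x => le_clamp x)
  refine (ciInf_le ⟨a, ?_⟩ a).trans (clamp_of_mem ⟨le_rfl, hab⟩).le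
  rintro _ ⟨x, rfl⟩
  exact le_clamp x

lemma iSup_clamp (hab : a ≤ b) : ⨆ x, clamp a b x = b := by
  refine le_antisymm (ciSup_le fun x => clamp_le hab x) ?_
  refine (clamp_of_mem ⟨hab, le_rfl⟩).ge.trans (le_ciSup (f := clamp a b) ⟨b, ?_⟩ b)
  rintro _ ⟨x, rfl⟩
  exact clamp_le hab x

lemma cutoff_coe (Z : ℝ → ℝ) (x : ℝ) : cutoff Z (x : EReal) = Z x := by
  simp [cutoff]

lemma cutoff_clamp_mem (hab : a ≤ b) (σ : EReal) : cutoff (clamp a b) σ ∈ Icc a b := by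
  unfold cutoff
  split_ifs
  · rw [iInf_clamp hab]; exact ⟨le_rfl, hab⟩
  · rw [iSup_clamp hab]; exact ⟨hab, le_rfl⟩
  · exact ⟨le_clamp _, clamp_le hab _⟩

/-- Truncation lowers every value that is at least `a` but raises those below. This is why the
relative energy with truncated entropy is coercive only after a lower bound on the entropy. -/
lemma cutoff_clamp_le {σ : EReal} (hσ : (a : EReal) ≤ σ) :
    (cutoff (clamp a b) σ : EReal) ≤ σ := by
  induction σ with
  | bot => simp at hσ
  | top => exact le_top
  | coe x =>
    rw [cutoff_coe, EReal.coe_le_coe_iff]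
    exact max_le (EReal.coe_le_coe_iff.1 hσ) (min_le_left _ _)

end Clamp

/-! ### Thermodynamic states in the phase variables -/

section States

variable {F : ThermoFunctions} {a₁ a₂ b₁ b₂ δ : ℝ}

/-- `(ϱ, E)` is the phase state of a point of the box. -/
def IsBoxState (F : ThermoFunctions) (a₁ a₂ b₁ b₂ ϱ E : ℝ) : Prop :=
  ∃ θ, (ϱ, θ) ∈ box a₁ a₂ b₁ b₂ ∧ E = ϱ * F.e (ϱ, θ)

/-- By compactness, box states whose phase variables tend to (ϱ,E) would cluster at a point of the
box, and by continuity of the state map this point would have phase variables (ϱ,E). -/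
lemma eventually_notMem_box (hreg : IsRegular F) (ha : 0 < a₁) (hb : 0 < b₁) {ϱ E : ℝ}
    (hnot : ¬ IsBoxState F a₁ a₂ b₁ b₂ ϱ E) :
    ∀ᶠ z in comap (fun z : ℝ × ℝ => (z.1, z.1 * F.e z)) (𝓝 (ϱ, E)) ⊓ 𝓟 Quadrant,
      z ∉ box a₁ a₂ b₁ b₂ := by
  by_contra hcon
  rw [not_eventually] at hcon
  simp only [not_not] at hcon
  set g : ℝ × ℝ → ℝ × ℝ := fun z => (z.1, z.1 * F.e z) with hg
  set 𝓕 := comap g (𝓝 (ϱ, E)) ⊓ 𝓟 Quadrant with h𝓕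
  have hne : NeBot (𝓕 ⊓ 𝓟 (box a₁ a₂ b₁ b₂)) := frequently_iff_neBot.1 hcon
  obtain ⟨w, hw, hcl⟩ := isCompact_box (a₁ := a₁) (a₂ := a₂) (b₁ := b₁) (b₂ := b₂)
    (f := 𝓕 ⊓ 𝓟 (box a₁ a₂ b₁ b₂)) inf_le_right
  have hne' : NeBot (𝓝 w ⊓ (𝓕 ⊓ 𝓟 (box a₁ a₂ b₁ b₂))) := hcl
  have hwQ := box_subset_quadrant ha hb hw
  have hgc : Tendsto g (𝓝 w) (𝓝 (g w)) := by
    have he := hreg.e_smooth.continuousOn.continuousAt (isOpen_quadrant.mem_nhds hwQ)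
    exact continuousAt_fst.prodMk (continuousAt_fst.mul he)
  have h1 : Tendsto g (𝓝 w ⊓ (𝓕 ⊓ 𝓟 (box a₁ a₂ b₁ b₂))) (𝓝 (g w)) := hgc.mono_left inf_le_left
  have h2 : Tendsto g (𝓝 w ⊓ (𝓕 ⊓ 𝓟 (box a₁ a₂ b₁ b₂))) (𝓝 (ϱ, E)) :=
    tendsto_comap.mono_left (inf_le_right.trans (inf_le_left.trans inf_le_left))
  have h3 := tendsto_nhds_unique h1 h2
  rw [hg, Prod.mk.injEq] at h3
  obtain ⟨h4, h5⟩ := h3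
  refine hnot ⟨w.2, ?_, ?_⟩
  · rwa [← h4]
  · rw [← h5, ← h4]

/-- The lower bound of the relative energy away from the box extends to all states. -/
lemma relThermo_bound_of_le_entropy (hreg : IsRegular F) (ha : 0 < a₁) (hb : 0 < b₁)
    {c r Θ : ℝ} (hΘ : 0 < Θ)
    (hc : ∀ ϱ θ, 0 < ϱ → 0 < θ → (ϱ, θ) ∉ box a₁ a₂ b₁ b₂ → c * (1 + ϱ) ≤ relThermo F ϱ θ r Θ)
    {ϱ E : ℝ≥0} (hnot : ¬ IsBoxState F a₁ a₂ b₁ b₂ ϱ E) {v : ℝ}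
    (hv : (v : EReal) ≤ entropy F ϱ E) :
    c * (1 + ϱ) ≤ E - Θ * ϱ * v - ϱ * gibbsEnergy F (r, Θ) + F.p (r, Θ) := by
  by_contra! hlt
  have hcont : Continuous fun ε : ℝ => (E : ℝ) - Θ * ϱ * (v - ε) - ϱ * gibbsEnergy F (r, Θ)
      + F.p (r, Θ) := by fun_prop
  have hev : ∀ᶠ ε in 𝓝[>] (0 : ℝ), (E : ℝ) - Θ * ϱ * (v - ε) - ϱ * gibbsEnergy F (r, Θ)
      + F.p (r, Θ) < c * (1 + ϱ) := by
    refine (hcont.tendsto 0).eventually_lt_const ?_ |>.filter_mono nhdsWithin_le_nhds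
    simpa using hlt
  obtain ⟨ε, hε, hε0⟩ := (hev.and self_mem_nhdsWithin).exists
  have hcont2 : Continuous fun q : ℝ × ℝ => q.2 - Θ * q.1 * (v - ε) - q.1 * gibbsEnergy F (r, Θ)
      + F.p (r, Θ) - c * (1 + q.1) := by fun_prop
  have hev2 : ∀ᶠ q in 𝓝 ((ϱ : ℝ), (E : ℝ)), q.2 - Θ * q.1 * (v - ε)
      - q.1 * gibbsEnergy F (r, Θ) + F.p (r, Θ) - c * (1 + q.1) < 0 := by
    refine (hcont2.tendsto _).eventually_lt_const ?_
    simp only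
    linarith
  have hev3 : ∀ᶠ z in comap (fun z : ℝ × ℝ => (z.1, z.1 * F.e z)) (𝓝 ((ϱ : ℝ), (E : ℝ)))
      ⊓ 𝓟 Quadrant, z.1 * F.e z - Θ * z.1 * (v - ε)
      - z.1 * gibbsEnergy F (r, Θ) + F.p (r, Θ) - c * (1 + z.1) < 0 :=
    (tendsto_comap.mono_left inf_le_left).eventually hev2
  have hlim : ((v - ε : ℝ) : EReal) < entropy F ϱ E :=
    lt_of_lt_of_le (EReal.coe_lt_coe_iff.2 (sub_lt_self v hε0)) hv
  -- The entropy is an upper limit, so regular states of entropy above `v - ε` occur arbitrarily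
  -- near (ϱ,E), all eventually off the box. The violated strict inequality would persist at such a
  -- state.
  have hfreq := frequently_lt_of_lt_limsup (by isBoundedDefault) hlim
  have hQ : ∀ᶠ z in comap (fun z : ℝ × ℝ => (z.1, z.1 * F.e z)) (𝓝 ((ϱ : ℝ), (E : ℝ)))
      ⊓ 𝓟 Quadrant, z ∈ Quadrant := mem_inf_of_right (mem_principal_self _)
  obtain ⟨z, hz1, hz2, hz3, hz4⟩ := (hfreq.and_eventually
    (hev3.and (hQ.and (eventually_notMem_box hreg ha hb hnot)))).exists
  have h5 := hc z.1 z.2 hz3.1 hz3.2 hz4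
  have h6 : v - ε < F.s z := EReal.coe_lt_coe_iff.1 hz1
  have h7 := mul_le_mul_of_nonneg_left h6.le (mul_pos hΘ hz3.1).le
  rw [relThermo] at h5
  simp only [Prod.mk.eta] at h5
  nlinarith

/-- A thermodynamic state of entropy at least `s₀` either lies in the box, or its relative energy
controls the density, the internal energy and the pressure. -/
lemma exists_state_dichotomy (hreg : IsRegular F) (hgibbs : GibbsRelation F)
    (hstab : ThermoStable F) {P : ℝ≥0 → ℝ≥0 → ℝ} (hP : IsPhasePressure F P) (ha : 0 < a₁)
    (hb : 0 < b₁) (hδ : 0 < δ) (hne : (box (a₁ + δ) (a₂ - δ) (b₁ + δ) (b₂ - δ)).Nonempty)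
    {s₀ a b : ℝ} (hab : a ≤ b) (has : a ≤ s₀) {π₀ : ℝ} (hπ₀ : 0 < π₀) :
    ∃ κ C : ℝ, 0 < κ ∧ 0 ≤ C ∧ ∀ ϱ E : ℝ≥0, (ϱ ≠ 0 → (s₀ : EReal) ≤ entropy F ϱ E) →
      (∃ θ, ((ϱ : ℝ), θ) ∈ box a₁ a₂ b₁ b₂ ∧ (E : ℝ) = ϱ * F.e (ϱ, θ) ∧
        P ϱ E = F.p (ϱ, θ) ∧ entropy F ϱ E = (F.s (ϱ, θ) : EReal)) ∨
      (|P ϱ E| ≤ C * (1 + ϱ + E) ∧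
        ∀ r Θ, (r, Θ) ∈ box (a₁ + δ) (a₂ - δ) (b₁ + δ) (b₂ - δ) → π₀ ≤ F.p (r, Θ) →
          κ * (1 + ϱ + E) ≤ E - Θ * ϱ * cutoff (clamp a b) (entropy F ϱ E)
            - ϱ * gibbsEnergy F (r, Θ) + F.p (r, Θ)) := by
  obtain ⟨c, hc, hfar⟩ := exists_relThermo_ge_density (a₂ := a₂) (b₂ := b₂) hreg hgibbs hstab ha hb hδ
  obtain ⟨c₀, hc₀, hgrow⟩ := hP.growth
  obtain ⟨⟨r₀, Θ₀⟩, h₀⟩ := hne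
  have hinner : box (a₁ + δ) (a₂ - δ) (b₁ + δ) (b₂ - δ) ⊆ Quadrant :=
    box_subset_quadrant (by linarith) (by linarith)
  have hμcont : ContinuousOn (gibbsEnergy F) Quadrant :=
    (hreg.e_smooth.continuousOn.sub (continuousOn_snd.mul hreg.s_smooth.continuousOn)).add
      (hreg.p_smooth.continuousOn.div continuousOn_fst fun z hz => ne_of_gt hz.1)
  obtain ⟨M₁, hM₁⟩ := (isCompact_box (a₁ := a₁ + δ) (a₂ := a₂ - δ) (b₁ := b₁ + δ)
    (b₂ := b₂ - δ)).exists_bound_of_continuousOn (hμcont.mono hinner)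
  have hM₁0 : 0 ≤ M₁ := (norm_nonneg _).trans (hM₁ _ h₀)
  set L : ℝ := max |a| |b| with hL
  have hL0 : 0 ≤ L := (abs_nonneg a).trans (le_max_left _ _)
  -- `M` bounds Θ v + μ(r,Θ) for every truncated entropy value v, so the expression is at least `E -
  -- M * ϱ`. The weight `lam` below satisfies `lam * M ≤ c / 2`, so that adding `lam` times this
  -- bound to `c * (1 + ϱ)` gains a multiple of `E` at the cost of half the density term.
  set M : ℝ := |b₂| * L + M₁ with hM
  have hM0 : 0 ≤ M := by positivity
  set lam : ℝ := c / (2 * (M + 1)) with hlam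
  have hlam0 : 0 < lam := by positivity
  have hΘ₀ : 0 < Θ₀ := (hinner h₀).2
  -- Constant for ϱ|s|: the first summand controls positive entropy through coercivity at one
  -- reference state, the second controls negative entropy through the lower bound `s₀`.
  set C₁ : ℝ := (1 + |gibbsEnergy F (r₀, Θ₀)| + |F.p (r₀, Θ₀)|) / Θ₀ + |s₀| with hC₁
  have hC₁0 : 0 ≤ C₁ := by positivity
  refine ⟨min (min 1 π₀) (min (c / 2) lam / (1 + lam)), c₀ * (1 + C₁), by positivity,
    by positivity, fun ϱ E hs => ?_⟩
  have hE0 : (0 : ℝ) ≤ E := E.coe_nonneg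
  have hϱ0 : (0 : ℝ) ≤ ϱ := ϱ.coe_nonneg
  by_cases hbox : IsBoxState F a₁ a₂ b₁ b₂ ϱ E
  · left
    obtain ⟨θ, hθ, hE⟩ := hbox
    have hq := box_subset_quadrant ha hb hθ
    have h1 := hP.eq_p ϱ θ hq.1 hq.2
    have h2 := entropy_eq F hreg hstab hq.1 hq.2
    rw [← hE, Real.toNNReal_coe, Real.toNNReal_coe] at h1 h2
    exact ⟨θ, hθ, hE, h1, h2⟩
  right
  -- On the vacuum the product of density and |s| is `0 * ∞ = 0`, and the relative expression is E +
  -- p(r,Θ); `min 1 π₀` serves as the coercivity constant.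
  by_cases hϱ : ϱ = 0
  · subst hϱ
    constructor
    · have h := hgrow 0 E
      rw [ENNReal.coe_zero, zero_mul, add_zero, add_zero,
        show (c₀ : ℝ≥0∞) * (1 + E) = ENNReal.ofReal (c₀ * (1 + E)) by
          rw [ENNReal.ofReal_mul c₀.coe_nonneg, ENNReal.ofReal_add zero_le_one hE0]; simp,
        ENNReal.ofReal_le_ofReal_iff (by positivity)] at h
      refine h.trans ?_
      rw [NNReal.coe_zero, add_zero]
      have : (c₀ : ℝ) * (1 + E) * 1 ≤ c₀ * (1 + E) * (1 + C₁) :=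
        mul_le_mul_of_nonneg_left (by linarith) (by positivity)
      linarith
    · intro r Θ hrΘ hp
      rw [NNReal.coe_zero]
      have h1 : min (min 1 π₀) (min (c / 2) lam / (1 + lam)) ≤ 1 :=
        (min_le_left _ _).trans (min_le_left _ _)
      have h2 : min (min 1 π₀) (min (c / 2) lam / (1 + lam)) ≤ π₀ :=
        (min_le_left _ _).trans (min_le_right _ _)
      nlinarith
  have hs' := hs hϱ
  have key : ∀ v : ℝ, (v : EReal) ≤ entropy F ϱ E → ∀ r Θ,
      (r, Θ) ∈ box (a₁ + δ) (a₂ - δ) (b₁ + δ) (b₂ - δ) →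
      c * (1 + ϱ) ≤ E - Θ * ϱ * v - ϱ * gibbsEnergy F (r, Θ) + F.p (r, Θ) :=
    fun v hv r Θ hrΘ => relThermo_bound_of_le_entropy hreg ha hb (hinner hrΘ).2
      (fun ϱ' θ' h1 h2 h3 => hfar r Θ ϱ' θ' hrΘ h1 h2 h3) hbox hv
  have hϱpos : (0 : ℝ) < ϱ := lt_of_le_of_ne hϱ0 (by simpa [eq_comm] using hϱ)
  constructor
  -- Coercivity holds with every real v below the entropy, not just with its truncation. Read
  -- backwards it bounds ϱ v from above, which excludes entropy +∞ at positive density and makes the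
  -- pressure growth condition linear in 1 + ϱ + E.
  · have hupper : ∀ v : ℝ, (v : EReal) ≤ entropy F ϱ E →
        ϱ * v ≤ (1 + |gibbsEnergy F (r₀, Θ₀)| + |F.p (r₀, Θ₀)|) / Θ₀ * (1 + ϱ + E) := by
      intro v hv
      have h1 := key v hv r₀ Θ₀ h₀
      have h2 : 0 ≤ c * (1 + (ϱ : ℝ)) := by positivity
      rw [div_mul_eq_mul_div, le_div_iff₀ hΘ₀]
      have h3 : -((ϱ : ℝ) * gibbsEnergy F (r₀, Θ₀)) ≤ ϱ * |gibbsEnergy F (r₀, Θ₀)| := by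
        rw [← mul_neg]; exact mul_le_mul_of_nonneg_left (neg_le_abs _) hϱ0
      have h4 := le_abs_self (F.p (r₀, Θ₀))
      have h5 := mul_nonneg hϱ0 (abs_nonneg (F.p (r₀, Θ₀)))
      have h6 := mul_nonneg hE0 (abs_nonneg (F.p (r₀, Θ₀)))
      have h7 := mul_nonneg hE0 (abs_nonneg (gibbsEnergy F (r₀, Θ₀)))
      have h8 := abs_nonneg (gibbsEnergy F (r₀, Θ₀))
      nlinarith
    have hreal : ∃ x : ℝ, entropy F ϱ E = x ∧ s₀ ≤ x := by
      induction hσ : entropy F ϱ E using EReal.rec with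
      | bot => rw [hσ] at hs'; exact absurd hs' (by simp)
      | top =>
        exfalso
        set W := (1 + |gibbsEnergy F (r₀, Θ₀)| + |F.p (r₀, Θ₀)|) / Θ₀ * (1 + ϱ + E) with hW
        have h := hupper ((W + 1) / ϱ) (by rw [hσ]; exact le_top)
        rw [mul_div_cancel₀ _ hϱpos.ne'] at h
        linarith
      | coe x =>
        rw [hσ] at hs'
        exact ⟨x, rfl, EReal.coe_le_coe_iff.1 hs'⟩
    obtain ⟨x, hx, hsx⟩ := hreal
    have h1 := hupper x hx.ge
    have h2 : (ϱ : ℝ) * |x| ≤ C₁ * (1 + ϱ + E) := by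
      have h3 : 0 ≤ (1 + |gibbsEnergy F (r₀, Θ₀)| + |F.p (r₀, Θ₀)|) / Θ₀ * (1 + ϱ + E) := by
        positivity
      have h4 : 0 ≤ |s₀| * (1 + (E : ℝ)) := by positivity
      rw [hC₁, add_mul]
      rcases abs_cases x with ⟨h, _⟩ | ⟨h, _⟩
      · rw [h]
        nlinarith [mul_nonneg (abs_nonneg s₀) hϱ0]
      · rw [h]
        have h5 := neg_le_abs s₀
        have h6 : (ϱ : ℝ) * -x ≤ ϱ * |s₀| := mul_le_mul_of_nonneg_left (by linarith) hϱ0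
        nlinarith
    have h := hgrow ϱ E
    have habs : (EReal.abs (x : EReal)) = ENNReal.ofReal |x| := rfl
    rw [hx, habs, show (c₀ : ℝ≥0∞) * (1 + ϱ + ϱ * ENNReal.ofReal |x| + E)
        = ENNReal.ofReal (c₀ * (1 + ϱ + ϱ * |x| + E)) by
          rw [ENNReal.ofReal_mul c₀.coe_nonneg, ENNReal.ofReal_add (by positivity) hE0,
            ENNReal.ofReal_add (by positivity) (by positivity),
            ENNReal.ofReal_add zero_le_one hϱ0, ENNReal.ofReal_mul hϱ0]
          simp,
      ENNReal.ofReal_le_ofReal_iff (by positivity)] at h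
    refine h.trans ?_
    rw [mul_assoc]
    exact mul_le_mul_of_nonneg_left (by linarith) c₀.2
  · intro r Θ hrΘ hp
    have hv := cutoff_clamp_le (b := b) ((EReal.coe_le_coe_iff.2 has).trans hs')
    have hmem := cutoff_clamp_mem hab (entropy F ϱ E)
    set v := cutoff (clamp a b) (entropy F ϱ E) with hvdef
    have h1 := key v hv r Θ hrΘ
    have hvL : |v| ≤ L := abs_le_max_abs_abs hmem.1 hmem.2
    have hΘpos := (hinner hrΘ).2
    simp only at hΘpos
    have hΘb : Θ ≤ |b₂| := (by linarith [hrΘ.2.2] : Θ ≤ b₂).trans (le_abs_self _)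
    have h2 : Θ * v ≤ |b₂| * L :=
      (mul_le_mul_of_nonneg_left ((le_abs_self v).trans hvL) hΘpos.le).trans
        (mul_le_mul_of_nonneg_right hΘb hL0)
    have h3 : gibbsEnergy F (r, Θ) ≤ M₁ := (le_abs_self _).trans (hM₁ _ hrΘ)
    have h4 : (E : ℝ) - M * ϱ ≤ E - Θ * ϱ * v - ϱ * gibbsEnergy F (r, Θ) + F.p (r, Θ) := by
      nlinarith [mul_le_mul_of_nonneg_right h2 hϱ0, mul_le_mul_of_nonneg_right h3 hϱ0]
    set X : ℝ := E - Θ * ϱ * v - ϱ * gibbsEnergy F (r, Θ) + F.p (r, Θ)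
    have h5 : lam * M ≤ c / 2 := by
      rw [hlam, div_mul_eq_mul_div, div_le_iff₀ (by positivity)]
      nlinarith
    have h6 : min (c / 2) lam * (1 + ϱ + E) ≤ (1 + lam) * X := by
      have h7 := mul_le_mul_of_nonneg_left h4 hlam0.le
      have h8 := mul_le_mul_of_nonneg_right (min_le_left (c / 2) lam)
        (by positivity : (0 : ℝ) ≤ 1 + ϱ)
      have h9 := mul_le_mul_of_nonneg_right (min_le_right (c / 2) lam) hE0
      have h10 := mul_le_mul_of_nonneg_right h5 hϱ0
      nlinarith
    calc _ ≤ min (c / 2) lam / (1 + lam) * (1 + ϱ + E) :=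
          mul_le_mul_of_nonneg_right (min_le_right _ _) (by positivity)
      _ ≤ X := by
          rw [div_mul_eq_mul_div, div_le_iff₀ (by positivity)]
          linarith

end States

/-! ### The relative energy and its remainder -/

section Remainder

variable {F : ThermoFunctions} {a₁ a₂ b₁ b₂ δ : ℝ}

lemma norm_prod_sq_le (z : ℝ × ℝ) : ‖z‖ ^ 2 ≤ z.1 ^ 2 + z.2 ^ 2 := by
  rcases le_total ‖z.1‖ ‖z.2‖ with h | h
  · rw [Prod.norm_def, max_eq_right h, Real.norm_eq_abs, sq_abs]; nlinarith [sq_nonneg z.1]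
  · rw [Prod.norm_def, max_eq_left h, Real.norm_eq_abs, sq_abs]; nlinarith [sq_nonneg z.2]

/-- In a box, the thermodynamic remainder is quadratic in the distance to the strong solution. -/
lemma exists_box_remainder_bound (hreg : IsRegular F) (hgibbs : GibbsRelation F)
    (ha : 0 < a₁) (hb : 0 < b₁) {B : ℝ} (hB : 0 ≤ B) :
    ∃ K : ℝ, 0 ≤ K ∧ ∀ r Θ ϱ θ, (r, Θ) ∈ box a₁ a₂ b₁ b₂ → (ϱ, θ) ∈ box a₁ a₂ b₁ b₂ →
      ∀ d Dr DΘ Dp : ℝ, |d| ≤ B → |DΘ| ≤ B → Dr = -(r * d) →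
        pd₁ F.s (r, Θ) * Dr + pd₂ F.s (r, Θ) * DΘ = 0 →
        Dp = pd₁ F.p (r, Θ) * Dr + pd₂ F.p (r, Θ) * DΘ →
        (F.p (r, Θ) - F.p (ϱ, θ)) * d + (1 - ϱ / r) * Dp
            - ϱ * (F.s (ϱ, θ) - F.s (r, Θ)) * DΘ ≤ K * ((ϱ - r) ^ 2 + (θ - Θ) ^ 2) ∧
          ϱ * (F.s (ϱ, θ) - F.s (r, Θ)) ^ 2 ≤ K * ((ϱ - r) ^ 2 + (θ - Θ) ^ 2) := by
  have hsub := box_subset_quadrant (a₂ := a₂) (b₂ := b₂) ha hb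
  have hcpt := isCompact_box (a₁ := a₁) (a₂ := a₂) (b₁ := b₁) (b₂ := b₂)
  have hcvx := convex_box (a₁ := a₁) (a₂ := a₂) (b₁ := b₁) (b₂ := b₂)
  obtain ⟨Cp, hCp0, hCp⟩ := exists_taylor_bound hreg.p_smooth hcpt hcvx hsub
  obtain ⟨Cs, hCs0, hCs⟩ := exists_taylor_bound hreg.s_smooth hcpt hcvx hsub
  obtain ⟨Ls, hLs0, hLs⟩ := exists_lipschitz_bound (hreg.s_smooth.of_le one_le_two) hcpt hcvx hsub
  refine ⟨B * Cp + B * (|a₂| * Cs + Ls) + |a₂| * Ls ^ 2, by positivity, ?_⟩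
  intro r Θ ϱ θ hr hϱ d Dr DΘ Dp hd hDΘ hDr hDs hDp
  have hr0 : 0 < r := (hsub hr).1
  have hΘ0 : 0 < Θ := (hsub hr).2
  have hϱ0 : 0 < ϱ := (hsub hϱ).1
  have hra : r ≤ |a₂| := hr.1.2.trans (le_abs_self _)
  have hϱa : ϱ ≤ |a₂| := hϱ.1.2.trans (le_abs_self _)
  have h1 := hCp (ϱ, θ) hϱ (r, Θ) hr
  have h2 := hCs (ϱ, θ) hϱ (r, Θ) hr
  have h3 := hLs (ϱ, θ) hϱ (r, Θ) hr
  have hn0 := norm_nonneg (((ϱ, θ) : ℝ × ℝ) - (r, Θ))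
  have hn := norm_prod_sq_le (((ϱ, θ) : ℝ × ℝ) - (r, Θ))
  have hn1 : |ϱ - r| ≤ ‖((ϱ, θ) : ℝ × ℝ) - (r, Θ)‖ := norm_fst_le (((ϱ, θ) : ℝ × ℝ) - (r, Θ))
  simp only [Prod.fst_sub, Prod.snd_sub] at hn h1 h2
  have hmax := maxwell hreg hgibbs hr0 hΘ0
  set n := ‖((ϱ, θ) : ℝ × ℝ) - (r, Θ)‖
  set Q := (ϱ - r) ^ 2 + (θ - Θ) ^ 2
  rw [Real.norm_eq_abs] at h3
  set ps := F.p (ϱ, θ)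
  set pb := F.p (r, Θ)
  set ss := F.s (ϱ, θ)
  set sb := F.s (r, Θ)
  set p1 := pd₁ F.p (r, Θ)
  set p2 := pd₂ F.p (r, Θ)
  set s1 := pd₁ F.s (r, Θ)
  set s2 := pd₂ F.s (r, Θ)
  -- All first-order terms cancel. In the direction of ϱ this is Maxwell's relation; in the
  -- direction of ϑ it also uses the entropy transport and `Dr = -(r * d)`. What is left are Taylor
  -- remainders of `p` and `s` and the product (ϱ - r)(s - s(r,Θ)).
  have hkey : (pb - ps) * d + (1 - ϱ / r) * Dp - ϱ * (ss - sb) * DΘ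
      = -d * (ps - pb - (p1 * (ϱ - r) + p2 * (θ - Θ)))
        - DΘ * (r * (ss - sb - (s1 * (ϱ - r) + s2 * (θ - Θ))) + (ϱ - r) * (ss - sb)) := by
    have h4 : s2 * DΘ = -(p2 * d / r) := by
      have h5 : s2 * DΘ = -(s1 * Dr) := by linarith
      rw [h5, hmax, hDr]; field_simp
    have h5 : p2 = -(s1 * r ^ 2) := by rw [hmax]; field_simp
    have h6 : s1 * r * d = s2 * DΘ := by rw [h4, h5]; field_simp
    have h7 : (1 - ϱ / r) * Dp = (r - ϱ) * (-(p1 * d) - s1 * r * DΘ) := by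
      rw [hDp, hDr, h5]; field_simp; ring
    rw [h7, h5]
    linear_combination (θ - Θ) * r * h6
  have hnQ : n ^ 2 ≤ Q := hn
  have e1 : |(-d) * (ps - pb - (p1 * (ϱ - r) + p2 * (θ - Θ)))| ≤ B * Cp * Q := by
    rw [abs_mul, abs_neg]
    calc _ ≤ B * (Cp * n ^ 2) := mul_le_mul hd h1 (abs_nonneg _) hB
      _ ≤ B * (Cp * Q) := by gcongr
      _ = _ := by ring
  have e2 : |r * (ss - sb - (s1 * (ϱ - r) + s2 * (θ - Θ)))| ≤ |a₂| * (Cs * n ^ 2) := by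
    rw [abs_mul, abs_of_pos hr0]
    exact mul_le_mul hra h2 (abs_nonneg _) (abs_nonneg _)
  have e3 : |(ϱ - r) * (ss - sb)| ≤ n * (Ls * n) := by
    rw [abs_mul]
    exact mul_le_mul hn1 h3 (abs_nonneg _) hn0
  have e4 : |DΘ * (r * (ss - sb - (s1 * (ϱ - r) + s2 * (θ - Θ))) + (ϱ - r) * (ss - sb))|
      ≤ B * (|a₂| * Cs + Ls) * Q := by
    rw [abs_mul]
    calc _ ≤ B * (|a₂| * (Cs * n ^ 2) + n * (Ls * n)) :=
          mul_le_mul hDΘ ((abs_add_le _ _).trans (add_le_add e2 e3)) (abs_nonneg _) hB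
      _ = B * (|a₂| * Cs + Ls) * n ^ 2 := by ring
      _ ≤ _ := by gcongr
  have e5 : ϱ * (ss - sb) ^ 2 ≤ |a₂| * Ls ^ 2 * Q := by
    have h4 : (ss - sb) ^ 2 ≤ (Ls * n) ^ 2 := by
      rw [← sq_abs (ss - sb)]; exact pow_le_pow_left₀ (abs_nonneg _) h3 2
    calc _ ≤ |a₂| * (Ls * n) ^ 2 := mul_le_mul hϱa h4 (sq_nonneg _) (abs_nonneg _)
      _ = |a₂| * Ls ^ 2 * n ^ 2 := by ring
      _ ≤ _ := by gcongr
  have hQ0 : 0 ≤ Q := by positivity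
  have f1 : 0 ≤ B * Cp * Q := by positivity
  have f2 : 0 ≤ B * (|a₂| * Cs + Ls) * Q := by positivity
  have f3 : 0 ≤ |a₂| * Ls ^ 2 * Q := by positivity
  constructor
  · rw [hkey]
    have := le_abs_self ((-d) * (ps - pb - (p1 * (ϱ - r) + p2 * (θ - Θ))))
    have := neg_abs_le
      (DΘ * (r * (ss - sb - (s1 * (ϱ - r) + s2 * (θ - Θ))) + (ϱ - r) * (ss - sb)))
    linarith
  · linarith

/-! ### Bounds at arbitrary phase states. -/

/-- The thermodynamic part of the relative energy at a phase state, with truncated entropy. -/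
noncomputable def relThermoPhase (F : ThermoFunctions) (a b : ℝ) (r Θ : ℝ) (ϱ E : ℝ≥0) : ℝ :=
  E - Θ * ϱ * cutoff (clamp a b) (entropy F ϱ E) - ϱ * gibbsEnergy F (r, Θ) + F.p (r, Θ)

lemma sq_le_of_far {ϱ E v s L : ℝ} (hvs : |v - s| ≤ L) (hϱ : 0 ≤ ϱ) (hE : 0 ≤ E) :
    ϱ * (v - s) ^ 2 ≤ L ^ 2 * (1 + ϱ + E) := by
  have h : (v - s) ^ 2 ≤ L ^ 2 := by
    rw [← sq_abs]; exact pow_le_pow_left₀ (abs_nonneg _) hvs 2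
  calc ϱ * (v - s) ^ 2 ≤ ϱ * L ^ 2 := mul_le_mul_of_nonneg_left h hϱ
    _ = L ^ 2 * ϱ := mul_comm _ _
    _ ≤ L ^ 2 * (1 + ϱ + E) := mul_le_mul_of_nonneg_left (by linarith) (sq_nonneg L)

/-- Far from the strong solution no cancellation is needed: every term is separately at most linear
in 1 + ϱ + E, a quantity that the relative energy controls there. -/
lemma remainder_le_of_far {ϱ E r α p P v s d DΘ Dp B C M L : ℝ} (hϱ : 0 ≤ ϱ) (hE : 0 ≤ E)
    (hα : 0 < α) (hr : α ≤ r) (hM : 0 ≤ M) (hC : 0 ≤ C) (hp : |p| ≤ M)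
    (hP : |P| ≤ C * (1 + ϱ + E)) (hvs : |v - s| ≤ L) (hd : |d| ≤ B) (hDΘ : |DΘ| ≤ B)
    (hDp : |Dp| ≤ B) :
    (p - P) * d + (1 - ϱ / r) * Dp - ϱ * (v - s) * DΘ
      ≤ (B * (M + C) + B * (1 + 1 / α) + L * B) * (1 + ϱ + E) := by
  have hB : 0 ≤ B := (abs_nonneg _).trans hd
  have hL : 0 ≤ L := (abs_nonneg _).trans hvs
  have hG : 1 ≤ 1 + ϱ + E := by linarith
  have hr0 : 0 < r := hα.trans_le hr
  have e1 : (p - P) * d ≤ B * (M + C) * (1 + ϱ + E) := by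
    have h5 : |p - P| ≤ (M + C) * (1 + ϱ + E) :=
      calc |p - P| ≤ M + C * (1 + ϱ + E) := (abs_sub _ _).trans (add_le_add hp hP)
        _ ≤ M * (1 + ϱ + E) + C * (1 + ϱ + E) :=
          add_le_add_left (le_mul_of_one_le_right hM hG) _
        _ = _ := by ring
    calc _ ≤ |(p - P) * d| := le_abs_self _
      _ ≤ (M + C) * (1 + ϱ + E) * B := by
        rw [abs_mul]; exact mul_le_mul h5 hd (abs_nonneg _) (by positivity)
      _ = _ := by ring
  have e2 : (1 - ϱ / r) * Dp ≤ B * (1 + 1 / α) * (1 + ϱ + E) := by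
    have h5 : |1 - ϱ / r| ≤ (1 + 1 / α) * (1 + ϱ + E) :=
      calc |1 - ϱ / r| ≤ |1| + |ϱ / r| := abs_sub _ _
        _ = 1 + ϱ / r := by rw [abs_one, abs_of_nonneg (by positivity)]
        _ ≤ 1 * (1 + ϱ + E) + 1 / α * (1 + ϱ + E) := by
          refine add_le_add (by linarith) ?_
          calc ϱ / r ≤ ϱ / α := div_le_div_of_nonneg_left hϱ hα hr
            _ = 1 / α * ϱ := by ring
            _ ≤ _ := mul_le_mul_of_nonneg_left (by linarith) (by positivity)
        _ = _ := by ring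
    calc _ ≤ |(1 - ϱ / r) * Dp| := le_abs_self _
      _ ≤ (1 + 1 / α) * (1 + ϱ + E) * B := by
        rw [abs_mul]; exact mul_le_mul h5 hDp (abs_nonneg _) (by positivity)
      _ = _ := by ring
  have e3 : -(ϱ * (v - s) * DΘ) ≤ L * B * (1 + ϱ + E) := by
    calc _ ≤ |ϱ * (v - s) * DΘ| := neg_le_abs _
      _ = ϱ * (|v - s| * |DΘ|) := by rw [abs_mul, abs_mul, abs_of_nonneg hϱ, mul_assoc]
      _ ≤ ϱ * (L * B) := mul_le_mul_of_nonneg_left (mul_le_mul hvs hDΘ (abs_nonneg _) hL) hϱ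
      _ = L * B * ϱ := mul_comm _ _
      _ ≤ _ := mul_le_mul_of_nonneg_left (by linarith) (mul_nonneg hL hB)
  calc _ = (p - P) * d + (1 - ϱ / r) * Dp + -(ϱ * (v - s) * DΘ) := by ring
    _ ≤ B * (M + C) * (1 + ϱ + E) + B * (1 + 1 / α) * (1 + ϱ + E) + L * B * (1 + ϱ + E) :=
      add_le_add (add_le_add e1 e2) e3
    _ = _ := by ring

set_option maxHeartbeats 1000000 in
/-- The thermodynamic remainder at a phase state is controlled by the relative energy, which
vanishes only at the state of the strong solution. -/
lemma exists_thermo_remainder_bound (hreg : IsRegular F) (hgibbs : GibbsRelation F)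
    (hstab : ThermoStable F) {P : ℝ≥0 → ℝ≥0 → ℝ} (hP : IsPhasePressure F P) (ha : 0 < a₁)
    (hb : 0 < b₁) (hδ : 0 < δ) (hne : (box (a₁ + δ) (a₂ - δ) (b₁ + δ) (b₂ - δ)).Nonempty)
    {s₀ a b : ℝ} (hab : a ≤ b) (has : a ≤ s₀) (hbox : ∀ z ∈ box a₁ a₂ b₁ b₂, F.s z ∈ Icc a b)
    {π₀ : ℝ} (hπ₀ : 0 < π₀) {B : ℝ} (hB : 0 ≤ B) :
    ∃ K : ℝ, 0 ≤ K ∧ ∀ r Θ, (r, Θ) ∈ box (a₁ + δ) (a₂ - δ) (b₁ + δ) (b₂ - δ) →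
      π₀ ≤ F.p (r, Θ) →
      ∀ ϱ E : ℝ≥0, (ϱ ≠ 0 → (s₀ : EReal) ≤ entropy F ϱ E) →
      0 ≤ relThermoPhase F a b r Θ ϱ E ∧
      (relThermoPhase F a b r Θ ϱ E = 0 → (ϱ : ℝ) = r ∧ (E : ℝ) = r * F.e (r, Θ)) ∧
      ϱ * (cutoff (clamp a b) (entropy F ϱ E) - F.s (r, Θ)) ^ 2
        ≤ K * relThermoPhase F a b r Θ ϱ E ∧
      ∀ d Dr DΘ Dp : ℝ, |d| ≤ B → |DΘ| ≤ B → |Dp| ≤ B → Dr = -(r * d) →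
        pd₁ F.s (r, Θ) * Dr + pd₂ F.s (r, Θ) * DΘ = 0 →
        Dp = pd₁ F.p (r, Θ) * Dr + pd₂ F.p (r, Θ) * DΘ →
        (F.p (r, Θ) - P ϱ E) * d + (1 - ϱ / r) * Dp
            - ϱ * (cutoff (clamp a b) (entropy F ϱ E) - F.s (r, Θ)) * DΘ
          ≤ K * relThermoPhase F a b r Θ ϱ E := by
  obtain ⟨κ, C, hκ, hC, hdich⟩ := exists_state_dichotomy hreg hgibbs hstab hP ha hb hδ hne hab has
    hπ₀
  obtain ⟨c, hc, -, hsq⟩ := exists_relThermo_ge_sq (a₂ := a₂) (b₂ := b₂) hreg hgibbs hstab ha hb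
  obtain ⟨K₁, hK₁, hnear⟩ := exists_box_remainder_bound (a₂ := a₂) (b₂ := b₂) hreg hgibbs ha hb hB
  have hin : box (a₁ + δ) (a₂ - δ) (b₁ + δ) (b₂ - δ) ⊆ box a₁ a₂ b₁ b₂ := fun z hz =>
    ⟨⟨by linarith [hz.1.1], by linarith [hz.1.2]⟩, by linarith [hz.2.1], by linarith [hz.2.2]⟩
  have hsub := box_subset_quadrant (a₂ := a₂) (b₂ := b₂) ha hb
  obtain ⟨Mp, hMp⟩ := (isCompact_box (a₁ := a₁) (a₂ := a₂) (b₁ := b₁)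
    (b₂ := b₂)).exists_bound_of_continuousOn (hreg.p_smooth.continuousOn.mono hsub)
  have hMp0 : 0 ≤ Mp := (norm_nonneg _).trans (hMp _ (hin hne.some_mem))
  set L : ℝ := b - a with hL
  have hL0 : 0 ≤ L := sub_nonneg.2 hab
  set K₂ : ℝ := (B * (Mp + C) + B * (1 + 1 / a₁) + L * B + L ^ 2) / κ with hK₂
  have hK₂0 : 0 ≤ K₂ := by positivity
  refine ⟨K₁ / c + K₂, by positivity, ?_⟩
  intro r Θ hrΘ hp ϱ E hs
  have hr0 : 0 < r := (hsub (hin hrΘ)).1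
  have hE0 : (0 : ℝ) ≤ E := E.coe_nonneg
  have hϱ0 : (0 : ℝ) ≤ ϱ := ϱ.coe_nonneg
  rcases hdich ϱ E hs with ⟨θ, hθ, hE, hPE, hent⟩ | ⟨hPC, hfar⟩
  · have hv : cutoff (clamp a b) (entropy F ϱ E) = F.s (ϱ, θ) := by
      rw [hent, cutoff_coe, clamp_of_mem (hbox _ hθ)]
    have hh : relThermoPhase F a b r Θ ϱ E = relThermo F ϱ θ r Θ := by
      rw [relThermoPhase, hv, relThermo, hE]; ring
    have h1 := hsq r Θ ϱ θ (hin hrΘ) hθ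
    rw [hh, hv, hPE]
    have hQ0 : 0 ≤ ((ϱ : ℝ) - r) ^ 2 + (θ - Θ) ^ 2 := by positivity
    have h0 : 0 ≤ relThermo F ϱ θ r Θ := le_trans (by positivity) h1
    have hKQ : K₁ * (((ϱ : ℝ) - r) ^ 2 + (θ - Θ) ^ 2) ≤ (K₁ / c + K₂) * relThermo F ϱ θ r Θ := by
      have h2 : K₁ / c * (c * (((ϱ : ℝ) - r) ^ 2 + (θ - Θ) ^ 2)) ≤ K₁ / c * relThermo F ϱ θ r Θ :=
        mul_le_mul_of_nonneg_left h1 (by positivity)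
      have h3 : K₁ / c * (c * (((ϱ : ℝ) - r) ^ 2 + (θ - Θ) ^ 2))
          = K₁ * (((ϱ : ℝ) - r) ^ 2 + (θ - Θ) ^ 2) := by field_simp
      nlinarith [mul_nonneg hK₂0 h0]
    refine ⟨h0, fun hzero => ?_, ?_, fun d Dr DΘ Dp hd hDΘ hDp h2 h3 h4 => ?_⟩
    · rw [hzero] at h1
      have h2 : ((ϱ : ℝ) - r) ^ 2 + (θ - Θ) ^ 2 ≤ 0 := by
        by_contra! h; exact absurd h1 (not_le.2 (by positivity))
      have h3 : (ϱ : ℝ) - r = 0 := by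
        rw [← sq_eq_zero_iff]; nlinarith [sq_nonneg ((ϱ : ℝ) - r), sq_nonneg (θ - Θ)]
      have h4 : θ - Θ = 0 := by
        rw [← sq_eq_zero_iff]; nlinarith [sq_nonneg ((ϱ : ℝ) - r), sq_nonneg (θ - Θ)]
      have h5 : (ϱ : ℝ) = r := by linarith
      have h6 : θ = Θ := by linarith
      exact ⟨h5, by rw [hE, h5, h6]⟩
    -- The bound on the squared entropy difference does not involve the derivatives, so they may be
    -- set to zero.
    · exact (hnear r Θ ϱ θ (hin hrΘ) hθ 0 0 0 0 (by simpa) (by simpa) (by simp) (by simp)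
        (by simp)).2.trans hKQ
    · exact (hnear r Θ ϱ θ (hin hrΘ) hθ d Dr DΘ Dp hd hDΘ h2 h3 h4).1.trans hKQ
  · have h1 : κ * (1 + ϱ + E) ≤ relThermoPhase F a b r Θ ϱ E := hfar r Θ hrΘ hp
    set h := relThermoPhase F a b r Θ ϱ E with hh
    have hv := cutoff_clamp_mem hab (entropy F ϱ E)
    set v := cutoff (clamp a b) (entropy F ϱ E) with hvd
    have hs := hbox _ (hin hrΘ)
    have hvs : |v - F.s (r, Θ)| ≤ L := abs_le.2 ⟨by linarith [hv.1, hs.2], by linarith [hv.2, hs.1]⟩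
    have hG : (0 : ℝ) < 1 + ϱ + E := by positivity
    have h0 : 0 < h := lt_of_lt_of_le (by positivity) h1
    have hK₂h : (B * (Mp + C) + B * (1 + 1 / a₁) + L * B + L ^ 2) * (1 + ϱ + E)
        ≤ (K₁ / c + K₂) * h := by
      have h2 : K₂ * (κ * (1 + ϱ + E)) ≤ K₂ * h := mul_le_mul_of_nonneg_left h1 hK₂0
      have h3 : K₂ * (κ * (1 + ϱ + E))
          = (B * (Mp + C) + B * (1 + 1 / a₁) + L * B + L ^ 2) * (1 + ϱ + E) := by
        rw [hK₂]; field_simp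
      have h4 : 0 ≤ K₁ / c * h := by positivity
      nlinarith
    have hvϱ := sq_le_of_far hvs hϱ0 hE0
    refine ⟨h0.le, fun hzero => absurd hzero h0.ne', ?_,
      fun d Dr DΘ Dp hd hDΘ hDp h2 h3 h4 => ?_⟩
    · refine hvϱ.trans (le_trans ?_ hK₂h)
      exact mul_le_mul_of_nonneg_right (le_add_of_nonneg_left (by positivity)) hG.le
    · refine (remainder_le_of_far hϱ0 hE0 ha (hin hrΘ).1.1 hMp0 hC (hMp _ (hin hrΘ)) hPC hvs hd hDΘ
        hDp).trans (le_trans ?_ hK₂h)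
      exact mul_le_mul_of_nonneg_right (le_add_of_nonneg_right (by positivity)) hG.le

/-- The relative energy of a point of the phase space. -/
noncomputable def relEnergy (F : ThermoFunctions) (a b r Θ : ℝ) (u : Fin 3 → ℝ) (z : Phase) : ℝ :=
  (∑ i, (z.2.2 i - z.1 * u i) ^ 2) / (2 * z.1) + relThermoPhase F a b r Θ z.1 z.2.1

/-- The points of the phase space charged by a dissipative measure-valued solution. -/
def IsAdmissible (F : ThermoFunctions) (s₀ : ℝ) (z : Phase) : Prop :=
  (z.1 = 0 → z.2.2 = 0) ∧ (z.1 ≠ 0 → (s₀ : EReal) ≤ entropy F z.1 z.2.1)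

/-- The remainder in the relative energy inequality. -/
noncomputable def remainder (F : ThermoFunctions) (P : ℝ≥0 → ℝ≥0 → ℝ) (a b r Θ : ℝ)
    (u : Fin 3 → ℝ) (dU : Fin 3 → Fin 3 → ℝ) (DΘ Dp : ℝ) (gΘ : Fin 3 → ℝ) (z : Phase) : ℝ :=
  -(∑ i, ∑ j, (z.2.2 i - z.1 * u i) * (z.2.2 j - z.1 * u j) / z.1 * dU i j)
    + ((F.p (r, Θ) - P z.1 z.2.1) * (∑ i, dU i i) + (1 - z.1 / r) * Dp
      - z.1 * (cutoff (clamp a b) (entropy F z.1 z.2.1) - F.s (r, Θ)) * DΘ)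
    - ∑ i, (cutoff (clamp a b) (entropy F z.1 z.2.1) - F.s (r, Θ)) * (z.2.2 i - z.1 * u i) * gΘ i

set_option maxHeartbeats 1000000 in
/-- The remainder is controlled by the relative energy, which vanishes only at the phase point of
the strong solution. -/
lemma exists_remainder_bound (hreg : IsRegular F) (hgibbs : GibbsRelation F)
    (hstab : ThermoStable F) {P : ℝ≥0 → ℝ≥0 → ℝ} (hP : IsPhasePressure F P) (ha : 0 < a₁)
    (hb : 0 < b₁) (hδ : 0 < δ) (hne : (box (a₁ + δ) (a₂ - δ) (b₁ + δ) (b₂ - δ)).Nonempty)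
    {s₀ a b : ℝ} (hab : a ≤ b) (has : a ≤ s₀) (hbox : ∀ z ∈ box a₁ a₂ b₁ b₂, F.s z ∈ Icc a b)
    {π₀ : ℝ} (hπ₀ : 0 < π₀) {B : ℝ} (hB : 0 ≤ B) :
    ∃ K : ℝ, 0 ≤ K ∧ ∀ r Θ, (r, Θ) ∈ box (a₁ + δ) (a₂ - δ) (b₁ + δ) (b₂ - δ) →
      π₀ ≤ F.p (r, Θ) → ∀ (u : Fin 3 → ℝ) (z : Phase), IsAdmissible F s₀ z →
      0 ≤ relEnergy F a b r Θ u z ∧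
      (relEnergy F a b r Θ u z = 0 → (z.1 : ℝ) = r ∧ (z.2.1 : ℝ) = r * F.e (r, Θ) ∧
        ∀ i, z.2.2 i = r * u i) ∧
      ∀ (dU : Fin 3 → Fin 3 → ℝ) (Dr DΘ Dp : ℝ) (gΘ : Fin 3 → ℝ), (∀ i j, |dU i j| ≤ B) →
        (∀ i, |gΘ i| ≤ B) → |∑ i, dU i i| ≤ B → |DΘ| ≤ B → |Dp| ≤ B →
        Dr = -(r * ∑ i, dU i i) →
        pd₁ F.s (r, Θ) * Dr + pd₂ F.s (r, Θ) * DΘ = 0 →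
        Dp = pd₁ F.p (r, Θ) * Dr + pd₂ F.p (r, Θ) * DΘ →
        remainder F P a b r Θ u dU DΘ Dp gΘ z ≤ K * relEnergy F a b r Θ u z := by
  obtain ⟨K, hK0, hK⟩ := exists_thermo_remainder_bound hreg hgibbs hstab hP ha hb hδ hne hab has
    hbox hπ₀ hB
  -- `K` pays for the thermodynamic terms, `6 * B` for the nine convective products, and the last
  -- two summands for the entropy flux after Young's inequality.
  refine ⟨K + 6 * B + B + 3 / 2 * B * K, by positivity, ?_⟩
  intro r Θ hrΘ hp u z hz
  have hr0 : 0 < r := (box_subset_quadrant (by linarith) (by linarith) hrΘ).1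
  obtain ⟨h0, hzero, hsq, hrem⟩ := hK r Θ hrΘ hp z.1 z.2.1 hz.2
  rw [relEnergy]
  set h := relThermoPhase F a b r Θ z.1 z.2.1
  set v := cutoff (clamp a b) (entropy F z.1 z.2.1) with hvd
  have hϱ0 : (0 : ℝ) ≤ z.1 := z.1.coe_nonneg
  have hkin0 : 0 ≤ (∑ i, (z.2.2 i - z.1 * u i) ^ 2) / (2 * (z.1 : ℝ)) := by positivity
  set k := (∑ i, (z.2.2 i - z.1 * u i) ^ 2) / (2 * (z.1 : ℝ)) with hkd
  refine ⟨by positivity, fun hz0 => ?_, fun dU Dr DΘ Dp gΘ hdU hgΘ hdiv hDΘ hDp h1 h2 h3 => ?_⟩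
  · have hk : k = 0 := by linarith
    obtain ⟨h1, h2⟩ := hzero (by linarith)
    refine ⟨h1, h2, ?_⟩
    rw [hkd, h1, div_eq_zero_iff, or_iff_left (by positivity),
      Finset.sum_eq_zero_iff_of_nonneg fun _ _ => sq_nonneg _] at hk
    intro i
    have h3 := pow_eq_zero_iff two_ne_zero |>.1 (hk i (Finset.mem_univ i))
    linarith
  have hM := hrem _ Dr DΘ Dp hdiv hDΘ hDp h1 h2 h3
  rw [remainder, ← hvd]
  -- On the vacuum the momentum is zero by admissibility, so the convective and flux terms vanish;
  -- division by zero density gives 0, as intended.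
  by_cases hϱ : z.1 = 0
  · have hm := hz.1 hϱ
    have hS1 : ∑ i, ∑ j, (z.2.2 i - z.1 * u i) * (z.2.2 j - z.1 * u j) / (z.1 : ℝ) * dU i j = 0 := by
      simp [hϱ]
    have hS2 : ∑ i, (v - F.s (r, Θ)) * (z.2.2 i - z.1 * u i) * gΘ i = 0 := by
      simp [hϱ, hm]
    rw [hS1, hS2]
    have : 0 ≤ (6 * B + B + 3 / 2 * B * K) * (k + h) := by positivity
    nlinarith [mul_nonneg hK0 hkin0]
  have hϱpos : (0 : ℝ) < z.1 := by positivity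
  set w : Fin 3 → ℝ := fun i => z.2.2 i - z.1 * u i with hw
  have hkw : k * (2 * z.1) = ∑ i, w i ^ 2 := by
    rw [hkd, div_mul_cancel₀]; positivity
  have hprod : ∀ i j, |w i * w j / (z.1 : ℝ) * dU i j| ≤ B * ((w i ^ 2 + w j ^ 2) / (2 * z.1)) := by
    intro i j
    rw [abs_mul, abs_div, abs_mul, abs_of_pos hϱpos, mul_comm B]
    refine mul_le_mul ?_ (hdU i j) (abs_nonneg _) (by positivity)
    rw [div_le_div_iff₀ hϱpos (by positivity)]
    nlinarith [sq_nonneg (|w i| - |w j|), sq_abs (w i), sq_abs (w j)]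
  have hS1 : -(∑ i, ∑ j, w i * w j / (z.1 : ℝ) * dU i j) ≤ 6 * B * k := by
    have h4 : |∑ i, ∑ j, w i * w j / (z.1 : ℝ) * dU i j|
        ≤ ∑ i, ∑ j, B * ((w i ^ 2 + w j ^ 2) / (2 * (z.1 : ℝ))) :=
      (Finset.abs_sum_le_sum_abs _ _).trans (Finset.sum_le_sum fun i _ =>
        (Finset.abs_sum_le_sum_abs _ _).trans (Finset.sum_le_sum fun j _ => hprod i j))
    have h5 : ∑ i, ∑ j, B * ((w i ^ 2 + w j ^ 2) / (2 * (z.1 : ℝ))) = 6 * B * k := by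
      have h6 : k = (w 0 ^ 2 + w 1 ^ 2 + w 2 ^ 2) / (2 * (z.1 : ℝ)) := by
        rw [hkd, Fin.sum_univ_three]
      rw [h6]
      simp only [Fin.sum_univ_three]
      field_simp
      ring
    linarith [neg_le_abs (∑ i, ∑ j, w i * w j / (z.1 : ℝ) * dU i j)]
  -- Young's inequality weighted by the density splits the flux into ϱ(v - s)², bounded by the
  -- thermodynamic part, and a kinetic part.
  have hterm : ∀ i, |(v - F.s (r, Θ)) * w i * gΘ i|
      ≤ B / 2 * (z.1 * (v - F.s (r, Θ)) ^ 2) + B * (w i ^ 2 / (2 * z.1)) := by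
    intro i
    rw [abs_mul]
    have h4 : |(v - F.s (r, Θ)) * w i| ≤ z.1 * (v - F.s (r, Θ)) ^ 2 / 2 + w i ^ 2 / (2 * z.1) := by
      rw [abs_mul, ← sq_abs (v - F.s (r, Θ)), ← sq_abs (w i), div_add_div _ _ two_ne_zero
        (by positivity), le_div_iff₀ (by positivity)]
      nlinarith [sq_nonneg (z.1 * |v - F.s (r, Θ)| - |w i|)]
    calc _ ≤ (z.1 * (v - F.s (r, Θ)) ^ 2 / 2 + w i ^ 2 / (2 * z.1)) * B :=
          mul_le_mul h4 (hgΘ i) (abs_nonneg _) (by positivity)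
      _ = _ := by ring
  have hS2 : -(∑ i, (v - F.s (r, Θ)) * w i * gΘ i) ≤ 3 / 2 * B * K * h + B * k := by
    have h4 := (Finset.abs_sum_le_sum_abs (fun i => (v - F.s (r, Θ)) * w i * gΘ i)
      Finset.univ).trans (Finset.sum_le_sum fun i _ => hterm i)
    have h5 : ∑ i, (B / 2 * (z.1 * (v - F.s (r, Θ)) ^ 2) + B * (w i ^ 2 / (2 * z.1)))
        = 3 / 2 * B * (z.1 * (v - F.s (r, Θ)) ^ 2) + B * k := by
      have h6 : k = (w 0 ^ 2 + w 1 ^ 2 + w 2 ^ 2) / (2 * (z.1 : ℝ)) := by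
        rw [hkd, Fin.sum_univ_three]
      rw [h6]
      simp only [Fin.sum_univ_three]
      field_simp
      ring
    have h6 := mul_le_mul_of_nonneg_left hsq (by positivity : 0 ≤ 3 / 2 * B)
    linarith [neg_le_abs (∑ i, (v - F.s (r, Θ)) * w i * gΘ i)]
  have g1 : 0 ≤ K * k := by positivity
  have g2 : 0 ≤ B * h := by positivity
  have g3 : 0 ≤ B * K * k := by positivity
  nlinarith

end Remainder

/-! ### Differentiation rules -/

/-- The restriction of `f` to the line through `(t, x)` in the time direction (`none`) or in a
coordinate direction of the torus (`some i`). -/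
noncomputable def line (o : Option (Fin 3)) (f : ℝ → Torus → ℝ) (t : ℝ) (x : Torus) (h : ℝ) : ℝ :=
  match o with
  | none => f (t + h) x
  | some i => f t (x + Pi.single i (h : UnitAddCircle))

/-- The time derivative (`none`) or a space derivative (`some i`). -/
noncomputable def pdiff (o : Option (Fin 3)) (f : ℝ → Torus → ℝ) (t : ℝ) (x : Torus) : ℝ :=
  deriv (line o f t x) 0

section Rules

variable {T : ℝ} {f g : ℝ → Torus → ℝ} {t : ℝ} {x : Torus}

lemma pdiff_none : pdiff none f t x = dt f t x := by
  have h := deriv_comp_const_add (fun τ => f τ x) t 0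
  rw [add_zero] at h
  exact h

lemma pdiff_some (i : Fin 3) : pdiff (some i) f t x = dx i f t x := rfl

lemma line_zero (o : Option (Fin 3)) : line o f t x 0 = f t x := by
  cases o
  · simp only [line, add_zero]
  · simp only [line, AddCircle.coe_zero, Pi.single_zero, add_zero]

lemma IsC1.hasDerivAt_line (hf : IsC1 T f) (ht : t ∈ Ioo 0 T) (x : Torus)
    (o : Option (Fin 3)) : HasDerivAt (line o f t x) (pdiff o f t x) 0 := by
  cases o with
  | none =>
    rw [pdiff_none]
    have h := hf.hasDerivAt_dt ht x
    rw [← add_zero t] at h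
    have h2 := h.comp_const_add t 0
    rw [add_zero] at h2
    exact h2
  | some i => exact hf.hasDerivAt_dx (Ioo_subset_Icc_self ht) x i

lemma pdiff_mul (hf : IsC1 T f) (hg : IsC1 T g) (ht : t ∈ Ioo 0 T) (o : Option (Fin 3)) :
    pdiff o (fun t x => f t x * g t x) t x = pdiff o f t x * g t x + f t x * pdiff o g t x := by
  have h := (hf.hasDerivAt_line ht x o).mul (hg.hasDerivAt_line ht x o)
  rw [line_zero, line_zero] at h
  rw [← h.deriv]
  cases o <;> rfl

lemma pdiff_add (hf : IsC1 T f) (hg : IsC1 T g) (ht : t ∈ Ioo 0 T) (o : Option (Fin 3)) :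
    pdiff o (fun t x => f t x + g t x) t x = pdiff o f t x + pdiff o g t x := by
  rw [← ((hf.hasDerivAt_line ht x o).add (hg.hasDerivAt_line ht x o)).deriv]
  cases o <;> rfl

lemma pdiff_sub (hf : IsC1 T f) (hg : IsC1 T g) (ht : t ∈ Ioo 0 T) (o : Option (Fin 3)) :
    pdiff o (fun t x => f t x - g t x) t x = pdiff o f t x - pdiff o g t x := by
  rw [← ((hf.hasDerivAt_line ht x o).sub (hg.hasDerivAt_line ht x o)).deriv]
  cases o <;> rfl

lemma pdiff_comp {G : ℝ × ℝ → ℝ} (hG : DifferentiableAt ℝ G (f t x, g t x)) (hf : IsC1 T f)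
    (hg : IsC1 T g) (ht : t ∈ Ioo 0 T) (o : Option (Fin 3)) :
    pdiff o (fun t x => G (f t x, g t x)) t x
      = pd₁ G (f t x, g t x) * pdiff o f t x + pd₂ G (f t x, g t x) * pdiff o g t x := by
  have hc := (hf.hasDerivAt_line ht x o).prodMk (hg.hasDerivAt_line ht x o)
  have hG' := hG.hasFDerivAt
  rw [← line_zero (f := f) o, ← line_zero (f := g) o] at hG'
  have h := hG'.comp_hasDerivAt (0 : ℝ) hc
  rw [fderiv_apply_eq, line_zero, line_zero] at h
  rw [← h.deriv]
  cases o <;> rfl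

end Rules

/-! ### Classical solutions in non-conservative form -/

section Strong

variable {F : ThermoFunctions} {T : ℝ} {r Θ : ℝ → Torus → ℝ} {U : ℝ → Torus → Vec}

lemma IsClassicalSolution.isC1_comp (hsol : IsClassicalSolution F T r Θ U) {G : ℝ × ℝ → ℝ}
    (hG : ContDiffOn ℝ 1 G Quadrant) : IsC1 T (fun t x => G (r t x, Θ t x)) :=
  hsol.r_C1.comp_pair hG hsol.Θ_C1 fun t ht x => ⟨hsol.r_pos t ht x, hsol.Θ_pos t ht x⟩

lemma IsClassicalSolution.pdiff_comp (hsol : IsClassicalSolution F T r Θ U) {G : ℝ × ℝ → ℝ}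
    (hG : ContDiffOn ℝ 1 G Quadrant) {t : ℝ} (ht : t ∈ Ioo 0 T) (x : Torus)
    (o : Option (Fin 3)) :
    pdiff o (fun t x => G (r t x, Θ t x)) t x
      = pd₁ G (r t x, Θ t x) * pdiff o r t x + pd₂ G (r t x, Θ t x) * pdiff o Θ t x := by
  have ht' := Ioo_subset_Icc_self ht
  have hz : (r t x, Θ t x) ∈ Quadrant := ⟨hsol.r_pos t ht' x, hsol.Θ_pos t ht' x⟩
  exact EulerMV.pdiff_comp ((hG.contDiffAt (isOpen_quadrant.mem_nhds hz)).differentiableAt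
    one_ne_zero) hsol.r_C1 hsol.Θ_C1 ht o

lemma IsClassicalSolution.density_eq (hsol : IsClassicalSolution F T r Θ U) {t : ℝ}
    (ht : t ∈ Ioo 0 T) (x : Torus) :
    dt r t x + ∑ j, U t x j * dx j r t x = -(r t x * ∑ j, dx j (fun t x => U t x j) t x) := by
  have h := hsol.continuity_eq t ht x
  have h1 : ∀ j, dx j (fun t x => r t x * U t x j) t x
      = dx j r t x * U t x j + r t x * dx j (fun t x => U t x j) t x := fun j =>
    pdiff_mul hsol.r_C1 (hsol.U_C1.component j) ht (some j)
  simp only [h1, Fin.sum_univ_three] at h ⊢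
  linear_combination h

/-- Momentum balance minus the velocity times the continuity equation. -/
lemma IsClassicalSolution.velocity_eq (hsol : IsClassicalSolution F T r Θ U) {t : ℝ}
    (ht : t ∈ Ioo 0 T) (x : Torus) (i : Fin 3) :
    r t x * (dt (fun t x => U t x i) t x + ∑ j, U t x j * dx j (fun t x => U t x i) t x)
      = -dx i (fun t x => F.p (r t x, Θ t x)) t x := by
  have h := hsol.momentum_eq t ht x i
  have hd := hsol.density_eq ht x
  have h1 : ∀ j, dx j (fun t x => r t x * U t x i * U t x j) t x
      = (dx j r t x * U t x i + r t x * dx j (fun t x => U t x i) t x) * U t x j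
        + r t x * U t x i * dx j (fun t x => U t x j) t x := fun j => by
    have e1 := pdiff_mul (x := x) (hsol.r_C1.mul (hsol.U_C1.component i))
      (hsol.U_C1.component j) ht (some j)
    have e2 := pdiff_mul (x := x) hsol.r_C1 (hsol.U_C1.component i) ht (some j)
    rw [e2] at e1
    exact e1
  have h2 : dt (fun t x => r t x * U t x i) t x
      = dt r t x * U t x i + r t x * dt (fun t x => U t x i) t x := by
    have e := pdiff_mul (x := x) hsol.r_C1 (hsol.U_C1.component i) ht none
    simpa only [pdiff_none] using e
  rw [h2] at h
  simp only [h1, Fin.sum_univ_three] at h hd ⊢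
  linear_combination h - U t x i * hd

lemma isC1_kinetic (hU : IsC1 T U) : IsC1 T (fun t x => ‖U t x‖ ^ 2) := by
  have h : (fun t x => ‖U t x‖ ^ 2) = fun t x => ∑ i, U t x i * U t x i := by
    funext t x
    rw [EuclideanSpace.norm_sq_eq]
    exact Finset.sum_congr rfl fun i _ => by rw [Real.norm_eq_abs, sq_abs, sq]
  rw [h]
  exact IsC1.sum fun i _ => (hU.component i).mul (hU.component i)

lemma pdiff_kinetic (hU : IsC1 T U) {t : ℝ} (ht : t ∈ Ioo 0 T) (x : Torus)
    (o : Option (Fin 3)) :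
    pdiff o (fun t x => ‖U t x‖ ^ 2) t x
      = 2 * ∑ i, U t x i * pdiff o (fun t x => U t x i) t x := by
  have h : (fun t x => ‖U t x‖ ^ 2)
      = fun t x => U t x 0 * U t x 0 + U t x 1 * U t x 1 + U t x 2 * U t x 2 := by
    funext t x
    rw [EuclideanSpace.norm_sq_eq, Fin.sum_univ_three]
    simp only [Real.norm_eq_abs, sq, abs_mul_abs_self]
  have hc := fun i => hU.component i
  rw [h, pdiff_add (((hc 0).mul (hc 0)).add ((hc 1).mul (hc 1))) ((hc 2).mul (hc 2)) ht,
    pdiff_add ((hc 0).mul (hc 0)) ((hc 1).mul (hc 1)) ht, pdiff_mul (hc 0) (hc 0) ht,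
    pdiff_mul (hc 1) (hc 1) ht, pdiff_mul (hc 2) (hc 2) ht, Fin.sum_univ_three]
  ring

/-- The specific entropy of a classical solution is transported by the velocity. -/
lemma IsClassicalSolution.entropy_transport (hreg : IsRegular F) (hgibbs : GibbsRelation F)
    (hsol : IsClassicalSolution F T r Θ U) {t : ℝ} (ht : t ∈ Ioo 0 T) (x : Torus) :
    pd₁ F.s (r t x, Θ t x) * (dt r t x + ∑ j, U t x j * dx j r t x)
      + pd₂ F.s (r t x, Θ t x) * (dt Θ t x + ∑ j, U t x j * dx j Θ t x) = 0 := by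
  have ht' := Ioo_subset_Icc_self ht
  have hr := hsol.r_pos t ht' x
  have hΘ := hsol.Θ_pos t ht' x
  have hE := hsol.energy_eq t ht x
  have hd := hsol.density_eq ht x
  have hv := fun i => hsol.velocity_eq ht x i
  have ce := hsol.isC1_comp (hreg.e_smooth.of_le one_le_two)
  have cp := hsol.isC1_comp (hreg.p_smooth.of_le one_le_two)
  have ck := isC1_kinetic hsol.U_C1
  have c1 : IsC1 T (fun t x => 1 / 2 * r t x) := (isC1_const (1 / 2 : ℝ)).mul hsol.r_C1
  have d1 : ∀ o, pdiff o (fun t x => 1 / 2 * r t x) t x = 1 / 2 * pdiff o r t x := fun o => by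
    have h := pdiff_mul (x := x) (isC1_const (1 / 2 : ℝ)) hsol.r_C1 ht o
    have h0 : pdiff o (fun _ _ => (1 / 2 : ℝ)) t x = 0 := by
      cases o <;> exact deriv_const _ _
    rw [h, h0]; ring
  have d2 : ∀ o, pdiff o (fun t x => 1 / 2 * r t x * ‖U t x‖ ^ 2 + r t x * F.e (r t x, Θ t x)) t x
      = 1 / 2 * pdiff o r t x * ‖U t x‖ ^ 2
        + r t x * ∑ i, U t x i * pdiff o (fun t x => U t x i) t x
        + pdiff o r t x * F.e (r t x, Θ t x)
        + r t x * pdiff o (fun t x => F.e (r t x, Θ t x)) t x := fun o => by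
    rw [pdiff_add (c1.mul ck) (hsol.r_C1.mul ce) ht, pdiff_mul c1 ck ht,
      pdiff_mul hsol.r_C1 ce ht, d1, pdiff_kinetic hsol.U_C1 ht]
    ring
  have d3 : ∀ j, dx j (fun t x => (1 / 2 * r t x * ‖U t x‖ ^ 2 + r t x * F.e (r t x, Θ t x)
      + F.p (r t x, Θ t x)) * U t x j) t x
      = (1 / 2 * dx j r t x * ‖U t x‖ ^ 2
        + r t x * ∑ i, U t x i * dx j (fun t x => U t x i) t x
        + dx j r t x * F.e (r t x, Θ t x)
        + r t x * dx j (fun t x => F.e (r t x, Θ t x)) t x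
        + dx j (fun t x => F.p (r t x, Θ t x)) t x) * U t x j
        + (1 / 2 * r t x * ‖U t x‖ ^ 2 + r t x * F.e (r t x, Θ t x)
          + F.p (r t x, Θ t x)) * dx j (fun t x => U t x j) t x := fun j => by
    have h := pdiff_mul (x := x) (((c1.mul ck).add (hsol.r_C1.mul ce)).add cp)
      (hsol.U_C1.component j) ht (some j)
    rw [pdiff_add ((c1.mul ck).add (hsol.r_C1.mul ce)) cp ht, d2] at h
    exact h
  have d2t := d2 none
  simp only [pdiff_none] at d2t
  rw [d2t] at hE
  simp only [d3] at hE
  have het : dt (fun t x => F.e (r t x, Θ t x)) t x = _ := pdiff_none.symm.trans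
    (hsol.pdiff_comp (hreg.e_smooth.of_le one_le_two) ht x none)
  have hej : ∀ j, dx j (fun t x => F.e (r t x, Θ t x)) t x = _ := fun j =>
    hsol.pdiff_comp (hreg.e_smooth.of_le one_le_two) ht x (some j)
  simp only [pdiff_none] at het
  simp only [pdiff_some] at hej
  rw [het] at hE
  simp only [hej] at hE
  have hg1 := gibbs₁ hgibbs hr hΘ
  have hg2 := gibbs₂ hgibbs hr hΘ
  have hv0 := hv 0
  have hv1 := hv 1
  have hv2 := hv 2
  simp only [Fin.sum_univ_three] at hE hd hv0 hv1 hv2 ⊢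
  -- Multiplied by rΘ, entropy transport becomes through Gibbs' relation the balance of internal
  -- energy. This is the total energy balance minus U times the velocity equation and minus |U|²/2 +
  -- e + p/r times the continuity equation.
  refine mul_left_cancel₀ (mul_pos hr hΘ).ne' ?_
  rw [mul_zero]
  have hg1' : Θ t x * pd₁ F.s (r t x, Θ t x) * r t x
      = r t x * pd₁ F.e (r t x, Θ t x) - F.p (r t x, Θ t x) / r t x := by
    rw [hg1]; field_simp
  have hpr : F.p (r t x, Θ t x) / r t x * r t x = F.p (r t x, Θ t x) := by field_simp
  generalize F.p (r t x, Θ t x) / r t x = q at hg1' hpr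
  linear_combination hE
    + (dt r t x + (U t x 0 * dx 0 r t x + U t x 1 * dx 1 r t x + U t x 2 * dx 2 r t x)) * hg1'
    + r t x * (dt Θ t x + (U t x 0 * dx 0 Θ t x + U t x 1 * dx 1 Θ t x + U t x 2 * dx 2 Θ t x)) * hg2
    - U t x 0 * hv0 - U t x 1 * hv1 - U t x 2 * hv2
    - (1 / 2 * ‖U t x‖ ^ 2 + F.e (r t x, Θ t x) + q) * hd
    + (dx 0 (fun t x => U t x 0) t x + dx 1 (fun t x => U t x 1) t x
      + dx 2 (fun t x => U t x 2) t x) * hpr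

lemma contDiffOn_gibbsEnergy (hreg : IsRegular F) : ContDiffOn ℝ 1 (gibbsEnergy F) Quadrant :=
  ((hreg.e_smooth.of_le one_le_two).sub
    (contDiff_snd.contDiffOn.mul (hreg.s_smooth.of_le one_le_two))).add
    ((hreg.p_smooth.of_le one_le_two).div contDiff_fst.contDiffOn fun _ hz => ne_of_gt hz.1)

/-- The test function in the equation of continuity. -/
noncomputable def massTest (F : ThermoFunctions) (r Θ : ℝ → Torus → ℝ) (U : ℝ → Torus → Vec)
    (t : ℝ) (x : Torus) : ℝ :=
  1 / 2 * ‖U t x‖ ^ 2 - gibbsEnergy F (r t x, Θ t x)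

lemma IsClassicalSolution.isC1_massTest (hreg : IsRegular F)
    (hsol : IsClassicalSolution F T r Θ U) : IsC1 T (massTest F r Θ U) :=
  ((isC1_const (1 / 2 : ℝ)).mul (isC1_kinetic hsol.U_C1)).sub
    (hsol.isC1_comp (contDiffOn_gibbsEnergy hreg))

/-- The Gibbs–Duhem relation dμ = dp/ϱ - s dϑ, read along the strong solution. It brings the
pressure gradient into the continuity test so that it can cancel against the momentum equation. -/
lemma IsClassicalSolution.pdiff_massTest (hreg : IsRegular F) (hgibbs : GibbsRelation F)
    (hsol : IsClassicalSolution F T r Θ U) {t : ℝ} (ht : t ∈ Ioo 0 T) (x : Torus)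
    (o : Option (Fin 3)) :
    r t x * pdiff o (massTest F r Θ U) t x
      = r t x * (∑ i, U t x i * pdiff o (fun t x => U t x i) t x)
        + r t x * F.s (r t x, Θ t x) * pdiff o Θ t x
        - pdiff o (fun t x => F.p (r t x, Θ t x)) t x := by
  have ht' := Ioo_subset_Icc_self ht
  have hr := hsol.r_pos t ht' x
  have hΘ := hsol.Θ_pos t ht' x
  have ck := isC1_kinetic hsol.U_C1
  have hz : (r t x, Θ t x) ∈ Quadrant := ⟨hr, hΘ⟩
  have h1 : pdiff o (massTest F r Θ U) t x
      = (∑ i, U t x i * pdiff o (fun t x => U t x i) t x)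
        - pdiff o (fun t x => gibbsEnergy F (r t x, Θ t x)) t x := by
    have h0 : pdiff o (fun _ _ => (1 / 2 : ℝ)) t x = 0 := by
      cases o <;> exact deriv_const _ _
    have h := pdiff_sub (x := x) ((isC1_const (1 / 2 : ℝ)).mul ck)
      (hsol.isC1_comp (contDiffOn_gibbsEnergy hreg)) ht o
    rw [pdiff_mul (isC1_const (1 / 2 : ℝ)) ck ht, h0, pdiff_kinetic hsol.U_C1 ht] at h
    refine h.trans ?_
    ring
  have hf : HasFDerivAt (gibbsEnergy F) (fderiv ℝ (gibbsEnergy F) (r t x, Θ t x))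
      (r t x, Θ t x) := (((contDiffOn_gibbsEnergy hreg).contDiffAt
    (isOpen_quadrant.mem_nhds hz)).differentiableAt one_ne_zero).hasFDerivAt
  have hμ1 : pd₁ (gibbsEnergy F) (r t x, Θ t x) = pd₁ F.p (r t x, Θ t x) / r t x := by
    have hd : HasDerivAt (fun y : ℝ => ((y, Θ t x) : ℝ × ℝ)) (1, 0) (r t x) :=
      (hasDerivAt_id _).prodMk (hasDerivAt_const _ _)
    have h2 : HasDerivAt (fun y => gibbsEnergy F (y, Θ t x))
        (pd₁ (gibbsEnergy F) (r t x, Θ t x)) (r t x) := by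
      have h := HasFDerivAt.comp_hasDerivAt (l := gibbsEnergy F) (r t x) hf hd
      exact h
    exact h2.unique (hasDerivAt_gibbsEnergy hreg hgibbs hr hΘ)
  have hμ2 : pd₂ (gibbsEnergy F) (r t x, Θ t x)
      = pd₂ F.p (r t x, Θ t x) / r t x - F.s (r t x, Θ t x) := by
    have h2 : HasDerivAt (fun y => gibbsEnergy F (r t x, y))
        (pd₂ (gibbsEnergy F) (r t x, Θ t x)) (Θ t x) :=
      hf.comp_hasDerivAt (Θ t x) ((hasDerivAt_const _ (r t x)).prodMk (hasDerivAt_id (Θ t x)))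
    have h3 := ((hasDerivAt_pd₂ hreg.e_smooth hr hΘ).sub
      ((hasDerivAt_id (Θ t x)).mul (hasDerivAt_pd₂ hreg.s_smooth hr hΘ))).add
      ((hasDerivAt_pd₂ hreg.p_smooth hr hΘ).div_const (r t x))
    refine (h2.unique h3).trans ?_
    have hg := gibbs₂ hgibbs hr hΘ
    simp only [id_eq]
    linarith
  rw [h1, hsol.pdiff_comp (contDiffOn_gibbsEnergy hreg) ht,
    hsol.pdiff_comp (hreg.p_smooth.of_le one_le_two) ht, hμ1, hμ2]
  field_simp
  ring

end Strong

/-! ### The integrand in the relative energy inequality -/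

section Algebra

/-- Kinetic plus internal energy of a point of the phase space, as a real number. -/
noncomputable def energyReal (z : Phase) : ℝ := (∑ i, z.2.2 i ^ 2) / (2 * z.1) + z.2.1

variable {F : ThermoFunctions} {P : ℝ≥0 → ℝ≥0 → ℝ} {a b s₀ : ℝ} {z : Phase}

/-- Expanding the square shows which test functions to use: each coefficient of a phase quantity is,
up to sign, the test function for its weak formulation. -/
lemma relEnergy_eq {r Θ : ℝ} {u : Fin 3 → ℝ} (hz : IsAdmissible F s₀ z) :
    relEnergy F a b r Θ u z
      = energyReal z - Θ * (z.1 * cutoff (clamp a b) (entropy F z.1 z.2.1))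
        - ∑ i, u i * z.2.2 i + (1 / 2 * (∑ i, u i ^ 2) - gibbsEnergy F (r, Θ)) * z.1
        + F.p (r, Θ) := by
  rw [relEnergy, relThermoPhase, energyReal]
  by_cases h : z.1 = 0
  · simp [h, hz.1 h]
  · have h0 : (z.1 : ℝ) ≠ 0 := by exact_mod_cast h
    simp only [Fin.sum_univ_three]
    field_simp
    ring

/-- The sum of the integrands of the weak formulations tested by the strong solution. -/
noncomputable def weakIntegrand (F : ThermoFunctions) (P : ℝ≥0 → ℝ≥0 → ℝ) (a b p : ℝ)
    (u : Fin 3 → ℝ) (Θt : ℝ) (Θx : Fin 3 → ℝ) (ut : Fin 3 → ℝ) (ux : Fin 3 → Fin 3 → ℝ)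
    (ψt : ℝ) (ψx : Fin 3 → ℝ) (pt : ℝ) (px : Fin 3 → ℝ) (z : Phase) : ℝ :=
  -(z.1 * cutoff (clamp a b) (entropy F z.1 z.2.1) * Θt
      + ∑ i, cutoff (clamp a b) (entropy F z.1 z.2.1) * z.2.2 i * Θx i)
    - ((∑ i, z.2.2 i * ut i) + (∑ i, ∑ j, z.2.2 i * z.2.2 j / z.1 * ux i j)
      + P z.1 z.2.1 * ∑ i, ux i i)
    + (z.1 * ψt + ∑ i, z.2.2 i * ψx i) + (pt + ∑ j, (px j * u j + p * ux j j))

/-- Writing m = ϱu + (m - ϱu) in the convective term and eliminating the time derivative of u by the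
velocity equation, the derivatives regroup into material derivatives and differences from the strong
state. -/
lemma weakIntegrand_eq_remainder {r Θ : ℝ} (hr : 0 < r) {u : Fin 3 → ℝ} {Θt : ℝ}
    {Θx : Fin 3 → ℝ} {ut : Fin 3 → ℝ} {ux : Fin 3 → Fin 3 → ℝ} {ψt : ℝ} {ψx : Fin 3 → ℝ} {pt : ℝ}
    {px : Fin 3 → ℝ} (hu : ∀ i, r * (ut i + ∑ j, u j * ux i j) = -px i)
    (hψt : r * ψt = r * (∑ i, u i * ut i) + r * F.s (r, Θ) * Θt - pt)
    (hψx : ∀ j, r * ψx j = r * (∑ i, u i * ux i j) + r * F.s (r, Θ) * Θx j - px j)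
    (hz : IsAdmissible F s₀ z) :
    weakIntegrand F P a b (F.p (r, Θ)) u Θt Θx ut ux ψt ψx pt px z
      = remainder F P a b r Θ u ux (Θt + ∑ j, u j * Θx j) (pt + ∑ j, u j * px j) Θx z := by
  have hmm : ∀ i j, (z.2.2 i - z.1 * u i) * (z.2.2 j - z.1 * u j) / (z.1 : ℝ)
      = z.2.2 i * z.2.2 j / z.1 - z.2.2 i * u j - u i * z.2.2 j + z.1 * u i * u j := fun i j => by
    by_cases h : z.1 = 0
    · simp [h, hz.1 h]
    · have h0 : (z.1 : ℝ) ≠ 0 := by exact_mod_cast h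
      field_simp
      ring
  have hut : ∀ i, ut i = -(px i / r) - ∑ j, u j * ux i j := fun i => by
    have h := hu i
    field_simp
    linarith
  have hψt' : ψt = (∑ i, u i * ut i) + F.s (r, Θ) * Θt - pt / r := by
    field_simp
    linarith
  have hψx' : ∀ j, ψx j = (∑ i, u i * ux i j) + F.s (r, Θ) * Θx j - px j / r := fun j => by
    have h := hψx j
    field_simp
    linarith
  rw [weakIntegrand, remainder, hψt']
  simp only [hmm, hψx', hut, Fin.sum_univ_three]
  generalize cutoff (clamp a b) (entropy F z.1 z.2.1) = v
  generalize P z.1 z.2.1 = π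
  -- The quotients become opaque because the density may be zero: only the denominator `r` may be
  -- cleared.
  generalize hX : (fun i j => z.2.2 i * z.2.2 j / (z.1 : ℝ)) = X
  have hX' : ∀ i j, z.2.2 i * z.2.2 j / (z.1 : ℝ) = X i j := fun i j => by rw [← hX]
  simp only [hX']
  field_simp
  ring

end Algebra

/-! ### A Gronwall argument -/

/-- The defect `D` has no sign a priori; only its primitive is nonnegative. So Gronwall's lemma is
applied to integrals of ε + D. -/
lemma eq_zero_of_gronwall {T K L : ℝ} (hT : 0 < T) {ε D : ℝ → ℝ}
    (hε : IntegrableOn ε (Ioo 0 T)) (hD : IntegrableOn D (Ioo 0 T))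
    (hε0 : ∀ᵐ τ ∂volume.restrict (Ioo 0 T), 0 ≤ ε τ)
    (hD0 : ∀ᵐ τ ∂volume.restrict (Ioo 0 T), 0 ≤ ∫ t in (0 : ℝ)..τ, D t)
    (h : ∀ᵐ τ ∂volume.restrict (Ioo 0 T),
      ε τ + D τ ≤ K * (∫ t in (0 : ℝ)..τ, ε t) + L * ∫ t in (0 : ℝ)..τ, D t) :
    (∀ᵐ τ ∂volume.restrict (Ioo 0 T), ε τ = 0) ∧ ∀ᵐ τ ∂volume.restrict (Ioo 0 T), D τ = 0 := by
  have hεI : IntegrableOn ε (Icc 0 T) := by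
    rwa [IntegrableOn, ← restrict_Ioo_eq_restrict_Icc]
  have hDI : IntegrableOn D (Icc 0 T) := by
    rwa [IntegrableOn, ← restrict_Ioo_eq_restrict_Icc]
  have hii : ∀ {f : ℝ → ℝ}, IntegrableOn f (Icc 0 T) → ∀ τ ∈ Icc 0 T,
      IntervalIntegrable f volume 0 τ := fun hf τ hτ =>
    (intervalIntegrable_iff_integrableOn_Icc_of_le hτ.1).2
      (hf.mono_set (Icc_subset_Icc_right hτ.2))
  have hprim : ∀ {f : ℝ → ℝ}, IntegrableOn f (Icc 0 T) →
      ContinuousOn (fun τ => ∫ t in (0 : ℝ)..τ, f t) (Icc 0 T) := fun hf => by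
    have := intervalIntegral.continuousOn_primitive_interval (a := 0) (b := T)
      (by rwa [uIcc_of_le hT.le])
    rwa [uIcc_of_le hT.le] at this
  have hres : ∀ τ ∈ Icc 0 T, ∀ {p : ℝ → Prop}, (∀ᵐ t ∂volume.restrict (Ioo 0 T), p t) →
      ∀ᵐ t ∂volume.restrict (Ioc 0 τ), p t := fun τ hτ p hp => by
    rw [← restrict_Ioo_eq_restrict_Ioc]
    exact ae_restrict_of_ae_restrict_of_subset (Ioo_subset_Ioo_right hτ.2) hp
  have hεint : ∀ τ ∈ Icc 0 T, 0 ≤ ∫ t in (0 : ℝ)..τ, ε t := fun τ hτ =>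
    intervalIntegral.integral_nonneg_of_ae_restrict hτ.1 (by
      rw [← restrict_Ioo_eq_restrict_Icc]
      exact ae_restrict_of_ae_restrict_of_subset (Ioo_subset_Ioo_right hτ.2) hε0)
  -- A common constant is allowed since the primitives of both ε and `D` are nonnegative.
  set C := max (max K L) 0 with hC
  have hC0 : 0 ≤ C := le_max_right _ _
  set G : ℝ → ℝ := fun τ => ∫ t in (0 : ℝ)..τ, (ε t + D t) with hG
  have hGsplit : ∀ τ ∈ Icc 0 T, G τ = (∫ t in (0 : ℝ)..τ, ε t) + ∫ t in (0 : ℝ)..τ, D t :=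
    fun τ hτ => intervalIntegral.integral_add (hii hεI τ hτ) (hii hDI τ hτ)
  have hGcont : ContinuousOn G (Icc 0 T) := hprim (hεI.add hDI)
  have hg : ∀ᵐ τ ∂volume.restrict (Ioo 0 T), ε τ + D τ ≤ C * G τ := by
    filter_upwards [h, hD0, ae_restrict_mem measurableSet_Ioo] with τ h1 h2 hτ
    have h3 := hεint τ (Ioo_subset_Icc_self hτ)
    rw [hGsplit τ (Ioo_subset_Icc_self hτ), mul_add]
    refine h1.trans (add_le_add ?_ ?_)
    · exact mul_le_mul_of_nonneg_right ((le_max_left K L).trans (le_max_left _ _)) h3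
    · exact mul_le_mul_of_nonneg_right ((le_max_right K L).trans (le_max_left _ _)) h2
  set W : ℝ → ℝ := fun τ => ∫ t in (0 : ℝ)..τ, G t with hW
  have hGI : IntegrableOn G (Icc 0 T) := hGcont.integrableOn_Icc
  have hGW : ∀ τ ∈ Icc 0 T, G τ ≤ C * W τ := fun τ hτ => by
    rw [hG, hW, ← intervalIntegral.integral_const_mul]
    simp only
    rw [intervalIntegral.integral_of_le hτ.1, intervalIntegral.integral_of_le hτ.1]
    refine integral_mono_ae ?_ ?_ (hres τ hτ hg)
    · exact ((hεI.add hDI).mono_set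
        (Ioc_subset_Icc_self.trans (Icc_subset_Icc_right hτ.2)))
    · exact (hGI.mono_set
        (Ioc_subset_Icc_self.trans (Icc_subset_Icc_right hτ.2))).const_mul C
  -- The primitive `W` of the continuous function `G` is differentiable from the right, with W' = G
  -- ≤ C W and W(0) = 0, whereas `G` itself is only a primitive of an integrable function.
  have hWle : ∀ τ ∈ Icc 0 T, W τ ≤ 0 := by
    have hder : ∀ x ∈ Ico 0 T, HasDerivWithinAt W (G x) (Ici x) x := fun x hx => by
      have hmem : Icc 0 T ∈ 𝓝[>] x := by
        filter_upwards [Ioo_mem_nhdsGT hx.2] with y hy using ⟨hx.1.trans hy.1.le, hy.2.le⟩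
      refine intervalIntegral.integral_hasDerivWithinAt_right
        (hii hGI x ⟨hx.1, hx.2.le⟩) (t := Ioi x) ?_ ?_
      · exact ⟨Icc 0 T, hmem, hGI.aestronglyMeasurable⟩
      · exact (hGcont x ⟨hx.1, hx.2.le⟩).mono_of_mem_nhdsWithin hmem
    intro τ hτ
    have hW0 : W 0 ≤ 0 := (intervalIntegral.integral_same (f := G)).le
    have := le_gronwallBound_of_liminf_deriv_right_le (f := W) (f' := G) (δ := 0) (K := C)
      (ε := 0) (a := 0) (b := T) (hprim hGI)
      (fun x hx r hr => (hder x hx).liminf_right_slope_le hr) hW0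
      (fun x hx => by simpa using hGW x ⟨hx.1, hx.2.le⟩) τ hτ
    simpa [gronwallBound_ε0_δ0] using this
  have hG0 : ∀ τ ∈ Icc 0 T, G τ ≤ 0 := fun τ hτ =>
    (hGW τ hτ).trans (mul_nonpos_of_nonneg_of_nonpos hC0 (hWle τ hτ))
  have hboth : ∀ᵐ τ ∂volume.restrict (Ioo 0 T),
      (∫ t in (0 : ℝ)..τ, ε t) = 0 ∧ (∫ t in (0 : ℝ)..τ, D t) = 0 := by
    filter_upwards [hD0, ae_restrict_mem measurableSet_Ioo] with τ h1 hτ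
    have hτ' := Ioo_subset_Icc_self hτ
    have h2 := hεint τ hτ'
    have h3 := hG0 τ hτ'
    rw [hGsplit τ hτ'] at h3
    constructor <;> linarith
  -- A primitive vanishing almost everywhere vanishes at `T` too, by continuity.
  have hend : ∀ {f : ℝ → ℝ}, IntegrableOn f (Icc 0 T) →
      (∀ᵐ τ ∂volume.restrict (Ioo 0 T), (∫ t in (0 : ℝ)..τ, f t) = 0) →
      ∫ t in Ioo 0 T, f t = 0 := fun {f} hf h0 => by
    have h1 := Measure.eqOn_Icc_of_ae_eq volume hT.ne
      (f := fun τ => ∫ t in (0 : ℝ)..τ, f t) (g := fun _ => 0)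
      (by rwa [← restrict_Ioo_eq_restrict_Icc]) (hprim hf) continuousOn_const
      (right_mem_Icc.2 hT.le)
    simp only [intervalIntegral.integral_of_le hT.le] at h1
    rwa [integral_Ioc_eq_integral_Ioo] at h1
  have hε1 := (integral_eq_zero_iff_of_nonneg_ae hε0 hε).1 (hend hεI (hboth.mono fun _ h => h.1))
  -- Now a sign is available: D ≤ C G - ε ≤ 0, and an integrable function of one sign with zero
  -- integral vanishes.
  have hDle : ∀ᵐ τ ∂volume.restrict (Ioo 0 T), 0 ≤ -D τ := by
    filter_upwards [hg, hε0, ae_restrict_mem measurableSet_Ioo] with τ h1 h2 hτ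
    have := mul_nonpos_of_nonneg_of_nonpos hC0 (hG0 τ (Ioo_subset_Icc_self hτ))
    linarith
  have hD1 := (integral_eq_zero_iff_of_nonneg_ae hDle hD.neg).1 (by
    simp only [integral_neg, neg_eq_zero]
    exact hend hDI (hboth.mono fun _ h => h.2))
  refine ⟨hε1, ?_⟩
  filter_upwards [hD1] with τ hτ
  simpa using hτ

/-! ### Integrals against signed measures -/

instance signedMeasure_isFiniteMeasure_variation {X : Type*} [MeasurableSpace X]
    (μ : SignedMeasure X) : IsFiniteMeasure μ.variation := by
  rw [← SignedMeasure.totalVariation_eq_variation]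
  unfold SignedMeasure.totalVariation
  infer_instance

lemma abs_signedIntegral_le (μ : SignedMeasure (ℝ × Torus)) {τ B : ℝ} {f : ℝ → Torus → ℝ}
    (hB : 0 ≤ B) (hf : ∀ t ∈ Ico 0 τ, ∀ x, |f t x| ≤ B) :
    |signedIntegral μ τ f| ≤ B * (μ.variation (Ico 0 τ ×ˢ univ)).toReal := by
  have hS : MeasurableSet (Ico 0 τ ×ˢ (univ : Set Torus)) := measurableSet_Ico.prod MeasurableSet.univ
  have hae : ∀ᵐ q ∂(μ.restrict (Ico 0 τ ×ˢ univ)).variation, ‖f q.1 q.2‖ ≤ B := by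
    rw [VectorMeasure.variation_restrict hS]
    filter_upwards [ae_restrict_mem hS] with q hq using hf q.1 hq.1 q.2
  have h := VectorMeasure.norm_integral_le_of_norm_le_const
    (B := (ContinuousLinearMap.lsmul ℝ ℝ).flip) hae
  have hn : ‖((ContinuousLinearMap.lsmul ℝ ℝ).flip : ℝ →L[ℝ] ℝ →L[ℝ] ℝ)‖ ≤ 1 := by
    rw [ContinuousLinearMap.opNorm_flip]
    exact ContinuousLinearMap.opNorm_lsmul_le
  rw [VectorMeasure.variation_restrict hS, Measure.real, Measure.restrict_apply_univ] at h
  refine h.trans ?_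
  refine mul_le_mul_of_nonneg_right ?_ ENNReal.toReal_nonneg
  exact mul_le_of_le_one_right hB hn

lemma abs_sum_signedIntegral_le (μ : Fin 3 → Fin 3 → SignedMeasure (ℝ × Torus)) {τ B : ℝ}
    {f : Fin 3 → Fin 3 → ℝ → Torus → ℝ} (hB : 0 ≤ B)
    (hf : ∀ i j, ∀ t ∈ Ico 0 τ, ∀ x, |f i j t x| ≤ B) :
    |∑ i, ∑ j, signedIntegral (μ i j) τ (f i j)| ≤ B * matrixVariation μ τ := by
  rw [matrixVariation, Finset.mul_sum]
  refine (Finset.abs_sum_le_sum_abs _ _).trans (Finset.sum_le_sum fun i _ => ?_)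
  rw [Finset.mul_sum]
  exact (Finset.abs_sum_le_sum_abs _ _).trans
    (Finset.sum_le_sum fun j _ => abs_signedIntegral_le (μ i j) hB (hf i j))

/-! ### The energy density -/

lemma measurable_energyDensity : Measurable energyDensity := by
  unfold energyDensity
  fun_prop

lemma momentum_eq_zero_of_energyDensity_ne_top {z : Phase} (hz : energyDensity z ≠ ⊤)
    (h : z.1 = 0) : z.2.2 = 0 := by
  by_contra hm
  apply hz
  have h1 : ‖z.2.2‖ₑ ^ 2 / (2 * (z.1 : ℝ≥0∞)) = ⊤ := by
    rw [h]
    simp only [ENNReal.coe_zero, mul_zero]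
    exact ENNReal.div_zero (by simpa using hm)
  rw [energyDensity, h1, top_add]

lemma toReal_energyDensity {z : Phase} (hz : z.1 = 0 → z.2.2 = 0) :
    (energyDensity z).toReal = energyReal z := by
  have h2 : ‖z.2.2‖ₑ ^ 2 / (2 * (z.1 : ℝ≥0∞)) ≠ ⊤ := by
    by_cases h : z.1 = 0
    · simp [hz h]
    · exact ENNReal.div_ne_top (by simp) (by simpa using h)
  rw [energyDensity, energyReal, ENNReal.toReal_add h2 ENNReal.coe_ne_top, ENNReal.toReal_div,
    ENNReal.toReal_pow, toReal_enorm, EuclideanSpace.real_norm_sq_eq]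
  simp

/-! ### Calculus of integrals -/

section HasInt

variable {X : Type*} {mX : MeasurableSpace X} {μ : Measure X} {f g : X → ℝ} {v w : ℝ}

/-- `f` is integrable with integral `v`. -/
def HasInt (μ : Measure X) (f : X → ℝ) (v : ℝ) : Prop := Integrable f μ ∧ ∫ x, f x ∂μ = v

lemma _root_.MeasureTheory.Integrable.hasInt (h : Integrable f μ) : HasInt μ f (∫ x, f x ∂μ) :=
  ⟨h, rfl⟩

lemma HasInt.add (hf : HasInt μ f v) (hg : HasInt μ g w) :
    HasInt μ (fun x => f x + g x) (v + w) :=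
  ⟨hf.1.add hg.1, by rw [integral_add hf.1 hg.1, hf.2, hg.2]⟩

lemma HasInt.sub (hf : HasInt μ f v) (hg : HasInt μ g w) :
    HasInt μ (fun x => f x - g x) (v - w) :=
  ⟨hf.1.sub hg.1, by rw [integral_sub hf.1 hg.1, hf.2, hg.2]⟩

lemma HasInt.neg (hf : HasInt μ f v) : HasInt μ (fun x => -f x) (-v) :=
  ⟨hf.1.neg, by rw [integral_neg, hf.2]⟩

lemma HasInt.mul_const (hf : HasInt μ f v) (c : ℝ) : HasInt μ (fun x => f x * c) (v * c) :=
  ⟨hf.1.mul_const c, by rw [integral_mul_const, hf.2]⟩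

lemma HasInt.sum {ι : Type*} {s : Finset ι} {f : ι → X → ℝ} {v : ι → ℝ}
    (hf : ∀ i ∈ s, HasInt μ (f i) (v i)) : HasInt μ (fun x => ∑ i ∈ s, f i x) (∑ i ∈ s, v i) :=
  ⟨integrable_finsetSum s fun i hi => (hf i hi).1, by
    rw [integral_finsetSum s fun i hi => (hf i hi).1]
    exact Finset.sum_congr rfl fun i hi => (hf i hi).2⟩

lemma hasInt_const [IsProbabilityMeasure μ] (c : ℝ) : HasInt μ (fun _ => c) c :=
  ⟨integrable_const c, by simp⟩

lemma HasInt.congr (hf : HasInt μ f v) (h : f =ᵐ[μ] g) : HasInt μ g v :=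
  ⟨hf.1.congr h, by rw [← integral_congr_ae h, hf.2]⟩

lemma integrable_toReal_prod {Ω : Type*} {mΩ : MeasurableSpace Ω} {ν : Measure Ω} [SFinite ν]
    [SFinite μ] {h : X × Ω → ℝ≥0∞} (hm : AEMeasurable h (μ.prod ν))
    (hfin : ∫⁻ t, ∫⁻ x, h (t, x) ∂ν ∂μ ≠ ⊤) :
    (∀ᵐ q ∂μ.prod ν, h q < ⊤) ∧ Integrable (fun q => (h q).toReal) (μ.prod ν) ∧
      ∀ᵐ t ∂μ, ∫ x, (h (t, x)).toReal ∂ν = (∫⁻ x, h (t, x) ∂ν).toReal := by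
  rw [← lintegral_prod h hm] at hfin
  have hlt := ae_lt_top' hm hfin
  refine ⟨hlt, integrable_toReal_of_lintegral_ne_top hm hfin, ?_⟩
  filter_upwards [hm.aestronglyMeasurable.prodMk_left, Measure.ae_ae_of_ae_prod hlt] with t h1 h2
  exact integral_toReal h1.aemeasurable h2

end HasInt

/-! ### Integrability on the space-time cylinder -/

section SpaceTime

variable {T : ℝ} {F : ThermoFunctions} {P : ℝ≥0 → ℝ≥0 → ℝ} {Y₀ : Torus → Measure Phase}
  {Y : ℝ → Torus → Measure Phase} {D : ℝ → ℝ} {G : Phase → ℝ} {f : ℝ → Torus → ℝ}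

lemma PairingIntegrable.mul_of_bound (hG : PairingIntegrable T Y G)
    (hf : AEStronglyMeasurable (fun q : ℝ × Torus => f q.1 q.2) (spaceTime T)) {B : ℝ}
    (hB : ∀ t ∈ Ioo 0 T, ∀ x, |f t x| ≤ B) :
    Integrable (fun q : ℝ × Torus => pairing (Y q.1 q.2) G * f q.1 q.2) (spaceTime T) := by
  refine hG.2.mul_bdd (c := B) hf ?_
  filter_upwards [ae_mem_Ioo_spaceTime] with q hq using hB _ hq _

lemma PairingIntegrable.mul_continuousOn (hG : PairingIntegrable T Y G)
    (hf : ContinuousOn (fun q : ℝ × Torus => f q.1 q.2) (Icc 0 T ×ˢ univ)) :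
    Integrable (fun q : ℝ × Torus => pairing (Y q.1 q.2) G * f q.1 q.2) (spaceTime T) := by
  obtain ⟨B, -, hB⟩ := exists_bound_of_continuousOn hf
  exact hG.mul_of_bound (aestronglyMeasurable_of_continuousOn hf)
    fun t ht => hB t (Ioo_subset_Icc_self ht)

lemma PairingIntegrable.mul_dt (hG : PairingIntegrable T Y G) (hT : 0 < T) (hf : IsC1 T f) :
    Integrable (fun q : ℝ × Torus => pairing (Y q.1 q.2) G * dt f q.1 q.2) (spaceTime T) := by
  obtain ⟨B, -, hB⟩ := hf.exists_bound_dt hT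
  exact hG.mul_of_bound (hf.aestronglyMeasurable_dt hT) hB

lemma integrable_of_continuousOn
    (hf : ContinuousOn (fun q : ℝ × Torus => f q.1 q.2) (Icc 0 T ×ˢ univ)) :
    Integrable (fun q : ℝ × Torus => f q.1 q.2) (spaceTime T) := by
  obtain ⟨B, -, hB⟩ := exists_bound_of_continuousOn hf
  refine Integrable.of_bound (aestronglyMeasurable_of_continuousOn hf) B ?_
  filter_upwards [ae_mem_Ioo_spaceTime] with q hq using hB _ (Ioo_subset_Icc_self hq) _

lemma ae_slice_of_ae {p : ℝ × Torus → Prop} (h : ∀ᵐ q ∂spaceTime T, p q) :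
    ∀ᵐ τ ∂volume.restrict (Ioo 0 T), ∀ᵐ x : Torus, p (τ, x) :=
  Measure.ae_ae_of_ae_prod h

lemma ae_integrable_slice {f : ℝ × Torus → ℝ} (h : Integrable f (spaceTime T)) :
    ∀ᵐ τ ∂volume.restrict (Ioo 0 T), Integrable (fun x : Torus => f (τ, x)) :=
  Integrable.prod_right_ae h

lemma integrableOn_integral_slice {f : ℝ → Torus → ℝ}
    (h : Integrable (fun q : ℝ × Torus => f q.1 q.2) (spaceTime T)) :
    IntegrableOn (fun τ => ∫ x : Torus, f τ x) (Ioo 0 T) :=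
  Integrable.integral_prod_left h

namespace IsDissipativeMVSolution

lemma integrableOn_defect (hY : IsDissipativeMVSolution F P T Y₀ Y D) :
    IntegrableOn D (Ioo 0 T) :=
  hY.defect.integrable le_top

/-- The energy balance equates the total energy with the initial energy minus `D`, which is
integrable in time; by Tonelli the energy is integrable on the cylinder. Its finiteness leaves no
momentum on the vacuum and allows the passage to a real-valued energy. -/
lemma energy_integrable (hY : IsDissipativeMVSolution F P T Y₀ Y D) :
    (∀ᵐ q ∂spaceTime T, ∀ᵐ z ∂Y q.1 q.2, z.1 = 0 → z.2.2 = 0) ∧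
      PairingIntegrable T Y energyReal ∧
      ∀ᵐ τ ∂volume.restrict (Ioo 0 T),
        ∫ x, pairing (Y τ x) energyReal = (totalEnergy (Y τ)).toReal := by
  have hm : AEMeasurable (fun q : ℝ × Torus => ∫⁻ z, energyDensity z ∂Y q.1 q.2) (spaceTime T) :=
    (Measure.measurable_lintegral measurable_energyDensity).comp_aemeasurable hY.young.measurable
  have hfin : ∫⁻ t in Ioo 0 T, totalEnergy (Y t) ≠ ⊤ := by
    have h1 : ∫⁻ t in Ioo 0 T, totalEnergy (Y t)
        = ∫⁻ t in Ioo 0 T, ENNReal.ofReal ((totalEnergy Y₀).toReal - D t) := by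
      refine lintegral_congr_ae ?_
      filter_upwards [hY.energy_eq] with t ht
      rw [← ENNReal.ofReal_toReal ht.1]
      congr 1
      linarith [ht.2]
    rw [h1]
    exact (Integrable.lintegral_lt_top
      ((integrable_const _).sub hY.integrableOn_defect)).ne
  obtain ⟨h1, h2, h3⟩ := integrable_toReal_prod hm hfin
  have hz : ∀ᵐ q ∂spaceTime T, ∀ᵐ z ∂Y q.1 q.2, energyDensity z < ⊤ := by
    filter_upwards [h1] with q hq using ae_lt_top measurable_energyDensity hq.ne
  have hz0 : ∀ᵐ q ∂spaceTime T, ∀ᵐ z ∂Y q.1 q.2, z.1 = 0 → z.2.2 = 0 := by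
    filter_upwards [hz] with q hq
    filter_upwards [hq] with z hz using momentum_eq_zero_of_energyDensity_ne_top hz.ne
  have hint : ∀ᵐ q ∂spaceTime T, HasInt (Y q.1 q.2) energyReal
      (∫⁻ z, energyDensity z ∂Y q.1 q.2).toReal := by
    filter_upwards [h1, hz, hz0] with q h1 h2 h3
    have h4 : HasInt (Y q.1 q.2) (fun z => (energyDensity z).toReal)
        (∫⁻ z, energyDensity z ∂Y q.1 q.2).toReal :=
      ⟨integrable_toReal_of_lintegral_ne_top measurable_energyDensity.aemeasurable h1.ne,
        integral_toReal measurable_energyDensity.aemeasurable h2⟩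
    refine h4.congr ?_
    filter_upwards [h3] with z hz using toReal_energyDensity hz
  refine ⟨hz0, ⟨hint.mono fun q h => h.1, h2.congr ?_⟩, ?_⟩
  · filter_upwards [hint] with q hq using hq.2.symm
  · filter_upwards [h3, ae_slice_of_ae hint] with τ h3 h4
    refine Eq.trans (integral_congr_ae ?_) h3
    filter_upwards [h4] with x hx using hx.2

end IsDissipativeMVSolution

/-! ### The initial data -/

section Initial

variable {r Θ : ℝ} {u : Vec}

@[simp] lemma pairing_dirac (z : Phase) : pairing (Measure.dirac z) G = G z :=
  integral_dirac _ _

lemma coe_density_phasePoint (hr : 0 < r) : ((phasePoint F r Θ u).1 : ℝ) = r :=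
  Real.coe_toNNReal _ hr.le

lemma coe_energy_phasePoint (hreg : IsRegular F) (hr : 0 < r) (hΘ : 0 < Θ) :
    ((phasePoint F r Θ u).2.1 : ℝ) = r * F.e (r, Θ) :=
  Real.coe_toNNReal _ (mul_pos hr (hreg.e_pos (r, Θ) ⟨hr, hΘ⟩)).le

lemma momentum_phasePoint (i : Fin 3) : (phasePoint F r Θ u).2.2 i = r * u i := rfl

lemma entropy_phasePoint (hreg : IsRegular F) (hstab : ThermoStable F) (hr : 0 < r)
    (hΘ : 0 < Θ) :
    entropy F (phasePoint F r Θ u).1 (phasePoint F r Θ u).2.1 = (F.s (r, Θ) : EReal) :=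
  entropy_eq F hreg hstab hr hΘ

lemma energyReal_phasePoint (hreg : IsRegular F) (hr : 0 < r) (hΘ : 0 < Θ) :
    energyReal (phasePoint F r Θ u) = 1 / 2 * r * (∑ i, u i ^ 2) + r * F.e (r, Θ) := by
  rw [energyReal, coe_energy_phasePoint hreg hr hΘ, coe_density_phasePoint hr]
  simp only [momentum_phasePoint, mul_pow, ← Finset.mul_sum]
  field_simp

lemma energyDensity_phasePoint (hreg : IsRegular F) (hr : 0 < r) (hΘ : 0 < Θ) :
    (energyDensity (phasePoint F r Θ u)).toReal
      = 1 / 2 * r * (∑ i, u i ^ 2) + r * F.e (r, Θ) := by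
  rw [toReal_energyDensity, energyReal_phasePoint hreg hr hΘ]
  intro h
  have := coe_density_phasePoint (F := F) (Θ := Θ) (u := u) hr
  rw [h] at this
  simp at this
  exact absurd this.symm hr.ne'

end Initial

/-! ### The minimum principle for the entropy -/

/-- The renormalization for the minimum principle: bounded, nondecreasing, nonpositive and strictly
negative below `s₀`, the value -∞ included. -/
lemma cutoff_nonpos_clamp (s₀ : ℝ) (σ : EReal) :
    cutoff (fun x => clamp (-1) 0 (x - s₀)) σ ≤ 0 ∧
      (cutoff (fun x => clamp (-1) 0 (x - s₀)) σ = 0 → (s₀ : EReal) ≤ σ) := by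
  have hle : ∀ x, clamp (-1) 0 (x - s₀) ≤ 0 := fun x => clamp_le (by norm_num) _
  have hbdd : BddBelow (range fun x => clamp (-1) 0 (x - s₀)) :=
    ⟨-1, by rintro _ ⟨x, rfl⟩; exact le_clamp _⟩
  induction hσ : σ using EReal.rec with
  | bot =>
    have h : cutoff (fun x => clamp (-1) 0 (x - s₀)) ⊥ ≤ -1 := by
      rw [cutoff, if_pos rfl]
      exact (ciInf_le hbdd (s₀ - 1)).trans (by simp [clamp])
    exact ⟨by linarith, fun h0 => by linarith⟩
  | top =>
    refine ⟨?_, fun _ => le_top⟩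
    simp only [cutoff, top_ne_bot, if_false, if_true]
    exact ciSup_le hle
  | coe x =>
    rw [cutoff_coe]
    refine ⟨hle x, fun h => ?_⟩
    have : 0 ≤ x - s₀ := by
      by_contra hx
      push Not at hx
      rw [clamp, min_eq_left hx.le] at h
      rcases max_choice (-1) (x - s₀) with h' | h' <;> rw [h'] at h <;> linarith
    exact_mod_cast sub_nonneg.1 this

/-- With this renormalization and the test function 1, the entropy inequality says that the integral
of ϱ Z(s) does not fall below its initial value, which is 0 as the initial entropy is at least `s₀`.
Since ϱ Z(s) ≤ 0, it vanishes almost everywhere. -/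
lemma IsDissipativeMVSolution.le_entropy (hY : IsDissipativeMVSolution F P T Y₀ Y D)
    (hreg : IsRegular F) (hstab : ThermoStable F) {r Θ : Torus → ℝ} {U : Torus → Vec}
    (hr : ∀ x, 0 < r x) (hΘ : ∀ x, 0 < Θ x)
    (hY₀ : ∀ᵐ x, Y₀ x = Measure.dirac (phasePoint F (r x) (Θ x) (U x))) {s₀ : ℝ}
    (hs : ∀ x, s₀ ≤ F.s (r x, Θ x)) :
    ∀ᵐ q ∂spaceTime T, ∀ᵐ z ∂Y q.1 q.2, z.1 ≠ 0 → (s₀ : EReal) ≤ entropy F z.1 z.2.1 := by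
  set Z : ℝ → ℝ := fun x => clamp (-1) 0 (x - s₀) with hZ
  have hZc : Continuous Z := continuous_clamp.comp (continuous_id.sub continuous_const)
  have hZb : ∃ C, ∀ x, |Z x| ≤ C := ⟨_, fun x => abs_clamp_le (by norm_num) _⟩
  have hZm : Monotone Z := fun x y hxy => monotone_clamp (sub_le_sub_right hxy _)
  set G : Phase → ℝ := fun z => z.1 * cutoff Z (entropy F z.1 z.2.1) with hG
  have hG0 : ∀ z, 0 ≤ -G z := fun z => by
    rw [hG, ← mul_neg]
    exact mul_nonneg (NNReal.coe_nonneg _) (neg_nonneg.2 (cutoff_nonpos_clamp s₀ _).1)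
  have hint := hY.int_entropy Z hZc hZb hZm
  have hp0 : ∀ ν, 0 ≤ -pairing ν G := fun ν => by
    rw [pairing, ← integral_neg]
    exact integral_nonneg hG0
  have hinit : ∫ x, pairing (Y₀ x) G * (1 : ℝ) = 0 := by
    refine integral_eq_zero_of_ae ?_
    filter_upwards [hY₀] with x hx
    have h1 : Z (F.s (r x, Θ x)) = 0 := by
      simp only [hZ, clamp]
      rw [min_eq_right (sub_nonneg.2 (hs x))]
      norm_num
    rw [hx, pairing_dirac, hG]
    simp only [entropy_phasePoint hreg hstab (hr x) (hΘ x), cutoff_coe, h1]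
    simp
  have hslice : ∀ᵐ τ ∂volume.restrict (Ioo 0 T), ∫ x : Torus, -pairing (Y τ x) G = 0 := by
    filter_upwards [hY.entropy_ineq Z hZc hZb hZm (fun _ _ => 1) (isC1_const 1)
      (fun _ _ _ => zero_le_one)] with τ hτ
    rw [hinit] at hτ
    simp only [dt, dx, deriv_const', mul_zero, Finset.sum_const_zero, add_zero, integral_zero,
      intervalIntegral.integral_zero, sub_zero, mul_one] at hτ
    refine le_antisymm ?_ (integral_nonneg fun x => hp0 _)
    rw [integral_neg]
    linarith
  have hzero : ∫ q : ℝ × Torus, -pairing (Y q.1 q.2) G ∂spaceTime T = 0 := by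
    refine (integral_prod _ hint.2.neg).trans ?_
    exact integral_eq_zero_of_ae hslice
  have h1 := (integral_eq_zero_iff_of_nonneg (fun q : ℝ × Torus => hp0 (Y q.1 q.2))
    hint.2.neg).1 hzero
  filter_upwards [h1, hint.1] with q h2 h3
  have h4 : ∫ z, -G z ∂Y q.1 q.2 = 0 := by rw [integral_neg]; exact h2
  filter_upwards [(integral_eq_zero_iff_of_nonneg hG0 h3.neg).1 h4] with z hz hz1
  have hz2 : (z.1 : ℝ) * cutoff Z (entropy F z.1 z.2.1) = 0 := by
    simpa [hG] using hz
  have hz3 : (z.1 : ℝ) ≠ 0 := by exact_mod_cast hz1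
  exact (cutoff_nonpos_clamp s₀ _).2 ((mul_eq_zero.1 hz2).resolve_left hz3)

end SpaceTime

/-! ### The relative energy inequality -/

section PairingFormulas

variable {F : ThermoFunctions} {P : ℝ≥0 → ℝ≥0 → ℝ} {a b s₀ : ℝ} {ν : Measure Phase}

lemma hasInt_relEnergy [IsProbabilityMeasure ν] (hz : ∀ᵐ z ∂ν, IsAdmissible F s₀ z)
    (hE : Integrable energyReal ν)
    (hS : Integrable (fun z : Phase => (z.1 : ℝ) * cutoff (clamp a b) (entropy F z.1 z.2.1)) ν)
    (hm : ∀ i, Integrable (fun z : Phase => z.2.2 i) ν)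
    (hϱ : Integrable (fun z : Phase => (z.1 : ℝ)) ν) (r Θ : ℝ) (u : Fin 3 → ℝ) :
    HasInt ν (relEnergy F a b r Θ u)
      (pairing ν energyReal
        - pairing ν (fun z => (z.1 : ℝ) * cutoff (clamp a b) (entropy F z.1 z.2.1)) * Θ
        - (∑ i, pairing ν (fun z => z.2.2 i) * u i)
        + pairing ν (fun z => (z.1 : ℝ)) * (1 / 2 * (∑ i, u i ^ 2) - gibbsEnergy F (r, Θ))
        + F.p (r, Θ)) := by
  refine (((((hE.hasInt).sub (hS.hasInt.mul_const Θ)).sub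
    (HasInt.sum fun i _ => (hm i).hasInt.mul_const (u i))).add (hϱ.hasInt.mul_const _)).add
    (hasInt_const _)).congr ?_
  filter_upwards [hz] with z hz
  rw [relEnergy_eq hz]
  simp only [mul_comm (u _)]
  ring

lemma hasInt_weakIntegrand [IsProbabilityMeasure ν]
    (hS : Integrable (fun z : Phase => (z.1 : ℝ) * cutoff (clamp a b) (entropy F z.1 z.2.1)) ν)
    (hSm : ∀ i, Integrable (fun z : Phase =>
      cutoff (clamp a b) (entropy F z.1 z.2.1) * z.2.2 i) ν)
    (hm : ∀ i, Integrable (fun z : Phase => z.2.2 i) ν)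
    (hmm : ∀ i j, Integrable (fun z : Phase => z.2.2 i * z.2.2 j / (z.1 : ℝ)) ν)
    (hP : Integrable (fun z : Phase => P z.1 z.2.1) ν)
    (hϱ : Integrable (fun z : Phase => (z.1 : ℝ)) ν) (p : ℝ)
    (u : Fin 3 → ℝ) (Θt : ℝ) (Θx : Fin 3 → ℝ) (ut : Fin 3 → ℝ) (ux : Fin 3 → Fin 3 → ℝ)
    (ψt : ℝ) (ψx : Fin 3 → ℝ) (pt : ℝ) (px : Fin 3 → ℝ) :
    HasInt ν (weakIntegrand F P a b p u Θt Θx ut ux ψt ψx pt px)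
      (-(pairing ν (fun z => (z.1 : ℝ) * cutoff (clamp a b) (entropy F z.1 z.2.1)) * Θt
          + ∑ i, pairing ν (fun z => cutoff (clamp a b) (entropy F z.1 z.2.1) * z.2.2 i) * Θx i)
        - ((∑ i, pairing ν (fun z => z.2.2 i) * ut i)
          + (∑ i, ∑ j, pairing ν (fun z => z.2.2 i * z.2.2 j / (z.1 : ℝ)) * ux i j)
          + pairing ν (fun z => P z.1 z.2.1) * ∑ i, ux i i)
        + (pairing ν (fun z => (z.1 : ℝ)) * ψt + ∑ i, pairing ν (fun z => z.2.2 i) * ψx i)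
        + (pt + ∑ j, (px j * u j + p * ux j j))) :=
  ((((hS.hasInt.mul_const Θt).add
    (HasInt.sum fun i _ => (hSm i).hasInt.mul_const (Θx i))).neg.sub
    (((HasInt.sum fun i _ => (hm i).hasInt.mul_const (ut i)).add
      (HasInt.sum fun i _ => HasInt.sum fun j _ => (hmm i j).hasInt.mul_const (ux i j))).add
      (hP.hasInt.mul_const _))).add
    ((hϱ.hasInt.mul_const ψt).add
      (HasInt.sum fun i _ => (hm i).hasInt.mul_const (ψx i)))).add (hasInt_const _)

end PairingFormulas

/-! ### Testing the weak formulations with the strong solution. -/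

section Inequality

variable {F : ThermoFunctions} {P : ℝ≥0 → ℝ≥0 → ℝ} {T a b s₀ : ℝ} {Y₀ : Torus → Measure Phase}
  {Y : ℝ → Torus → Measure Phase} {D : ℝ → ℝ} {r Θ : ℝ → Torus → ℝ} {U : ℝ → Torus → Vec}

/-- The relative energy with respect to the strong solution at `(t, x)`. -/
noncomputable def relEnergyAt (F : ThermoFunctions) (a b : ℝ) (r Θ : ℝ → Torus → ℝ)
    (U : ℝ → Torus → Vec) (t : ℝ) (x : Torus) : Phase → ℝ :=
  relEnergy F a b (r t x) (Θ t x) (fun i => U t x i)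

/-- The integrand of the relative energy inequality at `(t, x)`. -/
noncomputable def weakIntegrandAt (F : ThermoFunctions) (P : ℝ≥0 → ℝ≥0 → ℝ) (a b : ℝ)
    (r Θ : ℝ → Torus → ℝ) (U : ℝ → Torus → Vec) (t : ℝ) (x : Torus) : Phase → ℝ :=
  weakIntegrand F P a b (F.p (r t x, Θ t x)) (fun i => U t x i) (dt Θ t x) (fun i => dx i Θ t x)
    (fun i => dt (fun t x => U t x i) t x) (fun i j => dx j (fun t x => U t x i) t x)
    (dt (massTest F r Θ U) t x) (fun i => dx i (massTest F r Θ U) t x)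
    (dt (fun t x => F.p (r t x, Θ t x)) t x) (fun i => dx i (fun t x => F.p (r t x, Θ t x)) t x)

/-- Divergences integrate to zero on the torus. Adding ∂ₜp + div(pU) accounts for the term p(r,Θ) of
the relative energy. -/
lemma integral_pressure_balance (hT : 0 < T) {p : ℝ → Torus → ℝ} (hp : IsC1 T p)
    (hU : IsC1 T U) {τ : ℝ} (hτ : τ ∈ Ioo 0 T) :
    HasInt (spaceTime τ) (fun q : ℝ × Torus => dt p q.1 q.2
        + ∑ j, (dx j p q.1 q.2 * U q.1 q.2 j + p q.1 q.2 * dx j (fun t x => U t x j) q.1 q.2))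
      ((∫ x, p τ x) - ∫ x, p 0 x) := by
  have h1 : HasInt (spaceTime τ) (fun q : ℝ × Torus => dt p q.1 q.2)
      ((∫ x, p τ x) - ∫ x, p 0 x) :=
    ⟨(hp.integrable_dt hT).mono_measure (spaceTime_mono hτ.2.le), hp.integral_dt hT hτ⟩
  have h2 : ∀ j, HasInt (spaceTime τ)
      (fun q : ℝ × Torus => dx j (fun t x => p t x * U t x j) q.1 q.2) 0 := fun j => by
    have hpu := hp.mul (hU.component j)
    have hint := (integrable_of_continuousOn (hpu.continuousOn_dx hT j)).mono_measure
      (spaceTime_mono hτ.2.le)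
    refine ⟨hint, (integral_prod _ hint).trans (integral_eq_zero_of_ae ?_)⟩
    filter_upwards [ae_restrict_mem measurableSet_Ioo] with t ht
    exact hpu.integral_dx hT ⟨ht.1.le, ht.2.le.trans hτ.2.le⟩ j
  have h3 := h1.add (HasInt.sum (s := Finset.univ) fun j _ => h2 j)
  simp only [Finset.sum_const_zero, add_zero] at h3
  refine h3.congr ?_
  filter_upwards [ae_mem_Ioo_spaceTime] with q hq
  congr 1
  refine Finset.sum_congr rfl fun j _ => ?_
  have := pdiff_mul (x := q.2) hp (hU.component j) ⟨hq.1, hq.2.trans hτ.2⟩ (some j)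
  simp only [pdiff_some] at this
  rw [this]

lemma integral_toReal_lintegral_energyDensity {X : Type*} {mX : MeasurableSpace X} {μ : Measure X}
    {ν : X → Measure Phase} (hν : AEMeasurable ν μ)
    (hfin : ∫⁻ x, ∫⁻ z, energyDensity z ∂ν x ∂μ ≠ ⊤) :
    ∫ x, (∫⁻ z, energyDensity z ∂ν x).toReal ∂μ
      = (∫⁻ x, ∫⁻ z, energyDensity z ∂ν x ∂μ).toReal :=
  have hm := (Measure.measurable_lintegral measurable_energyDensity).comp_aemeasurable hν
  integral_toReal hm (ae_lt_top' hm hfin)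

/-- The relative energy vanishes at time 0: the initial measures sit at the strong state, whose
entropy the truncation leaves unchanged. -/
lemma initial_balance (hT : 0 < T) (hreg : IsRegular F) (hstab : ThermoStable F)
    (hsol : IsClassicalSolution F T r Θ U) (hinit : IsInitialMeasure Y₀)
    (hY₀ : ∀ᵐ x, Y₀ x = Measure.dirac (phasePoint F (r 0 x) (Θ 0 x) (U 0 x)))
    (hs : ∀ x, F.s (r 0 x, Θ 0 x) ∈ Icc a b) :
    (totalEnergy Y₀).toReal
      - (∫ x, pairing (Y₀ x) (fun z => (z.1 : ℝ) * cutoff (clamp a b) (entropy F z.1 z.2.1))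
          * Θ 0 x)
      - (∫ x, ∑ i, pairing (Y₀ x) (fun z => z.2.2 i) * U 0 x i)
      + (∫ x, pairing (Y₀ x) (fun z => (z.1 : ℝ)) * massTest F r Θ U 0 x)
      + (∫ x, F.p (r 0 x, Θ 0 x)) = 0 := by
  have h0 : (0 : ℝ) ∈ Icc 0 T := ⟨le_rfl, hT.le⟩
  have hr := hsol.r_pos 0 h0
  have hΘ := hsol.Θ_pos 0 h0
  have hcI : ∀ {f : Torus → ℝ}, Continuous f → Integrable f := fun hf =>
    hf.integrable_of_hasCompactSupport (HasCompactSupport.of_compactSpace _)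
  have hcr := hsol.r_C1.continuous_slice h0
  have hcΘ := hsol.Θ_C1.continuous_slice h0
  have hcU := fun i => (hsol.U_C1.component i).continuous_slice h0
  have hce := (hsol.isC1_comp (hreg.e_smooth.of_le one_le_two)).continuous_slice h0
  have hcs := (hsol.isC1_comp (hreg.s_smooth.of_le one_le_two)).continuous_slice h0
  have hcp := (hsol.isC1_comp (hreg.p_smooth.of_le one_le_two)).continuous_slice h0
  have hcψ := (hsol.isC1_massTest hreg).continuous_slice h0
  have hE : HasInt volume (fun x => 1 / 2 * r 0 x * (∑ i, U 0 x i ^ 2)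
      + r 0 x * F.e (r 0 x, Θ 0 x)) (totalEnergy Y₀).toReal := by
    refine ⟨hcI (((continuous_const.mul hcr).mul
      (continuous_finsetSum _ fun i _ => (hcU i).pow 2)).add (hcr.mul hce)), ?_⟩
    refine Eq.trans ?_ (integral_toReal_lintegral_energyDensity hinit.measurable hinit.energy)
    refine integral_congr_ae ?_
    filter_upwards [hY₀] with x hx
    simp only [hx, lintegral_dirac, energyDensity_phasePoint hreg (hr x) (hΘ x)]
  have hS : HasInt volume (fun x => r 0 x * F.s (r 0 x, Θ 0 x) * Θ 0 x)
      (∫ x, pairing (Y₀ x) (fun z => (z.1 : ℝ) * cutoff (clamp a b) (entropy F z.1 z.2.1))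
          * Θ 0 x) := by
    refine ⟨hcI ((hcr.mul hcs).mul hcΘ), integral_congr_ae ?_⟩
    filter_upwards [hY₀] with x hx
    rw [hx, pairing_dirac, entropy_phasePoint hreg hstab (hr x) (hΘ x), cutoff_coe,
      clamp_of_mem (hs x), coe_density_phasePoint (hr x)]
  have hM : HasInt volume (fun x => ∑ i, r 0 x * U 0 x i * U 0 x i)
      (∫ x, ∑ i, pairing (Y₀ x) (fun z => z.2.2 i) * U 0 x i) := by
    refine ⟨hcI (continuous_finsetSum _ fun i _ => (hcr.mul (hcU i)).mul (hcU i)), integral_congr_ae ?_⟩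
    filter_upwards [hY₀] with x hx
    simp only [hx, pairing_dirac, momentum_phasePoint]
  have hϱ : HasInt volume (fun x => r 0 x * massTest F r Θ U 0 x)
      (∫ x, pairing (Y₀ x) (fun z => (z.1 : ℝ)) * massTest F r Θ U 0 x) := by
    refine ⟨hcI (hcr.mul hcψ), integral_congr_ae ?_⟩
    filter_upwards [hY₀] with x hx
    rw [hx, pairing_dirac, coe_density_phasePoint (hr x)]
  rw [← ((((hE.sub hS).sub hM).add hϱ).add (hcI hcp).hasInt).2]
  refine integral_eq_zero_of_ae (Eventually.of_forall fun x => ?_)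
  have := (hr x).ne'
  simp only [massTest, gibbsEnergy, EuclideanSpace.real_norm_sq_eq, Fin.sum_univ_three,
    Pi.zero_apply]
  field_simp
  ring

lemma relEnergy_integrable (hreg : IsRegular F)
    (hsol : IsClassicalSolution F T r Θ U) (hY : IsDissipativeMVSolution F P T Y₀ Y D)
    (hab : a ≤ b) (hadm : ∀ᵐ q ∂spaceTime T, ∀ᵐ z ∂Y q.1 q.2, IsAdmissible F s₀ z) :
    (∀ᵐ q ∂spaceTime T, Integrable (relEnergyAt F a b r Θ U q.1 q.2) (Y q.1 q.2)) ∧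
      Integrable (fun q : ℝ × Torus => pairing (Y q.1 q.2) (relEnergyAt F a b r Θ U q.1 q.2))
        (spaceTime T) ∧
      ∀ᵐ τ ∂volume.restrict (Ioo 0 T),
        ∫ x, pairing (Y τ x) (relEnergyAt F a b r Θ U τ x)
          = (totalEnergy (Y τ)).toReal
            - (∫ x, pairing (Y τ x)
                (fun z => (z.1 : ℝ) * cutoff (clamp a b) (entropy F z.1 z.2.1)) * Θ τ x)
            - (∫ x, ∑ i, pairing (Y τ x) (fun z => z.2.2 i) * U τ x i)
            + (∫ x, pairing (Y τ x) (fun z => (z.1 : ℝ)) * massTest F r Θ U τ x)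
            + ∫ x, F.p (r τ x, Θ τ x) := by
  have hZ := hY.int_entropy (clamp a b) continuous_clamp ⟨_, abs_clamp_le hab⟩
    (fun _ _ h => monotone_clamp h)
  obtain ⟨-, hE, hEτ⟩ := hY.energy_integrable
  have hrel : ∀ᵐ q ∂spaceTime T, HasInt (Y q.1 q.2) (relEnergyAt F a b r Θ U q.1 q.2)
      (pairing (Y q.1 q.2) energyReal
        - pairing (Y q.1 q.2)
            (fun z => (z.1 : ℝ) * cutoff (clamp a b) (entropy F z.1 z.2.1)) * Θ q.1 q.2
        - (∑ i, pairing (Y q.1 q.2) (fun z => z.2.2 i) * U q.1 q.2 i)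
        + pairing (Y q.1 q.2) (fun z => (z.1 : ℝ)) * massTest F r Θ U q.1 q.2
        + F.p (r q.1 q.2, Θ q.1 q.2)) := by
    filter_upwards [hadm, hE.1, hZ.1, ae_all_iff.2 fun i => (hY.int_momentum i).1,
      hY.int_density.1, hY.young.probability] with q h1 h2 h3 h4 h5 h6
    have := hasInt_relEnergy h1 h2 h3 h4 h5 (r q.1 q.2) (Θ q.1 q.2) (fun i => U q.1 q.2 i)
    rwa [← EuclideanSpace.real_norm_sq_eq] at this
  have iZ := hZ.mul_continuousOn hsol.Θ_C1.continuousOn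
  have iM := integrable_finsetSum Finset.univ fun i _ =>
    (hY.int_momentum i).mul_continuousOn (f := fun t x => U t x i)
      (hsol.U_C1.component i).continuousOn
  have iϱ := hY.int_density.mul_continuousOn (hsol.isC1_massTest hreg).continuousOn
  have ip := integrable_of_continuousOn (f := fun t x => F.p (r t x, Θ t x))
    (hsol.isC1_comp (hreg.p_smooth.of_le one_le_two)).continuousOn
  refine ⟨hrel.mono fun q h => h.1,
    (((((hE.2.sub iZ).sub iM).add iϱ).add ip).congr ?_), ?_⟩
  · filter_upwards [hrel] with q hq using hq.2.symm
  · filter_upwards [hEτ, ae_slice_of_ae hrel, ae_integrable_slice hE.2, ae_integrable_slice iZ,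
      ae_integrable_slice iM, ae_integrable_slice iϱ, ae_integrable_slice ip]
      with τ h0 h1 h2 h3 h4 h5 h6
    rw [← h0]
    refine Eq.trans (integral_congr_ae ?_)
      ((((h2.hasInt.sub h3.hasInt).sub h4.hasInt).add h5.hasInt).add h6.hasInt).2
    filter_upwards [h1] with x hx using hx.2

/-- The value at τ splits into the total energy, the tested entropy, momentum and density, and the
pressure; each increment is governed by one weak formulation. The entropy enters with a minus sign
and the test function Θ is positive, so the inequality has the right direction; `D` comes from the
energy balance. -/
lemma relEnergy_inequality (hT : 0 < T) (hreg : IsRegular F) (hstab : ThermoStable F)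
    (hsol : IsClassicalSolution F T r Θ U) (hY : IsDissipativeMVSolution F P T Y₀ Y D)
    (hY₀ : ∀ᵐ x, Y₀ x = Measure.dirac (phasePoint F (r 0 x) (Θ 0 x) (U 0 x)))
    (hab : a ≤ b) (hs : ∀ x, F.s (r 0 x, Θ 0 x) ∈ Icc a b)
    (hadm : ∀ᵐ q ∂spaceTime T, ∀ᵐ z ∂Y q.1 q.2, IsAdmissible F s₀ z)
    {μ : Fin 3 → Fin 3 → SignedMeasure (ℝ × Torus)}
    (hμ : ∀ φ : ℝ → Torus → Vec, IsC1 T φ → ∀ᵐ τ ∂volume.restrict (Ioo 0 T),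
      (∫ x, ∑ i, pairing (Y τ x) (fun z => z.2.2 i) * φ τ x i)
          - (∫ x, ∑ i, pairing (Y₀ x) (fun z => z.2.2 i) * φ 0 x i)
        = (∫ t in (0 : ℝ)..τ, ∫ x,
            ((∑ i, pairing (Y t x) (fun z => z.2.2 i) * dt (fun t x => φ t x i) t x)
              + (∑ i, ∑ j, pairing (Y t x) (fun z => z.2.2 i * z.2.2 j / (z.1 : ℝ))
                  * dx j (fun t x => φ t x i) t x)
              + pairing (Y t x) (fun z => P z.1 z.2.1)
                  * ∑ i, dx i (fun t x => φ t x i) t x))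
          + ∑ i, ∑ j, signedIntegral (μ i j) τ (dx j (fun t x => φ t x i))) :
    (∀ᵐ q ∂spaceTime T, Integrable (weakIntegrandAt F P a b r Θ U q.1 q.2) (Y q.1 q.2)) ∧
      ∀ᵐ τ ∂volume.restrict (Ioo 0 T),
        Integrable (fun q : ℝ × Torus =>
          pairing (Y q.1 q.2) (weakIntegrandAt F P a b r Θ U q.1 q.2)) (spaceTime τ) ∧
        (∫ x, pairing (Y τ x) (relEnergyAt F a b r Θ U τ x)) + D τ
          ≤ (∫ q, pairing (Y q.1 q.2) (weakIntegrandAt F P a b r Θ U q.1 q.2) ∂spaceTime τ)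
            - ∑ i, ∑ j, signedIntegral (μ i j) τ (dx j (fun t x => U t x i)) := by
  have hZb : ∃ C, ∀ x, |clamp a b x| ≤ C := ⟨_, abs_clamp_le hab⟩
  have hZm : Monotone (clamp a b) := fun _ _ h => monotone_clamp h
  have hZ := hY.int_entropy (clamp a b) continuous_clamp hZb hZm
  have hZf := hY.int_entropy_flux (clamp a b) continuous_clamp hZb hZm
  have hp := hsol.isC1_comp (hreg.p_smooth.of_le one_le_two)
  have hψ := hsol.isC1_massTest hreg
  have hUi := fun i => hsol.U_C1.component i
  have hweak : ∀ᵐ q ∂spaceTime T, HasInt (Y q.1 q.2) (weakIntegrandAt F P a b r Θ U q.1 q.2)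
      (-(pairing (Y q.1 q.2) (fun z => (z.1 : ℝ) * cutoff (clamp a b) (entropy F z.1 z.2.1))
            * dt Θ q.1 q.2
          + ∑ i, pairing (Y q.1 q.2) (fun z => cutoff (clamp a b) (entropy F z.1 z.2.1) * z.2.2 i)
            * dx i Θ q.1 q.2)
        - ((∑ i, pairing (Y q.1 q.2) (fun z => z.2.2 i) * dt (fun t x => U t x i) q.1 q.2)
          + (∑ i, ∑ j, pairing (Y q.1 q.2) (fun z => z.2.2 i * z.2.2 j / (z.1 : ℝ))
            * dx j (fun t x => U t x i) q.1 q.2)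
          + pairing (Y q.1 q.2) (fun z => P z.1 z.2.1)
            * ∑ i, dx i (fun t x => U t x i) q.1 q.2)
        + (pairing (Y q.1 q.2) (fun z => (z.1 : ℝ)) * dt (massTest F r Θ U) q.1 q.2
          + ∑ i, pairing (Y q.1 q.2) (fun z => z.2.2 i) * dx i (massTest F r Θ U) q.1 q.2)
        + (dt (fun t x => F.p (r t x, Θ t x)) q.1 q.2
          + ∑ j, (dx j (fun t x => F.p (r t x, Θ t x)) q.1 q.2 * U q.1 q.2 j
            + F.p (r q.1 q.2, Θ q.1 q.2) * dx j (fun t x => U t x j) q.1 q.2))) := by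
    filter_upwards [hZ.1, ae_all_iff.2 fun i => (hZf i).1,
      ae_all_iff.2 fun i => (hY.int_momentum i).1,
      ae_all_iff.2 fun i => ae_all_iff.2 fun j => (hY.int_convection i j).1,
      hY.int_pressure.1, hY.int_density.1, hY.young.probability] with q h1 h2 h3 h4 h5 h6 h7
    exact hasInt_weakIntegrand h1 h2 h3 h4 h5 h6 (F.p (r q.1 q.2, Θ q.1 q.2))
      (fun i => U q.1 q.2 i) (dt Θ q.1 q.2) (fun i => dx i Θ q.1 q.2)
      (fun i => dt (fun t x => U t x i) q.1 q.2) (fun i j => dx j (fun t x => U t x i) q.1 q.2)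
      (dt (massTest F r Θ U) q.1 q.2) (fun i => dx i (massTest F r Θ U) q.1 q.2)
      (dt (fun t x => F.p (r t x, Θ t x)) q.1 q.2)
      (fun i => dx i (fun t x => F.p (r t x, Θ t x)) q.1 q.2)
  refine ⟨hweak.mono fun q h => h.1, ?_⟩
  have iZ := (hZ.mul_dt hT hsol.Θ_C1).add (integrable_finsetSum Finset.univ fun i _ =>
    (hZf i).mul_continuousOn (hsol.Θ_C1.continuousOn_dx hT i))
  have iM := ((integrable_finsetSum Finset.univ fun i _ =>
      (hY.int_momentum i).mul_dt hT (hUi i)).add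
    (integrable_finsetSum Finset.univ fun i _ => integrable_finsetSum Finset.univ fun j _ =>
      (hY.int_convection i j).mul_continuousOn ((hUi i).continuousOn_dx hT j))).add
    (hY.int_pressure.mul_continuousOn
      (f := fun t x => ∑ i, dx i (fun t x => U t x i) t x)
      (continuousOn_finsetSum _ fun i _ => (hUi i).continuousOn_dx hT i))
  have iϱ := (hY.int_density.mul_dt hT hψ).add (integrable_finsetSum Finset.univ fun i _ =>
    (hY.int_momentum i).mul_continuousOn (hψ.continuousOn_dx hT i))
  filter_upwards [(relEnergy_integrable hreg hsol hY hab hadm).2.2, hY.energy_eq,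
    hY.entropy_ineq (clamp a b) continuous_clamp hZb hZm Θ hsol.Θ_C1
      (fun t ht x => (hsol.Θ_pos t ht x).le),
    hμ U hsol.U_C1, hY.continuity_eq (massTest F r Θ U) hψ, ae_restrict_mem measurableSet_Ioo]
    with τ h1 h2 h3 h4 h5 hτ
  have hle := spaceTime_mono hτ.2.le
  have jZ := (iZ.mono_measure hle)
  have jM := (iM.mono_measure hle)
  have jϱ := (iϱ.mono_measure hle)
  have jp := integral_pressure_balance hT hp hsol.U_C1 hτ
  have hW := (((jZ.hasInt.neg.sub jM.hasInt).add jϱ.hasInt).add jp).congr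
    (g := fun q : ℝ × Torus =>
      pairing (Y q.1 q.2) (weakIntegrandAt F P a b r Θ U q.1 q.2)) (by
        filter_upwards [ae_mono hle hweak] with q hq using hq.2.symm)
  refine ⟨hW.1, ?_⟩
  have e3 := intervalIntegral_integral_eq (F := fun t x =>
        pairing (Y t x) (fun z => (z.1 : ℝ) * cutoff (clamp a b) (entropy F z.1 z.2.1))
            * dt Θ t x
          + ∑ i, pairing (Y t x) (fun z => cutoff (clamp a b) (entropy F z.1 z.2.1) * z.2.2 i)
            * dx i Θ t x)
    hτ.1.le jZ
  have e4 := intervalIntegral_integral_eq (F := fun t x =>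
        (∑ i, pairing (Y t x) (fun z => z.2.2 i) * dt (fun t x => U t x i) t x)
          + (∑ i, ∑ j, pairing (Y t x) (fun z => z.2.2 i * z.2.2 j / (z.1 : ℝ))
            * dx j (fun t x => U t x i) t x)
          + pairing (Y t x) (fun z => P z.1 z.2.1)
            * ∑ i, dx i (fun t x => U t x i) t x)
    hτ.1.le jM
  have e5 := intervalIntegral_integral_eq (F := fun t x =>
        pairing (Y t x) (fun z => (z.1 : ℝ)) * dt (massTest F r Θ U) t x
          + ∑ i, pairing (Y t x) (fun z => z.2.2 i) * dx i (massTest F r Θ U) t x)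
    hτ.1.le jϱ
  have h0 := initial_balance hT hreg hstab hsol hY.initial hY₀ hs
  have h6 : (∫ q, pairing (Y q.1 q.2) (weakIntegrandAt F P a b r Θ U q.1 q.2) ∂spaceTime τ) = _ :=
    hW.2
  rw [h1, h6]
  erw [← e3, ← e4, ← e5]
  -- Sum of all the balances; the initial terms cancel by `initial_balance`.
  linarith [h2.2]

end Inequality

/-! ### Weak–strong uniqueness -/

section Bounds

variable {T : ℝ} {f : ℝ → Torus → ℝ} {U : ℝ → Torus → Vec}

lemma exists_pos_bounds (hT : 0 < T)
    (hf : ContinuousOn (fun q : ℝ × Torus => f q.1 q.2) (Icc 0 T ×ˢ univ))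
    (hpos : ∀ t ∈ Icc 0 T, ∀ x, 0 < f t x) :
    ∃ m M : ℝ, 0 < m ∧ ∀ t ∈ Icc 0 T, ∀ x, f t x ∈ Icc m M := by
  obtain ⟨M, -, hM⟩ := exists_bound_of_continuousOn hf
  obtain ⟨q, hq, hmin⟩ := (isCompact_Icc.prod isCompact_univ).exists_isMinOn
    ⟨((0 : ℝ), (0 : Torus)), ⟨⟨le_rfl, hT.le⟩, mem_univ _⟩⟩ hf
  exact ⟨f q.1 q.2, M, hpos q.1 hq.1 q.2, fun t ht x =>
    ⟨hmin (show (t, x) ∈ Icc 0 T ×ˢ univ from ⟨ht, mem_univ _⟩),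
      (le_abs_self _).trans (hM t ht x)⟩⟩

lemma IsC1.exists_bound_material (hT : 0 < T) (hf : IsC1 T f) (hU : IsC1 T U) :
    ∃ B : ℝ, 0 ≤ B ∧ ∀ t ∈ Ioo 0 T, ∀ x, |dt f t x + ∑ j, U t x j * dx j f t x| ≤ B := by
  obtain ⟨B₁, h₁, hB₁⟩ := hf.exists_bound_dt hT
  obtain ⟨B₂, h₂, hB₂⟩ := exists_bound_of_continuousOn
    (f := fun t x => ∑ j, U t x j * dx j f t x)
    (continuousOn_finsetSum _ fun j _ =>
      (hU.component j).continuousOn.mul (hf.continuousOn_dx hT j))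
  exact ⟨B₁ + B₂, add_nonneg h₁ h₂, fun t ht x => (abs_add_le _ _).trans
    (add_le_add (hB₁ t ht x) (hB₂ t (Ioo_subset_Icc_self ht) x))⟩

lemma IsC1.exists_bound_gradient (hT : 0 < T) (hU : IsC1 T U) :
    ∃ B : ℝ, 0 ≤ B ∧ ∀ t ∈ Icc 0 T, ∀ x i j, |dx j (fun t x => U t x i) t x| ≤ B := by
  choose B hB0 hB using fun i => (hU.component i).exists_bound_dx hT
  exact ⟨∑ i, B i, Finset.sum_nonneg fun i _ => hB0 i, fun t ht x i j =>
    (hB i t ht x j).trans (Finset.single_le_sum (fun i _ => hB0 i) (Finset.mem_univ i))⟩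

end Bounds

lemma eq_dirac_of_ae_eq {X : Type*} {mX : MeasurableSpace X} {μ : Measure X}
    [IsProbabilityMeasure μ] {c : X} (h : ∀ᵐ z ∂μ, z = c) : μ = Measure.dirac c := by
  have h1 : μ.map id = μ.map fun _ => c := Measure.map_congr h
  rwa [Measure.map_id, Measure.map_const, measure_univ, one_smul] at h1

/-! ### Closing the Gronwall estimate. -/

section Uniqueness

variable {F : ThermoFunctions} {P : ℝ≥0 → ℝ≥0 → ℝ} {T : ℝ} {Y₀ : Torus → Measure Phase}
  {Y : ℝ → Torus → Measure Phase} {D : ℝ → ℝ} {r Θ : ℝ → Torus → ℝ} {U : ℝ → Torus → Vec}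

/-- The relative energy dominates the integrand of the relative energy inequality and vanishes only
at the phase point of the strong solution. -/
lemma exists_weakIntegrand_bound (hT : 0 < T) (hreg : IsRegular F) (hgibbs : GibbsRelation F)
    (hstab : ThermoStable F) (hP : IsPhasePressure F P) (hsol : IsClassicalSolution F T r Θ U)
    (hpos : ∀ t ∈ Icc 0 T, ∀ x, 0 < F.p (r t x, Θ t x)) :
    ∃ a b K : ℝ, a ≤ b ∧ (∀ t ∈ Icc 0 T, ∀ x, F.s (r t x, Θ t x) ∈ Icc a b) ∧
      ∀ t ∈ Ioo 0 T, ∀ x, ∀ z, IsAdmissible F a z →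
        0 ≤ relEnergyAt F a b r Θ U t x z ∧
        (relEnergyAt F a b r Θ U t x z = 0 → z = phasePoint F (r t x) (Θ t x) (U t x)) ∧
        weakIntegrandAt F P a b r Θ U t x z ≤ K * relEnergyAt F a b r Θ U t x z := by
  have hp := hsol.isC1_comp (hreg.p_smooth.of_le one_le_two)
  obtain ⟨R₁, R₂, hR, hr⟩ := exists_pos_bounds hT hsol.r_C1.continuousOn hsol.r_pos
  obtain ⟨T₁, T₂, hT₁, hΘ⟩ := exists_pos_bounds hT hsol.Θ_C1.continuousOn hsol.Θ_pos
  obtain ⟨π₀, π₁, hπ₀, hπ⟩ := exists_pos_bounds (f := fun t x => F.p (r t x, Θ t x)) hT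
    hp.continuousOn hpos
  obtain ⟨B₁, h₁, hB₁⟩ := hsol.U_C1.exists_bound_gradient hT
  obtain ⟨B₂, h₂, hB₂⟩ := hsol.Θ_C1.exists_bound_dx hT
  obtain ⟨B₃, h₃, hB₃⟩ := hsol.Θ_C1.exists_bound_material hT hsol.U_C1
  obtain ⟨B₄, h₄, hB₄⟩ := hp.exists_bound_material hT hsol.U_C1
  -- Half of the smaller lower bound: the box enlarged by `δ` still has positive densities and
  -- temperatures.
  set δ := min R₁ T₁ / 2 with hδ
  have hmin : 0 < min R₁ T₁ := lt_min hR hT₁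
  have hδ0 : 0 < δ := half_pos hmin
  have ha : 0 < R₁ - δ := by linarith [min_le_left R₁ T₁]
  have hb : 0 < T₁ - δ := by linarith [min_le_right R₁ T₁]
  have hin : ∀ t ∈ Icc 0 T, ∀ x, (r t x, Θ t x)
      ∈ box (R₁ - δ + δ) (R₂ + δ - δ) (T₁ - δ + δ) (T₂ + δ - δ) := fun t ht x => by
    simp only [sub_add_cancel, add_sub_cancel_right]
    exact ⟨hr t ht x, hΘ t ht x⟩
  have hout : ∀ t ∈ Icc 0 T, ∀ x, (r t x, Θ t x)
      ∈ box (R₁ - δ) (R₂ + δ) (T₁ - δ) (T₂ + δ) := fun t ht x =>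
    ⟨⟨by linarith [(hr t ht x).1], by linarith [(hr t ht x).2]⟩,
      ⟨by linarith [(hΘ t ht x).1], by linarith [(hΘ t ht x).2]⟩⟩
  obtain ⟨M, hM⟩ := isCompact_box.exists_bound_of_continuousOn
    (hreg.s_smooth.continuousOn.mono (box_subset_quadrant (a₂ := R₂ + δ) (b₂ := T₂ + δ) ha hb))
  have hMbox : ∀ z ∈ box (R₁ - δ) (R₂ + δ) (T₁ - δ) (T₂ + δ), F.s z ∈ Icc (-M) M :=
    fun z hz => abs_le.1 (hM z hz)
  have h0 : (0 : ℝ) ∈ Icc 0 T := ⟨le_rfl, hT.le⟩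
  have hMM : -M ≤ M := (hMbox _ (hout 0 h0 0)).1.trans (hMbox _ (hout 0 h0 0)).2
  have hB : 0 ≤ 3 * B₁ + B₂ + B₃ + B₄ := by positivity
  obtain ⟨K, -, hK⟩ := exists_remainder_bound hreg hgibbs hstab hP ha hb hδ0
    ⟨_, hin 0 h0 0⟩ hMM le_rfl hMbox hπ₀ hB
  -- `M` bounds the entropy on the whole enlarged box, so truncation to `[-M, M]` is inactive there;
  -- the lower end is also the level used in the minimum principle.
  refine ⟨-M, M, K, hMM, fun t ht x => hMbox _ (hout t ht x), fun t ht x z hz => ?_⟩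
  have ht' := Ioo_subset_Icc_self ht
  have hr0 := hsol.r_pos t ht' x
  have hΘ0 := hsol.Θ_pos t ht' x
  obtain ⟨k1, k2, k3⟩ := hK (r t x) (Θ t x) (hin t ht' x) (hπ t ht' x).1 (fun i => U t x i) z hz
  refine ⟨k1, fun h => ?_, ?_⟩
  · obtain ⟨e1, e2, e3⟩ := k2 h
    refine Prod.ext ?_ (Prod.ext ?_ ?_)
    · exact NNReal.eq (e1.trans (coe_density_phasePoint hr0).symm)
    · exact NNReal.eq (e2.trans (coe_energy_phasePoint hreg hr0 hΘ0).symm)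
    · ext i
      exact e3 i
  · have hψ := fun o => hsol.pdiff_massTest hreg hgibbs ht x o
    have hψt := hψ none
    simp only [pdiff_none] at hψt
    have hψx : ∀ j, _ := fun j => hψ (some j)
    simp only [pdiff_some] at hψx
    have hrem := weakIntegrand_eq_remainder (F := F) (P := P) (a := -M) (b := M) (s₀ := -M)
      (Θ := Θ t x) hr0 (fun i => hsol.velocity_eq ht x i) hψt hψx hz
    refine hrem.le.trans ?_
    have hDp : dt (fun t x => F.p (r t x, Θ t x)) t x
          + ∑ j, U t x j * dx j (fun t x => F.p (r t x, Θ t x)) t x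
        = pd₁ F.p (r t x, Θ t x) * (dt r t x + ∑ j, U t x j * dx j r t x)
          + pd₂ F.p (r t x, Θ t x) * (dt Θ t x + ∑ j, U t x j * dx j Θ t x) := by
      have hc := fun o => hsol.pdiff_comp (hreg.p_smooth.of_le one_le_two) ht x o
      have hct := hc none
      have hcx : ∀ j, _ := fun j => hc (some j)
      simp only [pdiff_none, pdiff_some] at hct hcx
      rw [hct]
      simp only [hcx, Fin.sum_univ_three]
      ring
    refine k3 _ (dt r t x + ∑ j, U t x j * dx j r t x) _ _ _
      (fun i j => (hB₁ t ht' x i j).trans (by linarith))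
      (fun i => (hB₂ t ht' x i).trans (by linarith)) ?_
      ((hB₃ t ht x).trans (by linarith)) ((hB₄ t ht x).trans (by linarith))
      (hsol.density_eq ht x) (hsol.entropy_transport hreg hgibbs ht x) hDp
    refine (Finset.abs_sum_le_sum_abs _ _).trans ?_
    refine (Finset.sum_le_sum fun i _ => hB₁ t ht' x i i).trans ?_
    simp only [Finset.sum_const, Finset.card_univ, Fintype.card_fin, nsmul_eq_mul]
    push_cast
    linarith

/-- The weak–strong uniqueness principle for dissipative measure-valued solutions. -/
theorem weak_strong_uniqueness (hT : 0 < T) (hreg : IsRegular F) (hgibbs : GibbsRelation F)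
    (hstab : ThermoStable F) (hP : IsPhasePressure F P) (hsol : IsClassicalSolution F T r Θ U)
    (hpos : ∀ t ∈ Icc 0 T, ∀ x, 0 < F.p (r t x, Θ t x))
    (hY : IsDissipativeMVSolution F P T Y₀ Y D)
    (hY₀ : ∀ᵐ x, Y₀ x = Measure.dirac (phasePoint F (r 0 x) (Θ 0 x) (U 0 x))) :
    (∀ᵐ t ∂volume.restrict (Ioo 0 T), D t = 0) ∧
      ∀ᵐ q ∂spaceTime T, Y q.1 q.2
        = Measure.dirac (phasePoint F (r q.1 q.2) (Θ q.1 q.2) (U q.1 q.2)) := by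
  obtain ⟨a, b, K, hab, hs, hK⟩ :=
    exists_weakIntegrand_bound hT hreg hgibbs hstab hP hsol hpos
  have h0 : (0 : ℝ) ∈ Icc 0 T := ⟨le_rfl, hT.le⟩
  have hadm : ∀ᵐ q ∂spaceTime T, ∀ᵐ z ∂Y q.1 q.2, IsAdmissible F a z := by
    filter_upwards [hY.energy_integrable.1, hY.le_entropy hreg hstab (hsol.r_pos 0 h0)
      (hsol.Θ_pos 0 h0) hY₀ fun x => (hs 0 h0 x).1] with q h1 h2
    filter_upwards [h1, h2] with z h1 h2 using ⟨h1, h2⟩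
  obtain ⟨μ, hμ, c, hc, hμD⟩ := hY.momentum_eq
  obtain ⟨hεY, hεI, -⟩ := relEnergy_integrable hreg hsol hY hab hadm
  obtain ⟨hRY, hineq⟩ :=
    relEnergy_inequality hT hreg hstab hsol hY hY₀ hab (hs 0 h0) hadm hμ
  obtain ⟨B, hB, hBU⟩ := hsol.U_C1.exists_bound_gradient hT
  set ε : ℝ → Torus → ℝ := fun t x => pairing (Y t x) (relEnergyAt F a b r Θ U t x) with hε
  have hpt : ∀ᵐ q ∂spaceTime T, ∀ᵐ z ∂Y q.1 q.2, 0 ≤ relEnergyAt F a b r Θ U q.1 q.2 z ∧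
      (relEnergyAt F a b r Θ U q.1 q.2 z = 0 →
        z = phasePoint F (r q.1 q.2) (Θ q.1 q.2) (U q.1 q.2)) ∧
      weakIntegrandAt F P a b r Θ U q.1 q.2 z ≤ K * relEnergyAt F a b r Θ U q.1 q.2 z := by
    filter_upwards [hadm, ae_mem_Ioo_spaceTime] with q h1 hq
    filter_upwards [h1] with z hz using hK q.1 hq q.2 z hz
  have hε0 : ∀ᵐ q ∂spaceTime T, 0 ≤ ε q.1 q.2 := by
    filter_upwards [hpt] with q hq using integral_nonneg_of_ae (hq.mono fun z h => h.1)
  have hR : ∀ᵐ q ∂spaceTime T,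
      pairing (Y q.1 q.2) (weakIntegrandAt F P a b r Θ U q.1 q.2) ≤ K * ε q.1 q.2 := by
    filter_upwards [hpt, hεY, hRY] with q h1 h2 h3
    refine le_trans ?_ (integral_const_mul K _).le
    exact integral_mono_ae h3 (h2.const_mul K) (h1.mono fun z h => h.2.2)
  -- No sign of the defect is assumed: its integral dominates a total variation, hence is
  -- nonnegative.
  have hD0 : ∀ᵐ τ ∂volume.restrict (Ioo 0 T), 0 ≤ ∫ t in (0 : ℝ)..τ, D t := by
    filter_upwards [hμD] with τ h
    have : 0 ≤ matrixVariation μ τ :=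
      Finset.sum_nonneg fun i _ => Finset.sum_nonneg fun j _ => ENNReal.toReal_nonneg
    exact nonneg_of_mul_nonneg_right (this.trans h) hc
  -- The remainder is absorbed by `K` times the relative energy; the concentration term is at most
  -- the bound on ∇U times the total variation, hence `B * c` times the integral of `D`.
  have hmain : ∀ᵐ τ ∂volume.restrict (Ioo 0 T), (∫ x, ε τ x) + D τ
      ≤ K * (∫ t in (0 : ℝ)..τ, ∫ x, ε t x) + B * c * ∫ t in (0 : ℝ)..τ, D t := by
    filter_upwards [hineq, hμD, ae_restrict_mem measurableSet_Ioo] with τ h1 h2 hτ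
    have hle := spaceTime_mono hτ.2.le
    have h3 := abs_sum_signedIntegral_le μ hB (τ := τ)
      (f := fun i j => dx j (fun t x => U t x i))
      fun i j t ht x => hBU t ⟨ht.1, ht.2.le.trans hτ.2.le⟩ x i j
    have h4 := integral_mono_ae h1.1 ((hεI.mono_measure hle).const_mul K) (ae_mono hle hR)
    rw [integral_const_mul, ← intervalIntegral_integral_eq (F := ε) hτ.1.le
      (hεI.mono_measure hle)] at h4
    have h5 := (abs_le.1 h3).1
    have h6 := mul_le_mul_of_nonneg_left h2 hB
    linarith [h1.2]
  obtain ⟨hε1, hD1⟩ := eq_zero_of_gronwall hT (integrableOn_integral_slice (f := ε) hεI)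
    hY.integrableOn_defect
    ((ae_slice_of_ae hε0).mono fun τ h => integral_nonneg_of_ae h) hD0 hmain
  refine ⟨hD1, ?_⟩
  have hε2 : ∫ q, ε q.1 q.2 ∂spaceTime T = 0 :=
    (integral_prod _ hεI).trans (integral_eq_zero_of_ae hε1)
  filter_upwards [(integral_eq_zero_iff_of_nonneg_ae hε0 hεI).1 hε2, hpt, hεY,
    hY.young.probability] with q h1 h2 h3 h4
  refine eq_dirac_of_ae_eq ?_
  filter_upwards [h2, (integral_eq_zero_iff_of_nonneg_ae (h2.mono fun z h => h.1) h3).1 h1]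
    with z h5 h6 using h5.2.1 h6

end Uniqueness

end EulerMV

theorem theorem3p1
    (F : EulerMV.ThermoFunctions)
    (hreg : EulerMV.IsRegular F)
    (hgibbs : EulerMV.GibbsRelation F)
    (hstab : EulerMV.ThermoStable F)
    (hgrowth : EulerMV.PressureGrowth F)
    (P : ℝ≥0 → ℝ≥0 → ℝ)
    (hP : EulerMV.IsPhasePressure F P)
    (T : ℝ) (hT : 0 < T)
    (r Θ : ℝ → EulerMV.Torus → ℝ)
    (U : ℝ → EulerMV.Torus → EulerMV.Vec)
    (hsol : EulerMV.IsClassicalSolution F T r Θ U)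
    (hpos : ∀ t ∈ Icc 0 T, ∀ x, 0 < F.p (r t x, Θ t x))
    (Y₀ : EulerMV.Torus → Measure EulerMV.Phase)
    (Y : ℝ → EulerMV.Torus → Measure EulerMV.Phase)
    (D : ℝ → ℝ)
    (hY : EulerMV.IsDissipativeMVSolution F P T Y₀ Y D)
    (hY₀ : ∀ᵐ x, Y₀ x = Measure.dirac (EulerMV.phasePoint F (r 0 x) (Θ 0 x) (U 0 x))) :
    (∀ᵐ t ∂volume.restrict (Ioo 0 T), D t = 0) ∧
      (∀ᵐ q ∂EulerMV.spaceTime T,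
        Y q.1 q.2
          = Measure.dirac
              (EulerMV.phasePoint F (r q.1 q.2) (Θ q.1 q.2) (U q.1 q.2))) :=
  EulerMV.weak_strong_uniqueness hT hreg hgibbs hstab hP hsol hpos hY hY₀
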